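/- Let $\kappa, c_v, \mathcal R_g, T_\infty, p_{\infty,*}, \rho_l, R_*>0$ and $\sigma,\mu_l\ge 0$, and put $\gamma = 1+\mathcal R_g/c_v$, $c_p=\gamma c_v$, $\rho_* = \frac{1}{\mathcal R_g T_\infty}\bigl(p_{\infty,*}+\frac{2\sigma}{R_*}\bigr)$, $p_*=\mathcal R_g T_\infty\rho_*$, $\chi=\frac{\kappa}{c_p\rho_*}$, $\bar\kappa=\chi/R_*^2$, $\vartheta(\gamma)=1-\gamma^{-1}$, $\Delta=\bigl(\frac{4\mu_l}{R_*}\bigr)^2-8\rho_l p_*$. Let $B_1$ be the unit ball of $\mathbb R^3$, let $L^2_y(B_1)$ be the space of profiles $f$ with $f(|x|)\in L^2(B_1)$, normed by $\|f(|\cdot|)\|_{L^2(B_1)}$, and let $\Delta_y=y^{-2}\partial_y(y^2\partial_y)$. Consider the linearization about the equilibrium bubble $(\rho_*,R_*)$, constrained to fixed mass, $$\partial_t\varrho(y,t)=\frac{\chi}{R_*^2}\Delta_y\varrho(y,t)+\frac1\gamma\,\partial_t\varrho(1,t),\qquad 0\le y\le 1,$$ $$\int_{B_1}\varrho(|x|,t)\,dx=-4\pi\frac{\rho_*}{R_*}\mathcal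 R(t),\qquad \varrho(1,t)=\frac{1}{\mathcal R_gT_\infty}\Bigl(-\frac{2\sigma}{R_*^2}\mathcal R+\frac{4\mu_l}{R_*}\dot{\mathcal R}+\rho_lR_*\ddot{\mathcal R}\Bigr)$$ for $t>0$, with initial data $\varrho(\cdot,0)=\varrho_0\in L^2_y(B_1)$, boundary value $\varrho(1,0)=z_0\in\mathbb R$, $\mathcal R(0)=\mathcal R_0$, $\dot{\mathcal R}(0)=\dot{\mathcal R}_0$, where $$\int_{B_1}\varrho_0(|x|)\,dx+4\pi\frac{\rho_*}{R_*}\mathcal R_0=0 .$$ A solution is understood in the $L^2$ sense: $\varrho\in C([0,\infty);L^2_y(B_1))\cap C^1((0,\infty);L^2_y(B_1))$; $z(t)=\varrho(1,t)$ is continuous on $[0,\infty)$ and $C^1$ on $(0,\infty)$; $\mathcal R\in C^1[0,\infty)$ is twice differentiable on $(0,\infty)$; for each $t>0$, $\varrho(\cdot,t)$ is continuous on $[0,1]$ with boundary value $z(t)$ and has a Laplacian in $L^2_y(B_1)$ in the weak sense (tested, after subtraction of $z(t)$, against smooth radial functions vanishing on $\partial B_1$); the equations hold for all $t>0$; and the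 initial data are attained. **Theorem.** For all such parameters and data the initial value problem has a unique solution, and it is global in time: $t\mapsto(\varrho(\cdot,t),\mathcal R(t))\in L^2_y(B_1)\times\mathbb R$ for all $t\ge0$. Moreover, there are an absolute constant $K$ and a function $E(\varepsilon,x)$ with $|E(\varepsilon,x)|\le Kx^{3/2}$ for all $\varepsilon\in(0,1)$, $x>0$, neither depending on the parameters or the data, such that for every choice of the parameters and every $\varepsilon\in(0,1)$ the number $$\beta=\min\Biggl\{\Biggl(1-\sqrt{\frac{\vartheta(\gamma)}{\frac{p_{\infty,*}R_*}{2p_{\infty,*}R_*+6\sigma}+\vartheta(\gamma)}}\Biggr)\pi^2\bar\kappa,\ \sqrt{\varepsilon\frac{2p_*}{\rho_lR_*^2}},\ \frac{2\mu_l}{\rho_lR_*^2}+\mathbf 1_{\Delta\le0}\frac{(1-\varepsilon)^2\vartheta(\gamma)p_*}{\pi^4\bar\kappa\rho_lR_*^2}\Bigl(\frac{4\pi^4}{90}+(1-\varepsilon)^{3/4}E(\varepsilon,x_*)\Bigr)-\mathbf 1_{\Delta>0}\frac{\sqrt\Delta}{2\rho_lR_*}\Biggr\},$$ with $x_*=\frac{1}{\pi^2\bar\kappa}\sqrt{\frac{2p_*}{\rho_lR_*^2}}$,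 is strictly positive, and for all initial data as above there is a constant $C_0$, depending on the initial data (and on the parameters and $\varepsilon$), such that the solution satisfies $$\|\varrho(\cdot,t)\|_{L^2_y(B_1)}+|\mathcal R(t)|+|\dot{\mathcal R}(t)|\le C_0e^{-\beta t}\qquad\text{for all }t>0 .$$ -/

import Mathlib

open MeasureTheory Set
open scoped ContDiff

noncomputable section

/-- The physical constants of the model, together with the radius of the spherical equilibrium
bubble about which the system is linearized. -/
structure BubbleParams where
  /-- thermal conductivity of the gas -/
  kappa : ℝ
  /-- heat capacity of the gas at constant volume -/
  cv : ℝ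
  /-- specific gas constant -/
  Rg : ℝ
  /-- far-field liquid temperature -/
  Tinf : ℝ
  /-- (constant) far-field liquid pressure -/
  pinf : ℝ
  /-- surface tension -/
  sigma : ℝ
  /-- dynamic viscosity of the liquid -/
  muL : ℝ
  /-- density of the liquid -/
  rhoL : ℝ
  /-- equilibrium bubble radius -/
  Rstar : ℝ
  kappa_pos : 0 < kappa
  cv_pos : 0 < cv
  Rg_pos : 0 < Rg
  Tinf_pos : 0 < Tinf
  pinf_pos : 0 < pinf
  sigma_nonneg : 0 ≤ sigma
  muL_nonneg : 0 ≤ muL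
  rhoL_pos : 0 < rhoL
  Rstar_pos : 0 < Rstar

namespace BubbleParams

variable (P : BubbleParams)

/-- The adiabatic constant `γ = 1 + Rg / c_v`. -/
def gam : ℝ := 1 + P.Rg / P.cv

/-- Heat capacity at constant pressure, `c_p = γ c_v`. -/
def cp : ℝ := P.gam * P.cv

/-- Equilibrium gas density: `Rg T∞ ρ_* = p_{∞,*} + 2σ / R_*`. -/
def rhoStar : ℝ := (P.pinf + 2 * P.sigma / P.Rstar) / (P.Rg * P.Tinf)

/-- Equilibrium gas pressure. -/
def pStar : ℝ := P.Rg * P.Tinf * P.rhoStar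

/-- Thermal diffusivity `χ = κ / (c_p ρ_*)`. -/
def chi : ℝ := P.kappa / (P.cp * P.rhoStar)

/-- `κ̄ = χ / R_*²`. -/
def kbar : ℝ := P.chi / P.Rstar ^ 2

/-- `ϑ(γ) = 1 - 1/γ`. -/
def theta : ℝ := 1 - P.gam⁻¹

/-- `Δ = (4 μ_l / R_*)² - 8 ρ_l p_*`. -/
def discr : ℝ := (4 * P.muL / P.Rstar) ^ 2 - 8 * P.rhoL * P.pStar

/-- The argument `(1 / (π² κ̄)) √(2 p_* / (ρ_l R_*²))` of the error term in the decay rate. -/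
def errArg : ℝ :=
  1 / (Real.pi ^ 2 * P.kbar) * Real.sqrt (2 * P.pStar / (P.rhoL * P.Rstar ^ 2))

/-- The decay rate `β`, as a function of `ε ∈ (0,1)` and of the value `e` of the error term. -/
def decayRate (ε e : ℝ) : ℝ :=
  min ((1 - Real.sqrt (P.theta /
        (P.pinf * P.Rstar / (2 * P.pinf * P.Rstar + 6 * P.sigma) + P.theta)))
        * Real.pi ^ 2 * P.kbar)
    (min (Real.sqrt (ε * (2 * P.pStar / (P.rhoL * P.Rstar ^ 2))))
      (2 * P.muL / (P.rhoL * P.Rstar ^ 2)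
        + (if P.discr ≤ 0 then
            (1 - ε) ^ 2 * P.theta * P.pStar / (Real.pi ^ 4 * P.kbar * P.rhoL * P.Rstar ^ 2)
              * (4 * Real.pi ^ 4 / 90 + (1 - ε) ^ (3 / 4 : ℝ) * e)
          else 0)
        - (if 0 < P.discr then Real.sqrt P.discr / (2 * P.rhoL * P.Rstar) else 0)))

end BubbleParams

/-- The law of `|x|` for Lebesgue measure on the unit ball `B₁ ⊆ ℝ³`, so that
`∫ f dν = ∫_{B₁} f(|x|) dx` for radial profiles `f`. -/
def radialMeasure : Measure ℝ :=
  Measure.map (fun x : EuclideanSpace ℝ (Fin 3) => ‖x‖)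
    ((volume : Measure (EuclideanSpace ℝ (Fin 3))).restrict (Metric.ball 0 1))

/-- `L²_y(B₁)`: profiles `f` of radial functions `x ↦ f(|x|)` in `L²(B₁)`, with the norm
`(∫_{B₁} f(|x|)² dx)^{1/2}`. -/
abbrev RadialL2 : Type := Lp ℝ 2 radialMeasure

/-- `Δ_y ψ = y⁻² ∂_y (y² ∂_y ψ)`. -/
def radialLaplacian (ψ : ℝ → ℝ) (y : ℝ) : ℝ :=
  deriv (fun r => r ^ 2 * deriv ψ r) y / y ^ 2

/-- `ψ(|x|)` is a smooth radial test function (smoothness of `x ↦ ψ(|x|)` at the origin is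
evenness of `ψ`) vanishing on the unit sphere. -/
structure IsRadialTest (ψ : ℝ → ℝ) : Prop where
  smooth : ContDiff ℝ ∞ ψ
  even : ∀ y, ψ (-y) = ψ y
  boundary : ψ 1 = 0

/-- The radial function `f` lies in `H²(B₁)`, has the boundary value `b` on the unit sphere, and
has the Laplacian `g ∈ L²(B₁)`, in the weak sense. -/
structure HasRadialLaplacian (f g : RadialL2) (b : ℝ) : Prop where
  boundary : ∃ F : ℝ → ℝ, ContinuousOn F (Icc 0 1) ∧ F 1 = b ∧ f =ᵐ[radialMeasure] F
  weak : ∀ ψ : ℝ → ℝ, IsRadialTest ψ →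
    ∫ y, (f y - b) * radialLaplacian ψ y ∂radialMeasure = ∫ y, g y * ψ y ∂radialMeasure

/-- Initial data `ϱ(·,0) ∈ L²`, boundary value `ϱ(1,0)`, `𝓡(0)` and `𝓡'(0)`. -/
structure BubbleData where
  dens : RadialL2
  bdry : ℝ
  rad : ℝ
  vel : ℝ

/-- The linearized fixed-mass constraint `∫_{B₁} ϱ₀(|x|) dx + 4π (ρ_*/R_*) 𝓡₀ = 0`. -/
def BubbleData.MassConstraint (P : BubbleParams) (d : BubbleData) : Prop :=
  (∫ y, d.dens y ∂radialMeasure) + 4 * Real.pi * (P.rhoStar / P.Rstar) * d.rad = 0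

/-- Global solution (in the `L²` setting) of the initial value problem for the mass-preserving
linearized system: `ϱ t` is the density perturbation, `z t = ϱ(1,t)` its boundary value, `𝓡 t`
the radius perturbation and `V t` its velocity `𝓡'(t)`. Values at negative times are irrelevant.
-/
structure IsLinearizedSolution (P : BubbleParams) (d : BubbleData)
    (ϱ : ℝ → RadialL2) (z 𝓡 V : ℝ → ℝ) : Prop where
  dens_cont : ContinuousOn ϱ (Ici 0)
  dens_c1 : ContDiffOn ℝ 1 ϱ (Ioi 0)
  bdry_cont : ContinuousOn z (Ici 0)
  bdry_c1 : ContDiffOn ℝ 1 z (Ioi 0)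
  vel_eq : ∀ t, 0 ≤ t → HasDerivWithinAt 𝓡 (V t) (Ici 0) t
  vel_cont : ContinuousOn V (Ici 0)
  vel_diff : DifferentiableOn ℝ V (Ioi 0)
  /-- `∂_t ϱ = (χ/R_*²) Δ_y ϱ + (1/γ) ∂_t ϱ(1,t)`, with `ϱ(1,t) = z(t)`. -/
  diffusion : ∀ t, 0 < t → ∃ g : RadialL2, HasRadialLaplacian (ϱ t) g (z t) ∧
    (deriv ϱ t : RadialL2) =ᵐ[radialMeasure]
      fun y => P.chi / P.Rstar ^ 2 * g y + 1 / P.gam * deriv z t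
  /-- `∫_{B₁} ϱ(|x|,t) dx = -4π (ρ_*/R_*) 𝓡(t)`. -/
  mass : ∀ t, 0 < t →
    (∫ y, ϱ t y ∂radialMeasure) = -(4 * Real.pi * (P.rhoStar / P.Rstar) * 𝓡 t)
  /-- `ϱ(1,t) = (1/(Rg T∞)) (-(2σ/R_*²) 𝓡 + (4μ_l/R_*) 𝓡' + ρ_l R_* 𝓡'')`. -/
  stress : ∀ t, 0 < t →
    z t = 1 / (P.Rg * P.Tinf) * (-(2 * P.sigma / P.Rstar ^ 2) * 𝓡 t
      + 4 * P.muL / P.Rstar * V t + P.rhoL * P.Rstar * deriv V t)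
  init_dens : ϱ 0 = d.dens
  init_bdry : z 0 = d.bdry
  init_rad : 𝓡 0 = d.rad
  init_vel : V 0 = d.vel

end

noncomputable section

/-! ### The radial measure -/

/-! Subtract the boundary value: u = ϱ - z·1 vanishes on the sphere and satisfies u' = κ̄Δu - ϑz'·1.
The mass constraint gives z = -m - cR, where m is the mean of u and c = 3ρ_*/R_*. With M the
mean-value projection, this becomes (I - ϑM)u' = κ̄Δu + ϑcV·1, coupled to a damped oscillator for
(R, V) forced by m.

Uniqueness is an energy argument (`linearized_eq_zero`): ‖u‖²/2 minus a multiple of m², plus a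
weighted oscillator energy, does not increase, and it is positive definite because ϑ < 1.

For existence, symmetrize with S = (I - ϑM)^{1/2}. The variable W = Su is driven by the negative of
an operator with inverse K = SGS, where G = (-κ̄Δ)⁻¹. K is compact, self-adjoint, positive and of
trace class (`exists_diagonalization`). In an eigenbasis of K the problem is a diagonal contraction
semigroup on ℓ² plus a bounded coupling to two scalar modes;
`IsContractionSemigroup.exists_perturbation` solves it by a Neumann series in an exponentially
weighted space. Parabolic smoothing and the sine expansion turn the mild solution into one with the
required regularity (`exists_coupled_solution`, `hasRadialLaplacian_of_inner_sineVec`).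

The perturbed semigroup is compact at time one. By Gelfand's formula its decay is controlled by the
eigenvalues of T(1), and each nonzero one comes from an exponential orbit e^{lt}x of the whole
semigroup (`exists_common_eigenvector`, `exists_exponential_bound`). Eliminating the thermal modes
shows that such an l with V ≠ 0 and Re l ≥ -β solves Q(l)W(l) = -3p_*, where Q is a mechanical
quadratic and, in this formula, W denotes the thermal transfer function `charW`
(`char_eq_of_eigenvector`).

That equation has no root with Re l ≥ -β (`char_ne`). The first entry of β keeps `charW` in a disc
so small that -Re Q > 2p_* + 2σ/R_* (`char_eq_parts`). A real root would then lie left of the larger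
zero of ρ_l R_*²x² + 4μ_l x + 2p_*, which needs Δ > 0. For a nonreal root the imaginary part
expresses -Re l exactly as viscous damping plus a positive thermal sum (`oscillatory_root`). When Δ
≤ 0, the second entry of β bounds |l| and hence that sum from below by ζ(4) = π⁴/90. The error
function E is chosen so that the bracket in β is exactly this lower bound. -/

theorem radialMeasure_eq_withDensity :
    radialMeasure = (volume.restrict (Ioo (0 : ℝ) 1)).withDensity
      (fun y => ((4 * Real.pi * y ^ 2).toNNReal : ENNReal)) := by
  have hdens : Measurable fun y : ℝ => (4 * Real.pi * y ^ 2).toNNReal := by fun_prop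
  have hint : IntegrableOn (fun y : ℝ => 4 * Real.pi * y ^ 2) (Ioo 0 1) :=
    ((by fun_prop : Continuous fun y : ℝ => 4 * Real.pi * y ^ 2).integrableOn_Icc
      (a := 0) (b := 1)).mono_set Ioo_subset_Icc_self
  have hfin : IsFiniteMeasure ((volume.restrict (Ioo (0 : ℝ) 1)).withDensity
      (fun y => ((4 * Real.pi * y ^ 2).toNNReal : ENNReal))) :=
    isFiniteMeasure_withDensity_ofReal hint.2
  have hball : volume (Metric.ball (0 : EuclideanSpace ℝ (Fin 3)) 1)
      = ENNReal.ofReal (Real.pi * 4 / 3) := by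
    simp [EuclideanSpace.volume_ball_fin_three]
  have : IsFiniteMeasure ((volume : Measure (EuclideanSpace ℝ (Fin 3))).restrict
      (Metric.ball 0 1)) := ⟨by simp [hball]⟩
  ext s hs
  have hnorm : Measurable fun x : EuclideanSpace ℝ (Fin 3) => ‖x‖ := measurable_norm
  have h1 : radialMeasure.real s
      = ∫ x : EuclideanSpace ℝ (Fin 3), (s ∩ Iio 1).indicator (fun _ => (1 : ℝ)) ‖x‖ := by
    rw [radialMeasure, measureReal_def, Measure.map_apply hnorm hs,
      Measure.restrict_apply (hnorm hs), ← measureReal_def, ← integral_indicator_one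
        ((hnorm hs).inter measurableSet_ball)]
    congr 1
    ext x
    have hx : x ∈ (fun x : EuclideanSpace ℝ (Fin 3) => ‖x‖) ⁻¹' s ∩ Metric.ball 0 1
        ↔ ‖x‖ ∈ s ∩ Iio 1 := by simp
    by_cases h : ‖x‖ ∈ s ∩ Iio 1
    · rw [indicator_of_mem h, indicator_of_mem (hx.2 h), Pi.one_apply]
    · rw [indicator_of_notMem h, indicator_of_notMem (mt hx.1 h)]
  have h2 : ((volume.restrict (Ioo (0 : ℝ) 1)).withDensity
      (fun y => ((4 * Real.pi * y ^ 2).toNNReal : ENNReal))).real s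
      = ∫ y in Ioo (0 : ℝ) 1, (4 * Real.pi * y ^ 2) * s.indicator (fun _ => (1 : ℝ)) y := by
    rw [← integral_indicator_one hs, integral_withDensity_eq_integral_smul hdens]
    refine integral_congr_ae (Filter.Eventually.of_forall fun y => ?_)
    simp only [NNReal.smul_def, smul_eq_mul, Real.coe_toNNReal _ (by positivity :
      0 ≤ 4 * Real.pi * y ^ 2)]
    rfl
  have h3 : radialMeasure.real s = ((volume.restrict (Ioo (0 : ℝ) 1)).withDensity
      (fun y => ((4 * Real.pi * y ^ 2).toNNReal : ENNReal))).real s := by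
    -- Polar coordinates: the surface factor is three times the volume 4π/3 of the ball.
    rw [h1, h2, integral_fun_norm_addHaar]
    simp only [measureReal_def, hball, finrank_euclideanSpace_fin, smul_eq_mul]
    rw [ENNReal.toReal_ofReal (by positivity), nsmul_eq_mul, ← integral_const_mul,
      ← integral_const_mul, ← integral_indicator measurableSet_Ioi,
      ← integral_indicator measurableSet_Ioo]
    congr 1
    ext y
    by_cases h0 : 0 < y <;> by_cases h1 : y < 1 <;> by_cases h2 : y ∈ s <;>
      simp [indicator, h0, h1, h2] <;> ring
  have : IsFiniteMeasure radialMeasure := by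
    unfold radialMeasure; infer_instance
  exact (ENNReal.toReal_eq_toReal_iff' (measure_ne_top _ _) (measure_ne_top _ _)).1 h3

instance : IsFiniteMeasure radialMeasure := by
  rw [radialMeasure_eq_withDensity]
  have hint : IntegrableOn (fun y : ℝ => 4 * Real.pi * y ^ 2) (Ioo 0 1) :=
    ((by fun_prop : Continuous fun y : ℝ => 4 * Real.pi * y ^ 2).integrableOn_Icc
      (a := 0) (b := 1)).mono_set Ioo_subset_Icc_self
  exact isFiniteMeasure_withDensity_ofReal hint.2

theorem integral_radialMeasure (f : ℝ → ℝ) :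
    ∫ y, f y ∂radialMeasure = ∫ y in Ioo (0 : ℝ) 1, (4 * Real.pi * y ^ 2) * f y := by
  rw [radialMeasure_eq_withDensity, integral_withDensity_eq_integral_smul (by fun_prop)]
  refine integral_congr_ae (Filter.Eventually.of_forall fun y => ?_)
  simp only [NNReal.smul_def, smul_eq_mul, Real.coe_toNNReal _ (by positivity :
      0 ≤ 4 * Real.pi * y ^ 2)]

theorem integrable_radialMeasure_iff {f : ℝ → ℝ} :
    Integrable f radialMeasure ↔ IntegrableOn (fun y => (4 * Real.pi * y ^ 2) * f y) (Ioo 0 1) := by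
  rw [radialMeasure_eq_withDensity, integrable_withDensity_iff_integrable_smul (by fun_prop)]
  refine integrable_congr (Filter.Eventually.of_forall fun y => ?_)
  simp only [NNReal.smul_def, smul_eq_mul, Real.coe_toNNReal _ (by positivity :
      0 ≤ 4 * Real.pi * y ^ 2)]

theorem ae_radialMeasure_iff {p : ℝ → Prop} :
    (∀ᵐ y ∂radialMeasure, p y) ↔ ∀ᵐ y ∂volume.restrict (Ioo (0 : ℝ) 1), p y := by
  rw [radialMeasure_eq_withDensity, ae_withDensity_iff (by fun_prop)]
  have h : ∀ᵐ y ∂volume.restrict (Ioo (0 : ℝ) 1), y ∈ Ioo (0 : ℝ) 1 :=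
    ae_restrict_mem measurableSet_Ioo
  constructor <;> intro H
  · filter_upwards [h, H] with y hy hp
    refine hp ?_
    have : 0 < 4 * Real.pi * y ^ 2 := by have := hy.1; positivity
    simpa using this
  · filter_upwards [H] with y hy _ using hy

/-- Functions continuous on the closed interval are square integrable for the radial measure. -/
theorem memLp_radialMeasure_of_continuous {f : ℝ → ℝ} (hf : Continuous f) :
    MemLp f 2 radialMeasure := by
  obtain ⟨C, hC⟩ := (isCompact_Icc (a := (0 : ℝ)) (b := 1)).exists_bound_of_continuousOn
    hf.continuousOn
  refine MemLp.of_bound hf.aestronglyMeasurable C ?_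
  rw [ae_radialMeasure_iff]
  filter_upwards [ae_restrict_mem measurableSet_Ioo] with y hy using hC y (Ioo_subset_Icc_self hy)

/-- The constant profile `1`. -/
def unitProfile : RadialL2 := Lp.const 2 radialMeasure (1 : ℝ)

theorem unitProfile_ae : unitProfile =ᵐ[radialMeasure] fun _ => (1 : ℝ) :=
  Lp.coeFn_const 2 radialMeasure (1 : ℝ)

theorem inner_radial (f g : RadialL2) : inner ℝ f g = ∫ y, f y * g y ∂radialMeasure := by
  rw [L2.inner_def]
  refine integral_congr_ae (Filter.Eventually.of_forall fun y => ?_)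
  simp [mul_comm]

theorem inner_unitProfile (f : RadialL2) : inner ℝ unitProfile f = ∫ y, f y ∂radialMeasure := by
  rw [inner_radial]
  refine integral_congr_ae ?_
  filter_upwards [unitProfile_ae] with y hy
  rw [hy, one_mul]

theorem norm_unitProfile_sq : ‖unitProfile‖ ^ 2 = 4 * Real.pi / 3 := by
  rw [← real_inner_self_eq_norm_sq, inner_unitProfile, integral_congr_ae unitProfile_ae,
    integral_radialMeasure, ← integral_Ioc_eq_integral_Ioo,
    ← intervalIntegral.integral_of_le zero_le_one]
  simp only [mul_one]
  rw [intervalIntegral.integral_const_mul, integral_pow]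
  norm_num
  ring

/-! ### The Dirichlet eigenfunctions -/

/-- At the origin, `sinc` is the divided slope of an analytic function, so its power series is that
of the sine shifted by one; elsewhere it is a quotient. -/
theorem Real.contDiff_sinc : ContDiff ℝ ∞ Real.sinc := by
  rw [contDiff_iff_contDiffAt]
  intro x
  by_cases hx : x = 0
  · subst hx
    obtain ⟨p, hp⟩ := (Real.analyticAt_sin : AnalyticAt ℝ Real.sin 0)
    rw [Real.sinc_eq_dslope]
    exact (hp.has_fpower_series_dslope_fslope.analyticAt).contDiffAt
  · have h : Real.sinc =ᶠ[nhds x] fun y => Real.sin y / y := by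
      filter_upwards [isOpen_ne.mem_nhds hx] with y hy using Real.sinc_of_ne_zero hy
    exact ContDiffAt.congr_of_eventuallyEq
      (Real.contDiff_sin.contDiffAt.div contDiffAt_id hx) h

/-- The wave number `(n+1)π`. -/
def waveNum (n : ℕ) : ℝ := (n + 1) * Real.pi

theorem waveNum_pos (n : ℕ) : 0 < waveNum n := by unfold waveNum; positivity

/-- The normalized radial Dirichlet eigenfunctions `sin((n+1)πy) / (√(2π) y)`. -/
def sineMode (n : ℕ) (y : ℝ) : ℝ :=
  waveNum n / Real.sqrt (2 * Real.pi) * Real.sinc (waveNum n * y)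

theorem mul_sineMode (n : ℕ) (y : ℝ) :
    y * sineMode n y = Real.sin (waveNum n * y) / Real.sqrt (2 * Real.pi) := by
  unfold sineMode
  have hn := (waveNum_pos n).ne'
  by_cases hy : y = 0
  · simp [hy]
  · rw [Real.sinc_of_ne_zero (mul_ne_zero hn hy)]
    field_simp

theorem contDiff_sineMode (n : ℕ) : ContDiff ℝ ∞ (sineMode n) :=
  contDiff_const.mul (Real.contDiff_sinc.comp (contDiff_const.mul contDiff_id))

theorem sin_waveNum (n : ℕ) : Real.sin (waveNum n) = 0 := by
  have := Real.sin_nat_mul_pi (n + 1)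
  unfold waveNum
  exact_mod_cast this

theorem isRadialTest_sineMode (n : ℕ) : IsRadialTest (sineMode n) where
  smooth := contDiff_sineMode n
  even y := by simp [sineMode, Real.sinc_neg]
  boundary := by
    have := mul_sineMode n 1
    simpa [sin_waveNum] using this

/-- The Dirichlet eigenfunctions as elements of `L²`. -/
def sineVec (n : ℕ) : RadialL2 :=
  (memLp_radialMeasure_of_continuous (contDiff_sineMode n).continuous).toLp (sineMode n)

theorem sineVec_ae (n : ℕ) : sineVec n =ᵐ[radialMeasure] sineMode n := MemLp.coeFn_toLp _

theorem inner_sineVec (n : ℕ) (f : RadialL2) :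
    inner ℝ (sineVec n) f = ∫ y, f y * sineMode n y ∂radialMeasure := by
  rw [inner_radial]
  refine integral_congr_ae ?_
  filter_upwards [sineVec_ae n] with y hy
  rw [hy, mul_comm]

theorem integral_sin_mul_sin (m n : ℕ) :
    ∫ y in (0 : ℝ)..1, Real.sin (waveNum m * y) * Real.sin (waveNum n * y)
      = if m = n then 1 / 2 else 0 := by
  have hcos : ∀ a : ℤ, a ≠ 0 → ∫ y in (0 : ℝ)..1, Real.cos (a * Real.pi * y) = 0 := by
    intro a ha
    have ha' : (a : ℝ) * Real.pi ≠ 0 := mul_ne_zero (by exact_mod_cast ha) Real.pi_ne_zero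
    rw [intervalIntegral.integral_comp_mul_left (fun x => Real.cos x) ha', integral_cos]
    simp [Real.sin_int_mul_pi]
  have hprod : ∀ y : ℝ, Real.sin (waveNum m * y) * Real.sin (waveNum n * y)
      = (1 / 2) * Real.cos (((m - n : ℤ) : ℝ) * Real.pi * y)
        - (1 / 2) * Real.cos (((m + n + 2 : ℤ) : ℝ) * Real.pi * y) := by
    intro y
    have e1 : ((m - n : ℤ) : ℝ) * Real.pi * y = waveNum m * y - waveNum n * y := by
      unfold waveNum; push_cast; ring
    have e2 : ((m + n + 2 : ℤ) : ℝ) * Real.pi * y = waveNum m * y + waveNum n * y := by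
      unfold waveNum; push_cast; ring
    rw [e1, e2, Real.cos_sub, Real.cos_add]
    ring
  simp_rw [hprod]
  rw [intervalIntegral.integral_sub (by apply Continuous.intervalIntegrable; fun_prop)
    (by apply Continuous.intervalIntegrable; fun_prop), intervalIntegral.integral_const_mul,
    intervalIntegral.integral_const_mul, hcos (m + n + 2) (by positivity)]
  split_ifs with h
  · subst h; simp
  · rw [hcos (m - n) (by omega)]; simp

/-- The weight y² absorbs one factor y from each mode, leaving the orthogonality of sines on (0,1).
-/
theorem orthonormal_sineVec : Orthonormal ℝ sineVec := by
  rw [orthonormal_iff_ite]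
  intro m n
  rw [inner_sineVec]
  have : ∫ y, (sineVec n) y * sineMode m y ∂radialMeasure
      = ∫ y, sineMode n y * sineMode m y ∂radialMeasure := by
    refine integral_congr_ae ?_
    filter_upwards [sineVec_ae n] with y hy
    rw [hy]
  rw [this, integral_radialMeasure, ← integral_Ioc_eq_integral_Ioo,
    ← intervalIntegral.integral_of_le zero_le_one]
  have h2 : ∀ y : ℝ, 4 * Real.pi * y ^ 2 * (sineMode n y * sineMode m y)
      = 2 * (Real.sin (waveNum m * y) * Real.sin (waveNum n * y)) := by
    intro y
    have : 4 * Real.pi * y ^ 2 * (sineMode n y * sineMode m y)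
      = 4 * Real.pi * (y * sineMode n y) * (y * sineMode m y) := by ring
    rw [this, mul_sineMode, mul_sineMode]
    have h0 : Real.sqrt (2 * Real.pi) ≠ 0 := by positivity
    have h1 : Real.sqrt (2 * Real.pi) ^ 2 = 2 * Real.pi := Real.sq_sqrt (by positivity)
    rw [show 4 * Real.pi * (Real.sin (waveNum n * y) / Real.sqrt (2 * Real.pi))
      * (Real.sin (waveNum m * y) / Real.sqrt (2 * Real.pi))
      = 4 * Real.pi * (Real.sin (waveNum n * y) * Real.sin (waveNum m * y))
        / Real.sqrt (2 * Real.pi) ^ 2 by field_simp, h1]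
    field_simp
    ring
  simp_rw [h2]
  rw [intervalIntegral.integral_const_mul, integral_sin_mul_sin]
  split_ifs <;> simp

/-- Completeness of the modes. Extend y f(y) to an odd function on (-1,1]: its cosine coefficients
vanish by parity and its sine coefficients by hypothesis, so Parseval's identity for period 2 kills
it. -/
theorem radial_eq_zero_of_inner_sineVec (f : RadialL2) (hf : ∀ n, inner ℝ (sineVec n) f = 0) :
    f = 0 := by
  have hsq : Integrable (fun y => f y ^ 2) radialMeasure :=
    (memLp_two_iff_integrable_sq (Lp.aestronglyMeasurable f)).1 (Lp.memLp f)
  have hfm : Measurable f := (Lp.stronglyMeasurable f).measurable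
  have hsq' : IntegrableOn (fun y => (y * f y) ^ 2) (Ioo 0 1) := by
    have := (integrable_radialMeasure_iff.1 hsq).const_mul (1 / (4 * Real.pi))
    refine this.congr (Filter.Eventually.of_forall fun y => ?_)
    have := Real.pi_ne_zero
    simp only; field_simp
  set O : ℝ → ℂ := fun x => ((x * f |x| : ℝ) : ℂ) with hO
  have hOm : Measurable O := by
    refine Complex.measurable_ofReal.comp (measurable_id.mul (hfm.comp measurable_norm))
  have hI01 : IntervalIntegrable (fun x => ‖O x‖ ^ 2) volume 0 1 := by
    rw [intervalIntegrable_iff_integrableOn_Ioo_of_le zero_le_one]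
    refine hsq'.congr_fun (fun x hx => ?_) measurableSet_Ioo
    simp only [hO, Complex.norm_real, Real.norm_eq_abs, sq_abs, abs_of_pos hx.1]
  have hI10 : IntervalIntegrable (fun x => ‖O x‖ ^ 2) volume (-1) 0 := by
    have := (IntervalIntegrable.iff_comp_neg (f := fun x => ‖O x‖ ^ 2) (a := -1) (b := 0)).2
    refine this ?_
    have e : (fun x => ‖O (-x)‖ ^ 2) = fun x => ‖O x‖ ^ 2 := by
      ext x; simp [hO]
    rw [e]
    simpa using hI01.symm
  have hOL : MemLp O 2 (volume.restrict (Ioc (-1) 1)) := by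
    rw [memLp_two_iff_integrable_sq_norm hOm.aestronglyMeasurable]
    exact (intervalIntegrable_iff_integrableOn_Ioc_of_le (by norm_num)).1 (hI10.trans hI01)
  have hOi : IntervalIntegrable O volume (-1) 1 := by
    rw [intervalIntegrable_iff_integrableOn_Ioc_of_le (by norm_num)]
    exact hOL.integrable (by norm_num)
  have hcoef : ∀ i : ℤ, fourierCoeffOn (by norm_num : (-1 : ℝ) < 1) O i = 0 := by
    intro i
    rw [fourierCoeffOn_eq_integral]
    set G : ℝ → ℂ := fun x => fourier (-i) (x : AddCircle ((1 : ℝ) - -1)) • O x with hG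
    have hGi : IntervalIntegrable G volume (-1) 1 := by
      have hc : Continuous fun x : ℝ => fourier (-i) (x : AddCircle ((1 : ℝ) - -1)) := by
        fun_prop
      simpa only [hG, smul_eq_mul] using hOi.continuousOn_mul hc.continuousOn
    have hG0 : IntervalIntegrable G volume 0 1 :=
      hGi.mono_set (by rw [uIcc_of_le (by norm_num), uIcc_of_le (by norm_num)]; exact Icc_subset_Icc (by norm_num) le_rfl)
    have hG1 : IntervalIntegrable G volume (-1) 0 :=
      hGi.mono_set (by rw [uIcc_of_le (by norm_num), uIcc_of_le (by norm_num)]; exact Icc_subset_Icc le_rfl (by norm_num))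
    have hG2 : IntervalIntegrable (fun x => G (-x)) volume 0 1 := by
      have := (IntervalIntegrable.iff_comp_neg (f := G) (a := -1) (b := 0)).1 hG1
      simpa using this.symm
    have e0 : ∫ x in (-1 : ℝ)..0, G x = ∫ x in (0 : ℝ)..1, G (-x) := by
      rw [intervalIntegral.integral_comp_neg]; simp
    rw [← intervalIntegral.integral_add_adjacent_intervals hG1 hG0, e0,
      ← intervalIntegral.integral_add hG2 hG0]
    have hsin : ∫ x in (0 : ℝ)..1, (x * f x) * Real.sin (i * Real.pi * x) = 0 := by
      have key : ∀ n : ℕ, ∫ x in (0 : ℝ)..1, (x * f x) * Real.sin (waveNum n * x) = 0 := by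
        intro n
        have h := hf n
        rw [inner_sineVec, integral_radialMeasure, ← integral_Ioc_eq_integral_Ioo,
          ← intervalIntegral.integral_of_le zero_le_one] at h
        have e : ∀ y : ℝ, 4 * Real.pi * y ^ 2 * (f y * sineMode n y)
            = (4 * Real.pi / Real.sqrt (2 * Real.pi)) * ((y * f y) * Real.sin (waveNum n * y)) := by
          intro y
          calc _ = 4 * Real.pi * (y * f y) * (y * sineMode n y) := by ring
            _ = _ := by rw [mul_sineMode]; ring
        simp_rw [e] at h
        rw [intervalIntegral.integral_const_mul] at h
        have h0 : 4 * Real.pi / Real.sqrt (2 * Real.pi) ≠ 0 := by positivity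
        exact (mul_eq_zero.1 h).resolve_left h0
      rcases lt_trichotomy i 0 with hi | hi | hi
      · have e : ∀ x : ℝ, (x * f x) * Real.sin (i * Real.pi * x)
            = -((x * f x) * Real.sin (waveNum ((-i).toNat - 1) * x)) := by
          intro x
          have h1 : (((-i).toNat - 1 : ℕ) : ℝ) + 1 = -i := by
            have : (((-i).toNat - 1 : ℕ) : ℤ) + 1 = -i := by omega
            exact_mod_cast this
          unfold waveNum
          rw [h1, ← mul_neg, ← Real.sin_neg]
          ring_nf
        simp_rw [e]
        rw [intervalIntegral.integral_neg, key, neg_zero]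
      · subst hi; simp
      · have h1 : ((i.toNat - 1 : ℕ) : ℝ) + 1 = i := by
          have : ((i.toNat - 1 : ℕ) : ℤ) + 1 = i := by omega
          exact_mod_cast this
        have := key (i.toNat - 1)
        unfold waveNum at this
        rwa [h1] at this
    -- Folding the integral onto (0,1) cancels the even part of the exponential, as `O` is odd.
    have e1 : ∫ x in (0 : ℝ)..1, (G (-x) + G x)
        = ∫ x in (0 : ℝ)..1, (-2 * Complex.I) * (((x * f x) * Real.sin (i * Real.pi * x) : ℝ) : ℂ) := by
      refine intervalIntegral.integral_congr fun x hx => ?_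
      rw [uIcc_of_le zero_le_one] at hx
      simp only [hG, hO, abs_neg, abs_of_nonneg hx.1, fourier_coe_apply, smul_eq_mul]
      push_cast
      rw [Complex.sin]
      have a1 : 2 * (Real.pi : ℂ) * Complex.I * (-i) * (-x) / (1 - -1) = i * Real.pi * x * Complex.I := by
        ring
      have a2 : 2 * (Real.pi : ℂ) * Complex.I * (-i) * x / (1 - -1) = -(i * Real.pi * x) * Complex.I := by
        ring
      rw [a1, a2]
      linear_combination (x * f x * (Complex.exp (-(i * Real.pi * x) * Complex.I)
        - Complex.exp (i * Real.pi * x * Complex.I)) : ℂ) * Complex.I_sq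
    rw [e1, intervalIntegral.integral_const_mul, intervalIntegral.integral_ofReal, hsin]
    simp
  have hsum := tsum_sq_fourierCoeffOn (by norm_num : (-1 : ℝ) < 1) hOL
  simp only [hcoef, norm_zero, ne_eq, OfNat.ofNat_ne_zero, not_false_eq_true, zero_pow,
    tsum_zero] at hsum
  have hzero : ∫ x in (-1 : ℝ)..1, ‖O x‖ ^ 2 = 0 := by
    have := hsum.symm
    rw [smul_eq_mul] at this
    exact (mul_eq_zero.1 this).resolve_left (by norm_num)
  have hz : ∫ x in (0 : ℝ)..1, ‖O x‖ ^ 2 = 0 := by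
    rw [← intervalIntegral.integral_add_adjacent_intervals hI10 hI01] at hzero
    have p1 : 0 ≤ ∫ x in (-1 : ℝ)..0, ‖O x‖ ^ 2 :=
      intervalIntegral.integral_nonneg (by norm_num) fun x _ => by positivity
    have p2 : 0 ≤ ∫ x in (0 : ℝ)..1, ‖O x‖ ^ 2 :=
      intervalIntegral.integral_nonneg (by norm_num) fun x _ => by positivity
    linarith
  have hnorm : ‖f‖ ^ 2 = 0 := by
    rw [← real_inner_self_eq_norm_sq, inner_radial, integral_radialMeasure]
    rw [intervalIntegral.integral_of_le zero_le_one, integral_Ioc_eq_integral_Ioo] at hz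
    have : ∫ y in Ioo (0 : ℝ) 1, 4 * Real.pi * y ^ 2 * (f y * f y)
        = ∫ y in Ioo (0 : ℝ) 1, 4 * Real.pi * ‖O y‖ ^ 2 := by
      refine setIntegral_congr_fun measurableSet_Ioo fun y hy => ?_
      simp only [hO, Complex.norm_real, Real.norm_eq_abs, sq_abs, abs_of_pos hy.1]
      ring
    rw [this, integral_const_mul, hz, mul_zero]
  simpa using hnorm

/-- The Hilbert basis of Dirichlet eigenfunctions. -/
def sineBasis : HilbertBasis ℕ ℝ RadialL2 :=
  HilbertBasis.mkOfOrthogonalEqBot orthonormal_sineVec (by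
    rw [eq_bot_iff]
    intro f hf
    rw [Submodule.mem_bot]
    refine radial_eq_zero_of_inner_sineVec f fun n => ?_
    exact (Submodule.mem_orthogonal _ _).1 hf _ (Submodule.subset_span ⟨n, rfl⟩))

theorem sineBasis_apply (n : ℕ) : sineBasis n = sineVec n := by
  simp [sineBasis]

/-! ### The Dirichlet Laplacian in the sine basis -/

/-- Multiplication by y conjugates the radial Laplacian in dimension three to the second derivative
on the line. -/
theorem mul_radialLaplacian {ψ : ℝ → ℝ} (hψ : ContDiff ℝ ∞ ψ) {y : ℝ} (hy : y ≠ 0) :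
    y * radialLaplacian ψ y = deriv (deriv fun r => r * ψ r) y := by
  have hd : Differentiable ℝ ψ := hψ.differentiable (by simp)
  have hd' : ContDiff ℝ ∞ (deriv ψ) := (contDiff_infty_iff_deriv.1 hψ).2
  have hdd : Differentiable ℝ (deriv ψ) := hd'.differentiable (by simp)
  have h1 : (deriv fun r => r * ψ r) = fun r => ψ r + r * deriv ψ r := by
    ext r
    have : HasDerivAt (fun r => r * ψ r) (1 * ψ r + r * deriv ψ r) r :=
      (hasDerivAt_id r).mul (hd r).hasDerivAt
    simpa using this.deriv
  have h2 : deriv (fun r => ψ r + r * deriv ψ r) y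
      = deriv ψ y + (deriv ψ y + y * deriv (deriv ψ) y) := by
    have : HasDerivAt (fun r => ψ r + r * deriv ψ r)
        (deriv ψ y + (1 * deriv ψ y + y * deriv (deriv ψ) y)) y :=
      (hd y).hasDerivAt.add ((hasDerivAt_id y).mul (hdd y).hasDerivAt)
    simpa using this.deriv
  have h3 : deriv (fun r => r ^ 2 * deriv ψ r) y
      = 2 * y * deriv ψ y + y ^ 2 * deriv (deriv ψ) y := by
    have : HasDerivAt (fun r => r ^ 2 * deriv ψ r)
        ((2 : ℕ) * y ^ (2 - 1) * deriv ψ y + y ^ 2 * deriv (deriv ψ) y) y :=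
      (hasDerivAt_pow 2 y).mul (hdd y).hasDerivAt
    simpa using this.deriv
  rw [h1, h2, radialLaplacian, h3]
  field_simp
  ring

theorem deriv_deriv_mul_sineMode (n : ℕ) (y : ℝ) :
    deriv (deriv fun r => r * sineMode n r) y = -(waveNum n) ^ 2 * (y * sineMode n y) := by
  have h1 : (fun r => r * sineMode n r)
      = fun r => Real.sin (waveNum n * r) / Real.sqrt (2 * Real.pi) := by
    ext r; exact mul_sineMode n r
  have hl : ∀ r : ℝ, HasDerivAt (fun r => waveNum n * r) (waveNum n) r := fun r => by
    simpa using (hasDerivAt_id r).const_mul (waveNum n)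
  have h2 : deriv (fun r => Real.sin (waveNum n * r) / Real.sqrt (2 * Real.pi))
      = fun r => Real.cos (waveNum n * r) * waveNum n / Real.sqrt (2 * Real.pi) := by
    ext r
    exact ((hl r).sin.div_const _).deriv
  rw [h1, h2, (((hl y).cos.mul_const _).div_const _).deriv, mul_sineMode]
  ring

theorem radialLaplacian_sineMode (n : ℕ) {y : ℝ} (hy : y ≠ 0) :
    radialLaplacian (sineMode n) y = -(waveNum n) ^ 2 * sineMode n y := by
  have h := mul_radialLaplacian (contDiff_sineMode n) hy
  rw [deriv_deriv_mul_sineMode] at h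
  exact mul_left_cancel₀ hy (by rw [h]; ring)

theorem ae_radialMeasure_pos : ∀ᵐ y ∂radialMeasure, (0 : ℝ) < y := by
  rw [ae_radialMeasure_iff]
  filter_upwards [ae_restrict_mem measurableSet_Ioo] with y hy using hy.1

theorem sub_smul_unitProfile_ae (f : RadialL2) (b : ℝ) :
    (f - b • unitProfile : RadialL2) =ᵐ[radialMeasure] fun y => f y - b := by
  filter_upwards [Lp.coeFn_sub f (b • unitProfile), Lp.coeFn_smul b unitProfile,
    unitProfile_ae] with y h1 h2 h3
  rw [h1, Pi.sub_apply, h2, Pi.smul_apply, h3]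
  simp

/-- The sine coefficients of a weak Laplacian. -/
theorem HasRadialLaplacian.inner_sineVec {f g : RadialL2} {b : ℝ}
    (h : HasRadialLaplacian f g b) (n : ℕ) :
    inner ℝ (sineVec n) g
      = -(waveNum n) ^ 2 * inner ℝ (sineVec n) (f - b • unitProfile) := by
  have hw := h.weak (sineMode n) (isRadialTest_sineMode n)
  rw [_root_.inner_sineVec, ← hw, _root_.inner_sineVec, ← integral_const_mul]
  refine integral_congr_ae ?_
  filter_upwards [ae_radialMeasure_pos, sub_smul_unitProfile_ae f b] with y hy hs
  rw [radialLaplacian_sineMode n hy.ne', hs]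
  ring

/-- The weight y² turns the square of the Laplacian into the square of (yψ)'', which is continuous;
no estimate at the origin is needed. -/
theorem memLp_radialLaplacian {ψ : ℝ → ℝ} (hψ : ContDiff ℝ ∞ ψ) :
    MemLp (radialLaplacian ψ) 2 radialMeasure := by
  have hm : Measurable (radialLaplacian ψ) := by
    unfold radialLaplacian
    exact (measurable_deriv _).div (by fun_prop)
  have hh : ContDiff ℝ ∞ fun r => r * ψ r := contDiff_id.mul hψ
  have hc : Continuous (deriv (deriv fun r => r * ψ r)) :=
    (contDiff_infty_iff_deriv.1 (contDiff_infty_iff_deriv.1 hh).2).2.continuous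
  rw [memLp_two_iff_integrable_sq hm.aestronglyMeasurable, integrable_radialMeasure_iff]
  have hc' : Continuous fun y => 4 * Real.pi * deriv (deriv fun r => r * ψ r) y ^ 2 := by fun_prop
  refine ((hc'.integrableOn_Icc (a := 0) (b := 1)).mono_set Ioo_subset_Icc_self).congr_fun
    (fun y hy => ?_) measurableSet_Ioo
  simp only
  rw [← mul_radialLaplacian hψ hy.1.ne']
  ring

/-- Two integrations by parts for yψ against the sine; both vanish at 0 and 1, so no boundary terms
survive. -/
theorem integral_sineMode_radialLaplacian {ψ : ℝ → ℝ} (hψ : IsRadialTest ψ) (n : ℕ) :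
    ∫ y, radialLaplacian ψ y * sineMode n y ∂radialMeasure
      = -(waveNum n) ^ 2 * ∫ y, ψ y * sineMode n y ∂radialMeasure := by
  set h : ℝ → ℝ := fun r => r * ψ r with hh
  have hs : ContDiff ℝ ∞ h := contDiff_id.mul hψ.smooth
  have hs1 : ContDiff ℝ ∞ (deriv h) := (contDiff_infty_iff_deriv.1 hs).2
  have hc2 : Continuous (deriv (deriv h)) := (contDiff_infty_iff_deriv.1 hs1).2.continuous
  have hd : ∀ y, HasDerivAt h (deriv h y) y := fun y => (hs.differentiable (by simp) y).hasDerivAt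
  have hd1 : ∀ y, HasDerivAt (deriv h) (deriv (deriv h) y) y :=
    fun y => (hs1.differentiable (by simp) y).hasDerivAt
  set κ := waveNum n
  have hl : ∀ r : ℝ, HasDerivAt (fun r => κ * r) κ r := fun r => by
    simpa using (hasDerivAt_id r).const_mul κ
  have e1 : ∀ y ∈ Ioo (0 : ℝ) 1, 4 * Real.pi * y ^ 2 * (radialLaplacian ψ y * sineMode n y)
      = 4 * Real.pi / Real.sqrt (2 * Real.pi) * (Real.sin (κ * y) * deriv (deriv h) y) := by
    intro y hy
    calc _ = 4 * Real.pi * (y * radialLaplacian ψ y) * (y * sineMode n y) := by ring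
      _ = _ := by rw [mul_sineMode, mul_radialLaplacian hψ.smooth hy.1.ne']; ring
  have e2 : ∀ y ∈ Ioo (0 : ℝ) 1, 4 * Real.pi * y ^ 2 * (ψ y * sineMode n y)
      = 4 * Real.pi / Real.sqrt (2 * Real.pi) * (Real.sin (κ * y) * h y) := by
    intro y hy
    calc _ = 4 * Real.pi * (y * ψ y) * (y * sineMode n y) := by ring
      _ = _ := by rw [mul_sineMode]; ring
  rw [integral_radialMeasure, integral_radialMeasure, setIntegral_congr_fun measurableSet_Ioo e1,
    setIntegral_congr_fun measurableSet_Ioo e2, ← integral_Ioc_eq_integral_Ioo,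
    ← integral_Ioc_eq_integral_Ioo, ← intervalIntegral.integral_of_le zero_le_one,
    ← intervalIntegral.integral_of_le zero_le_one, intervalIntegral.integral_const_mul,
    intervalIntegral.integral_const_mul]
  have i1 := intervalIntegral.integral_mul_deriv_eq_deriv_mul (a := 0) (b := 1)
    (u := fun y => Real.sin (κ * y)) (v := deriv h) (fun y _ => (hl y).sin) (fun y _ => hd1 y)
    (by apply Continuous.intervalIntegrable; fun_prop) (hc2.intervalIntegrable _ _)
  have i2 := intervalIntegral.integral_mul_deriv_eq_deriv_mul (a := 0) (b := 1)
    (u := fun y => Real.cos (κ * y) * κ) (v := h) (fun y _ => (hl y).cos.mul_const κ)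
    (fun y _ => hd y)
    (by apply Continuous.intervalIntegrable; fun_prop) (hs1.continuous.intervalIntegrable _ _)
  have h0 : h 0 = 0 := by simp [hh]
  have h1 : h 1 = 0 := by simp [hh, hψ.boundary]
  have hsin : Real.sin (κ * 1) = 0 := by rw [mul_one]; exact sin_waveNum n
  rw [i1, i2, h0, h1, hsin]
  have : ∫ x in (0 : ℝ)..1, -Real.sin (κ * x) * κ * κ * h x
      = -κ ^ 2 * ∫ x in (0 : ℝ)..1, Real.sin (κ * x) * h x := by
    rw [← intervalIntegral.integral_const_mul]
    refine intervalIntegral.integral_congr fun x _ => ?_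
    ring
  rw [this]
  simp
  ring

theorem summable_inv_waveNum_sq : Summable fun n => ((waveNum n) ^ 2)⁻¹ := by
  have h := ((summable_nat_add_iff 1).2 (Real.summable_nat_pow_inv.2 (by norm_num : 1 < 2))).mul_left
    ((Real.pi ^ 2)⁻¹)
  refine h.congr fun n => ?_
  unfold waveNum
  push_cast
  rw [mul_pow, mul_inv, mul_comm]

theorem summable_inner_sq (f : RadialL2) : Summable fun n => inner ℝ (sineVec n) f ^ 2 := by
  have := sineBasis.summable_inner_mul_inner f f
  refine this.congr fun n => ?_
  rw [sineBasis_apply, real_inner_comm, sq]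

/-- A function whose sine coefficients are those of an inverse Dirichlet Laplacian lies in its
domain. -/
theorem hasRadialLaplacian_of_inner_sineVec {f g : RadialL2} {b : ℝ}
    (h : ∀ n, inner ℝ (sineVec n) g
      = -(waveNum n) ^ 2 * inner ℝ (sineVec n) (f - b • unitProfile)) :
    HasRadialLaplacian f g b := by
  set u : RadialL2 := f - b • unitProfile with hu
  set c : ℕ → ℝ := fun n => inner ℝ (sineVec n) u with hc
  -- Since |c n|·ω = |g_n|/ω, the inequality ab ≤ a² + b² gives a summable bound. As |`sineMode n`|
  -- ≤ ω, the sine series of f - b converges uniformly.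
  have hcg : ∀ n, |c n| * waveNum n ≤ inner ℝ (sineVec n) g ^ 2 + ((waveNum n) ^ 2)⁻¹ := by
    intro n
    have hp := waveNum_pos n
    have e : |c n| * waveNum n = |inner ℝ (sineVec n) g| * (waveNum n)⁻¹ := by
      rw [h n, abs_mul, abs_neg, abs_of_pos (by positivity : 0 < waveNum n ^ 2)]
      simp only [hc]
      field_simp
    rw [e, ← inv_pow, ← sq_abs (inner ℝ (sineVec n) g)]
    nlinarith [sq_nonneg (|inner ℝ (sineVec n) g| - (waveNum n)⁻¹),
      abs_nonneg (inner ℝ (sineVec n) g), inv_pos.2 hp]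
  have hsum : Summable fun n => |c n| * waveNum n :=
    Summable.of_nonneg_of_le (fun n => mul_nonneg (abs_nonneg _) (waveNum_pos n).le) hcg
      ((summable_inner_sq g).add summable_inv_waveNum_sq)
  have hmode : ∀ n y, |sineMode n y| ≤ waveNum n := by
    intro n y
    unfold sineMode
    have h1 : 1 ≤ Real.sqrt (2 * Real.pi) := Real.one_le_sqrt.2 (by linarith [Real.pi_gt_three])
    rw [abs_mul, abs_of_nonneg (div_nonneg (waveNum_pos n).le (by positivity))]
    calc _ ≤ waveNum n / Real.sqrt (2 * Real.pi) * 1 := by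
          gcongr
          · exact div_nonneg (waveNum_pos n).le (by positivity)
          · exact Real.abs_sinc_le_one _
      _ ≤ waveNum n := by
          rw [mul_one]; exact div_le_self (waveNum_pos n).le h1
  have hterm : ∀ n y, ‖c n * sineMode n y‖ ≤ |c n| * waveNum n := by
    intro n y
    rw [Real.norm_eq_abs, abs_mul]
    exact mul_le_mul_of_nonneg_left (hmode n y) (abs_nonneg _)
  -- The continuous representative of f - b; it vanishes at 1 because every mode does.
  set U : ℝ → ℝ := fun y => ∑' n, c n * sineMode n y with hU
  have hUc : Continuous U :=
    continuous_tsum (fun n => continuous_const.mul (contDiff_sineMode n).continuous) hsum hterm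
  have hUL : MemLp U 2 radialMeasure := memLp_radialMeasure_of_continuous hUc
  have hint : ∀ φ : ℝ → ℝ, Continuous φ → Integrable φ radialMeasure := fun φ hφ =>
    (memLp_radialMeasure_of_continuous hφ).integrable (by norm_num)
  have hUu : hUL.toLp U = u := by
    refine sub_eq_zero.1 (radial_eq_zero_of_inner_sineVec _ fun m => ?_)
    rw [inner_sub_right, inner_sineVec]
    have e1 : ∫ y, (hUL.toLp U) y * sineMode m y ∂radialMeasure
        = ∫ y, ∑' n, c n * sineMode n y * sineMode m y ∂radialMeasure := by
      refine integral_congr_ae ?_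
      filter_upwards [hUL.coeFn_toLp] with y hy
      rw [hy, hU, tsum_mul_right]
    have hs := hasSum_integral_of_summable_integral_norm (μ := radialMeasure)
      (F := fun n y => c n * sineMode n y * sineMode m y)
      (fun n => hint _ ((continuous_const.mul (contDiff_sineMode n).continuous).mul
        (contDiff_sineMode m).continuous))
      (by
        refine Summable.of_nonneg_of_le (fun n => integral_nonneg fun y => norm_nonneg _)
          (fun n => ?_) (hsum.mul_right (waveNum m * radialMeasure.real univ))
        have hb : ∀ y, ‖c n * sineMode n y * sineMode m y‖ ≤ |c n| * waveNum n * waveNum m := by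
          intro y
          rw [norm_mul]
          exact mul_le_mul (hterm n y) (hmode m y) (norm_nonneg _)
            (mul_nonneg (abs_nonneg _) (waveNum_pos n).le)
        calc _ ≤ ∫ _, |c n| * waveNum n * waveNum m ∂radialMeasure :=
              integral_mono (hint _ ((continuous_const.mul (contDiff_sineMode n).continuous).mul
                (contDiff_sineMode m).continuous)).norm (integrable_const _) hb
          _ = _ := by rw [integral_const, smul_eq_mul]; ring)
    rw [e1, ← hs.tsum_eq]
    have e2 : ∀ n, ∫ y, c n * sineMode n y * sineMode m y ∂radialMeasure
        = if n = m then c n else 0 := by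
      intro n
      have h3 := (orthonormal_iff_ite.1 orthonormal_sineVec) m n
      rw [inner_sineVec] at h3
      have h4 : ∫ y, (sineVec n) y * sineMode m y ∂radialMeasure
          = ∫ y, sineMode n y * sineMode m y ∂radialMeasure := by
        refine integral_congr_ae ?_
        filter_upwards [sineVec_ae n] with y hy
        rw [hy]
      simp_rw [mul_assoc]
      rw [integral_const_mul, ← h4, h3]
      by_cases hnm : n = m
      · simp [hnm]
      · simp [hnm, Ne.symm hnm]
    simp_rw [e2]
    rw [tsum_ite_eq]
    simp [hc]
  have hUae : U =ᵐ[radialMeasure] fun y => f y - b := by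
    have h1 := hUL.coeFn_toLp
    rw [hUu] at h1
    exact h1.symm.trans (sub_smul_unitProfile_ae f b)
  refine ⟨⟨fun y => U y + b, (hUc.add continuous_const).continuousOn, ?_, ?_⟩, ?_⟩
  · have : U 1 = 0 := by
      rw [hU]
      simp [(isRadialTest_sineMode _).boundary]
    simp [this]
  · filter_upwards [hUae] with y hy
    rw [hy]; ring
  · intro ψ hψ
    have hL := memLp_radialLaplacian hψ.smooth
    have hψL := memLp_radialMeasure_of_continuous hψ.smooth.continuous
    have e1 : ∫ y, (f y - b) * radialLaplacian ψ y ∂radialMeasure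
        = inner ℝ u (hL.toLp (radialLaplacian ψ)) := by
      rw [inner_radial]
      refine integral_congr_ae ?_
      filter_upwards [sub_smul_unitProfile_ae f b, hL.coeFn_toLp] with y h1 h2
      rw [h1, h2]
    have e2 : ∫ y, g y * ψ y ∂radialMeasure = inner ℝ g (hψL.toLp ψ) := by
      rw [inner_radial]
      refine integral_congr_ae ?_
      filter_upwards [hψL.coeFn_toLp] with y h2
      rw [h2]
    -- By Parseval both sides are series over the modes, and the factor -ω² moves from the test
    -- function to u term by term.
    rw [e1, e2, ← sineBasis.tsum_inner_mul_inner u, ← sineBasis.tsum_inner_mul_inner g]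
    refine tsum_congr fun n => ?_
    have e3 : inner ℝ (sineVec n) (hL.toLp (radialLaplacian ψ))
        = -(waveNum n) ^ 2 * inner ℝ (sineVec n) (hψL.toLp ψ) := by
      rw [inner_sineVec, inner_sineVec]
      have e4 : ∫ y, (hL.toLp (radialLaplacian ψ)) y * sineMode n y ∂radialMeasure
          = ∫ y, radialLaplacian ψ y * sineMode n y ∂radialMeasure := by
        refine integral_congr_ae ?_
        filter_upwards [hL.coeFn_toLp] with y h2
        rw [h2]
      have e5 : ∫ y, (hψL.toLp ψ) y * sineMode n y ∂radialMeasure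
          = ∫ y, ψ y * sineMode n y ∂radialMeasure := by
        refine integral_congr_ae ?_
        filter_upwards [hψL.coeFn_toLp] with y h2
        rw [h2]
      rw [e4, e5, integral_sineMode_radialLaplacian hψ]
    rw [sineBasis_apply, e3, real_inner_comm (sineVec n) g, h n, real_inner_comm (sineVec n) u]
    ring

/-! ### Constants of the reduced model and their signs -/

namespace BubbleParams

variable (P : BubbleParams)

/-- The ratio `3 ρ_* / R_*` in the linearized mass constraint. -/
def massCoef : ℝ := 3 * (P.rhoStar / P.Rstar)

/-- The inertia coefficient `ρ_l R_*`. -/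
def inertia : ℝ := P.rhoL * P.Rstar

/-- The coefficient `Rg T∞ / (ρ_l R_*)`. -/
def gasCoef : ℝ := P.Rg * P.Tinf / P.inertia

/-- The squared frequency of isothermal oscillations. -/
def freqSq : ℝ := (P.Rg * P.Tinf * P.massCoef - 2 * P.sigma / P.Rstar ^ 2) / P.inertia

/-- The viscous damping coefficient. -/
def damping : ℝ := 4 * P.muL / P.Rstar / P.inertia

theorem gam_gt_one : 1 < P.gam := by
  have := div_pos P.Rg_pos P.cv_pos
  unfold gam; linarith

theorem gam_pos : 0 < P.gam := zero_lt_one.trans P.gam_gt_one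

theorem theta_pos : 0 < P.theta := by
  have := inv_lt_one_of_one_lt₀ P.gam_gt_one
  unfold theta; linarith

theorem theta_lt_one : P.theta < 1 := by
  have := inv_pos.2 P.gam_pos
  unfold theta; linarith

theorem one_sub_theta : 1 - P.theta = 1 / P.gam := by
  unfold theta; rw [one_div]; ring

theorem pressure_pos : 0 < P.pinf + 2 * P.sigma / P.Rstar := by
  have := div_nonneg (mul_nonneg zero_le_two P.sigma_nonneg) P.Rstar_pos.le
  linarith [P.pinf_pos]

theorem rhoStar_pos : 0 < P.rhoStar :=
  div_pos P.pressure_pos (mul_pos P.Rg_pos P.Tinf_pos)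

theorem pStar_eq : P.pStar = P.pinf + 2 * P.sigma / P.Rstar := by
  have h1 := P.Rg_pos.ne'
  have h2 := P.Tinf_pos.ne'
  unfold pStar rhoStar
  field_simp

theorem pStar_pos : 0 < P.pStar := by rw [pStar_eq]; exact P.pressure_pos

theorem kbar_pos : 0 < P.kbar := by
  have h1 := P.kappa_pos
  have h2 := P.rhoStar_pos
  have h3 := P.Rstar_pos
  have h4 := P.gam_pos
  have h5 := P.cv_pos
  unfold kbar chi cp
  positivity

theorem massCoef_pos : 0 < P.massCoef := by
  have h2 := P.rhoStar_pos
  have h3 := P.Rstar_pos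
  unfold massCoef
  positivity

theorem inertia_pos : 0 < P.inertia := mul_pos P.rhoL_pos P.Rstar_pos

theorem gasCoef_pos : 0 < P.gasCoef :=
  div_pos (mul_pos P.Rg_pos P.Tinf_pos) P.inertia_pos

theorem RgT_massCoef : P.Rg * P.Tinf * P.massCoef = 3 * P.pStar / P.Rstar := by
  unfold massCoef pStar; ring

/-- Gas compression outweighs surface tension: p_* already contains 2σ/R_*, so 3p_*/R_* - 2σ/R_*²
leaves 3p_∞/R_* + 4σ/R_*². -/
theorem freqSq_pos : 0 < P.freqSq := by
  refine div_pos ?_ P.inertia_pos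
  rw [RgT_massCoef, pStar_eq]
  have h1 := P.pinf_pos
  have h2 := P.sigma_nonneg
  have h3 := P.Rstar_pos
  have : 3 * (P.pinf + 2 * P.sigma / P.Rstar) / P.Rstar - 2 * P.sigma / P.Rstar ^ 2
      = 3 * P.pinf / P.Rstar + 4 * P.sigma / P.Rstar ^ 2 := by
    field_simp; ring
  rw [this]
  positivity

theorem damping_nonneg : 0 ≤ P.damping := by
  have h2 := P.muL_nonneg
  have h3 := P.Rstar_pos
  have h4 := P.inertia_pos
  unfold damping
  positivity

/-- The stress balance, solved for the acceleration. -/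
theorem stress_iff {z R V Vd : ℝ} :
    z = 1 / (P.Rg * P.Tinf) * (-(2 * P.sigma / P.Rstar ^ 2) * R
      + 4 * P.muL / P.Rstar * V + P.rhoL * P.Rstar * Vd) ↔
    Vd = -P.gasCoef * (-z - P.massCoef * R) - P.freqSq * R - P.damping * V := by
  have h1 := P.Rg_pos.ne'
  have h2 := P.Tinf_pos.ne'
  have h3 := P.Rstar_pos.ne'
  have h4 := P.rhoL_pos.ne'
  unfold gasCoef freqSq damping inertia
  constructor <;> intro h
  · have h5 : P.Rg * P.Tinf * z = -(2 * P.sigma / P.Rstar ^ 2) * R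
      + 4 * P.muL / P.Rstar * V + P.rhoL * P.Rstar * Vd := by
      rw [h]; field_simp
    have h6 : Vd = (P.Rg * P.Tinf * z + (2 * P.sigma / P.Rstar ^ 2) * R
      - 4 * P.muL / P.Rstar * V) / (P.rhoL * P.Rstar) := by
      rw [h5]; field_simp; ring
    rw [h6]
    field_simp
    ring
  · rw [h]
    field_simp
    ring

end BubbleParams

/-! ### Uniqueness by the energy method -/

/-- Dissipativity of the Dirichlet Laplacian, read off Parseval's identity. -/
theorem inner_le_zero_of_inner_sineVec {g u : RadialL2}
    (h : ∀ n, inner ℝ (sineVec n) g = -(waveNum n) ^ 2 * inner ℝ (sineVec n) u) :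
    inner ℝ g u ≤ 0 := by
  rw [← sineBasis.tsum_inner_mul_inner]
  refine tsum_nonpos fun n => ?_
  rw [sineBasis_apply, real_inner_comm, h n]
  nlinarith [mul_nonneg (sq_nonneg (waveNum n)) (sq_nonneg (inner ℝ (sineVec n) u))]

/-- The equations of the linearized problem at a single positive time, in terms of
`u = ϱ - ϱ(1)` (with time derivative `ud`), `z = ϱ(1)` (derivative `zd`), `𝓡` and `𝓡'`. -/
structure LinearizedAt (P : BubbleParams) (u ud : RadialL2) (z zd R V Vd : ℝ) : Prop where
  diffusion : ∃ g : RadialL2,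
    (∀ n, inner ℝ (sineVec n) g = -(waveNum n) ^ 2 * inner ℝ (sineVec n) u) ∧
    ud = P.kbar • g - (P.theta * zd) • unitProfile
  mass : inner ℝ unitProfile u = 4 * Real.pi / 3 * (-z - P.massCoef * R)
  stress : Vd = -P.gasCoef * (-z - P.massCoef * R) - P.freqSq * R - P.damping * V

theorem LinearizedAt.sub {P : BubbleParams} {u ud u' ud' : RadialL2}
    {z zd R V Vd z' zd' R' V' Vd' : ℝ}
    (h : LinearizedAt P u ud z zd R V Vd) (h' : LinearizedAt P u' ud' z' zd' R' V' Vd') :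
    LinearizedAt P (u - u') (ud - ud') (z - z') (zd - zd') (R - R') (V - V') (Vd - Vd') where
  diffusion := by
    obtain ⟨g, hg, e⟩ := h.diffusion
    obtain ⟨g', hg', e'⟩ := h'.diffusion
    refine ⟨g - g', fun n => ?_, ?_⟩
    · rw [inner_sub_right, inner_sub_right, hg, hg']; ring
    · rw [e, e', mul_sub, sub_smul, smul_sub]; abel
  mass := by rw [inner_sub_right, h.mass, h'.mass]; ring
  stress := by rw [h.stress, h'.stress]; ring

/-- Removing the boundary value changes the source coefficient from 1/γ to 1/γ - 1 = -ϑ. -/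
theorem IsLinearizedSolution.linearizedAt {P : BubbleParams} {d : BubbleData}
    {ϱ : ℝ → RadialL2} {z R V : ℝ → ℝ} (h : IsLinearizedSolution P d ϱ z R V) {t : ℝ}
    (ht : 0 < t) :
    LinearizedAt P (ϱ t - z t • unitProfile) (deriv ϱ t - deriv z t • unitProfile)
      (z t) (deriv z t) (R t) (V t) (deriv V t) where
  diffusion := by
    obtain ⟨g, hg, e⟩ := h.diffusion t ht
    refine ⟨g, hg.inner_sineVec, ?_⟩
    have e' : deriv ϱ t = P.kbar • g + (1 / P.gam * deriv z t) • unitProfile := by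
      refine Lp.ext ?_
      filter_upwards [e, Lp.coeFn_add (P.kbar • g) ((1 / P.gam * deriv z t) • unitProfile),
        Lp.coeFn_smul P.kbar g, Lp.coeFn_smul (1 / P.gam * deriv z t) unitProfile,
        unitProfile_ae] with y h1 h2 h3 h4 h5
      rw [h1, h2, Pi.add_apply, h3, h4, Pi.smul_apply, Pi.smul_apply, h5]
      simp [BubbleParams.kbar]
    rw [e', ← P.one_sub_theta, add_sub_assoc, ← sub_smul, sub_eq_add_neg (P.kbar • g), ← neg_smul]
    congr 2
    ring
  mass := by
    have h1 := norm_unitProfile_sq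
    rw [inner_sub_right, inner_smul_right, real_inner_self_eq_norm_sq, h1, inner_unitProfile,
      h.mass t ht, BubbleParams.massCoef]
    ring
  stress := P.stress_iff.1 (h.stress t ht)

theorem IsLinearizedSolution.hasDerivAt {P : BubbleParams} {d : BubbleData}
    {ϱ : ℝ → RadialL2} {z R V : ℝ → ℝ} (h : IsLinearizedSolution P d ϱ z R V) {t : ℝ}
    (ht : 0 < t) :
    HasDerivAt (fun s => ϱ s - z s • unitProfile) (deriv ϱ t - deriv z t • unitProfile) t ∧
    HasDerivAt z (deriv z t) t ∧ HasDerivAt R (V t) t ∧ HasDerivAt V (deriv V t) t := by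
  have hn : Ioi (0 : ℝ) ∈ nhds t := Ioi_mem_nhds ht
  have h1 : HasDerivAt ϱ (deriv ϱ t) t :=
    ((h.dens_c1.differentiableOn (by simp)).differentiableAt hn).hasDerivAt
  have h2 : HasDerivAt z (deriv z t) t :=
    ((h.bdry_c1.differentiableOn (by simp)).differentiableAt hn).hasDerivAt
  exact ⟨h1.sub (h2.smul_const _), h2, (h.vel_eq t ht.le).hasDerivAt (Ici_mem_nhds ht),
    (h.vel_diff.differentiableAt hn).hasDerivAt⟩

/-- A solution of the linearized problem with vanishing initial data vanishes. -/
theorem linearized_eq_zero {P : BubbleParams} {u : ℝ → RadialL2} {z R V : ℝ → ℝ}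
    {ud : ℝ → RadialL2} {zd Vd : ℝ → ℝ}
    (hu : ContinuousOn u (Ici 0)) (hz : ContinuousOn z (Ici 0)) (hR : ContinuousOn R (Ici 0))
    (hV : ContinuousOn V (Ici 0))
    (hu' : ∀ t, 0 < t → HasDerivAt u (ud t) t) (hz' : ∀ t, 0 < t → HasDerivAt z (zd t) t)
    (hR' : ∀ t, 0 < t → HasDerivAt R (V t) t) (hV' : ∀ t, 0 < t → HasDerivAt V (Vd t) t)
    (h : ∀ t, 0 < t → LinearizedAt P (u t) (ud t) (z t) (zd t) (R t) (V t) (Vd t))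
    (hu0 : u 0 = 0) (hz0 : z 0 = 0) (hR0 : R 0 = 0) (hV0 : V 0 = 0) :
    ∀ t, 0 ≤ t → u t = 0 ∧ z t = 0 ∧ R t = 0 ∧ V t = 0 := by
  have hc := P.gasCoef_pos
  have hm := P.massCoef_pos
  have hθ := P.theta_pos
  have hθ1 := P.theta_lt_one
  have hω := P.freqSq_pos
  have ha := P.damping_nonneg
  have hk := P.kbar_pos
  -- The weight for which the work of the gas on the oscillator cancels the term in mV left over
  -- from the thermal energy.
  set q : ℝ := 4 * Real.pi / 3 * (P.theta * P.massCoef / P.gasCoef) with hq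
  have hqpos : 0 < q := by positivity
  -- The m² term cancels the indefinite contribution of z'; the derivative that remains is κ̄⟨Δu, u⟩
  -- minus viscous dissipation.
  set En : ℝ → ℝ := fun t => inner ℝ (u t) (u t) / 2
    - P.theta * (2 * Real.pi / 3) * (-z t - P.massCoef * R t) ^ 2
    + q / 2 * (V t ^ 2 + P.freqSq * R t ^ 2) with hEn
  have hcont : ContinuousOn En (Ici 0) := by
    have := hu.inner (𝕜 := ℝ) hu
    simp only [hEn]
    fun_prop
  have hder : ∀ t, 0 < t → ∃ e, HasDerivAt En e t ∧ e ≤ 0 := by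
    intro t ht
    obtain ⟨g, hg, hud⟩ := (h t ht).diffusion
    have hmass := (h t ht).mass
    have hstress := (h t ht).stress
    have d1 := (hu' t ht).inner ℝ (hu' t ht)
    have d2 := ((hz' t ht).neg.sub ((hR' t ht).const_mul P.massCoef)).pow 2
    have d3 := ((hV' t ht).pow 2).add (((hR' t ht).pow 2).const_mul P.freqSq)
    refine ⟨_, ((d1.div_const 2).sub (d2.const_mul (P.theta * (2 * Real.pi / 3)))).add
      (d3.const_mul (q / 2)), ?_⟩
    have hdis := inner_le_zero_of_inner_sineVec hg
    have e1 : inner ℝ (u t) (ud t) = P.kbar * inner ℝ g (u t)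
        - P.theta * zd t * (4 * Real.pi / 3 * (-z t - P.massCoef * R t)) := by
      rw [hud, inner_sub_right, inner_smul_right, inner_smul_right, real_inner_comm g,
        real_inner_comm unitProfile, hmass]
    rw [real_inner_comm (u t) (ud t), e1, hstress]
    have hqc : q * P.gasCoef = 4 * Real.pi / 3 * P.theta * P.massCoef := by
      rw [hq]; field_simp
    simp only [Pi.sub_apply, Pi.neg_apply]
    norm_num
    have h5 : 0 ≤ q * P.damping * V t ^ 2 := by positivity
    have h6 : P.kbar * inner ℝ g (u t) ≤ 0 := mul_nonpos_of_nonneg_of_nonpos hk.le hdis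
    have key := congrArg (fun x => x * (z t + P.massCoef * R t) * V t) hqc
    nlinarith [h5, h6, key]
  have hanti : AntitoneOn En (Ici 0) := by
    refine antitoneOn_of_deriv_nonpos (convex_Ici 0) hcont ?_ ?_
    · rw [interior_Ici]
      intro t ht
      obtain ⟨e, he, _⟩ := hder t ht
      exact he.differentiableAt.differentiableWithinAt
    · rw [interior_Ici]
      intro t ht
      obtain ⟨e, he, hle⟩ := hder t ht
      rw [he.deriv]; exact hle
  have hmass0 : ∀ t, 0 ≤ t →
      inner ℝ unitProfile (u t) = 4 * Real.pi / 3 * (-z t - P.massCoef * R t) := by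
    intro t ht
    rcases ht.eq_or_lt with rfl | ht
    · simp [hu0, hz0, hR0]
    · exact (h t ht).mass
  intro t ht
  have hE : En t ≤ 0 := by
    have := hanti (mem_Ici.2 le_rfl) (mem_Ici.2 ht) ht
    simpa [hEn, hu0, hz0, hR0, hV0] using this
  set m := -z t - P.massCoef * R t with hmdef
  -- Cauchy–Schwarz against the constant profile, so the negative term costs at most the fraction ϑ
  -- < 1 of ‖u‖²/2.
  have hcs : (4 * Real.pi / 3) * m ^ 2 ≤ inner ℝ (u t) (u t) := by
    have h1 := abs_real_inner_le_norm unitProfile (u t)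
    rw [hmass0 t ht] at h1
    have h2 : (4 * Real.pi / 3 * m) ^ 2 ≤ (4 * Real.pi / 3) * ‖u t‖ ^ 2 := by
      rw [← norm_unitProfile_sq, ← mul_pow, ← sq_abs]
      rw [norm_unitProfile_sq]
      exact pow_le_pow_left₀ (abs_nonneg _) h1 2
    rw [real_inner_self_eq_norm_sq]
    have h3 : 0 < 4 * Real.pi / 3 := by positivity
    refine le_of_mul_le_mul_left ?_ h3
    calc _ = (4 * Real.pi / 3 * m) ^ 2 := by ring
      _ ≤ _ := h2
  have hEn' : En t = inner ℝ (u t) (u t) / 2 - P.theta * (2 * Real.pi / 3) * m ^ 2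
    + q / 2 * (V t ^ 2 + P.freqSq * R t ^ 2) := rfl
  have hI : 0 ≤ inner ℝ (u t) (u t) := real_inner_self_nonneg
  have h7 : P.theta * (4 * Real.pi / 3 * m ^ 2) ≤ P.theta * inner ℝ (u t) (u t) :=
    mul_le_mul_of_nonneg_left hcs hθ.le
  have h8 : (1 - P.theta) * inner ℝ (u t) (u t) / 2
      + q / 2 * (V t ^ 2 + P.freqSq * R t ^ 2) ≤ 0 := by
    linarith
  have h9 : 0 ≤ (1 - P.theta) * inner ℝ (u t) (u t) :=
    mul_nonneg (by linarith) hI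
  have h10 : 0 ≤ q * V t ^ 2 := by positivity
  have h11 : 0 ≤ q * P.freqSq * R t ^ 2 := by positivity
  have hu1 : u t = 0 := by
    have : (1 - P.theta) * inner ℝ (u t) (u t) = 0 := by linarith
    have := (mul_eq_zero.1 this).resolve_left (by linarith)
    exact inner_self_eq_zero.1 this
  have hV1 : V t = 0 := by
    have : q * V t ^ 2 = 0 := by linarith
    simpa using (mul_eq_zero.1 this).resolve_left hqpos.ne'
  have hR1 : R t = 0 := by
    have : q * P.freqSq * R t ^ 2 = 0 := by linarith
    simpa using (mul_eq_zero.1 this).resolve_left (mul_pos hqpos hω).ne'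
  have hz1 : z t = 0 := by
    have h12 := hmass0 t ht
    rw [hu1, inner_zero_right] at h12
    have h13 : 4 * Real.pi / 3 ≠ 0 := by positivity
    have h14 := (mul_eq_zero.1 h12.symm).resolve_left h13
    rw [hR1] at h14
    linarith
  exact ⟨hu1, hz1, hR1, hV1⟩

theorem IsLinearizedSolution.unique {P : BubbleParams} {d : BubbleData}
    {ϱ ϱ' : ℝ → RadialL2} {z R V z' R' V' : ℝ → ℝ}
    (h : IsLinearizedSolution P d ϱ z R V) (h' : IsLinearizedSolution P d ϱ' z' R' V') :
    ∀ t, 0 ≤ t → ϱ t = ϱ' t ∧ z t = z' t ∧ R t = R' t ∧ V t = V' t := by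
  have hRc : ContinuousOn R (Ici 0) := fun t ht => (h.vel_eq t ht).continuousWithinAt
  have hRc' : ContinuousOn R' (Ici 0) := fun t ht => (h'.vel_eq t ht).continuousWithinAt
  have key := linearized_eq_zero (P := P)
    (u := fun t => (ϱ t - z t • unitProfile) - (ϱ' t - z' t • unitProfile))
    (z := fun t => z t - z' t) (R := fun t => R t - R' t) (V := fun t => V t - V' t)
    ((h.dens_cont.sub (h.bdry_cont.smul continuousOn_const)).sub
      (h'.dens_cont.sub (h'.bdry_cont.smul continuousOn_const)))
    (h.bdry_cont.sub h'.bdry_cont) (hRc.sub hRc') (h.vel_cont.sub h'.vel_cont)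
    (fun t ht => (h.hasDerivAt ht).1.sub (h'.hasDerivAt ht).1)
    (fun t ht => (h.hasDerivAt ht).2.1.sub (h'.hasDerivAt ht).2.1)
    (fun t ht => (h.hasDerivAt ht).2.2.1.sub (h'.hasDerivAt ht).2.2.1)
    (fun t ht => (h.hasDerivAt ht).2.2.2.sub (h'.hasDerivAt ht).2.2.2)
    (fun t ht => (h.linearizedAt ht).sub (h'.linearizedAt ht))
    (by simp [h.init_dens, h'.init_dens, h.init_bdry, h'.init_bdry])
    (by simp [h.init_bdry, h'.init_bdry]) (by simp [h.init_rad, h'.init_rad])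
    (by simp [h.init_vel, h'.init_vel])
  intro t ht
  obtain ⟨h1, h2, h3, h4⟩ := key t ht
  have e2 := sub_eq_zero.1 h2
  refine ⟨?_, e2, sub_eq_zero.1 h3, sub_eq_zero.1 h4⟩
  have e1 := sub_eq_zero.1 h1
  simp only [e2] at e1
  exact sub_left_injective e1

/-! ### Bounded perturbations of contraction semigroups -/

section Perturbation

open scoped BoundedContinuousFunction

variable {X : Type*} [NormedAddCommGroup X] [NormedSpace ℂ X]

/-- A strongly continuous semigroup of contractions, extended to negative times by continuity. -/
structure IsContractionSemigroup (E : ℝ → X →L[ℂ] X) : Prop where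
  map_zero : E 0 = 1
  map_add : ∀ s t, 0 ≤ s → 0 ≤ t → ∀ x, E (s + t) x = E s (E t x)
  norm_le : ∀ t x, ‖E t x‖ ≤ ‖x‖
  cont : ∀ x, Continuous fun t => E t x

variable {E : ℝ → X →L[ℂ] X}

/-- The uniform bound upgrades strong continuity to joint continuity, which makes every Duhamel
integrand continuous. -/
theorem IsContractionSemigroup.continuous_uncurry (hE : IsContractionSemigroup E) :
    Continuous fun p : ℝ × X => E p.1 p.2 := by
  rw [continuous_iff_continuousAt]
  rintro ⟨t, x⟩
  rw [ContinuousAt, tendsto_iff_norm_sub_tendsto_zero]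
  have h1 : Filter.Tendsto (fun p : ℝ × X => ‖p.2 - x‖ + ‖E p.1 x - E t x‖) (nhds (t, x))
      (nhds 0) := by
    have hc : Continuous fun p : ℝ × X => ‖p.2 - x‖ + ‖E p.1 x - E t x‖ := by
      have := hE.cont x
      fun_prop
    have := hc.tendsto (t, x)
    simpa using this
  refine squeeze_zero (fun _ => norm_nonneg _) (fun p => ?_) h1
  calc ‖E p.1 p.2 - E t x‖ = ‖E p.1 (p.2 - x) + (E p.1 x - E t x)‖ := by
        rw [map_sub]; congr 1; abel
    _ ≤ _ := (norm_add_le _ _).trans (by gcongr; exact hE.norm_le _ _)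

theorem IsContractionSemigroup.continuous_comp (hE : IsContractionSemigroup E) {α : Type*}
    [TopologicalSpace α] {f : α → ℝ} {g : α → X} (hf : Continuous f) (hg : Continuous g) :
    Continuous fun a => E (f a) (g a) :=
  hE.continuous_uncurry.comp (hf.prodMk hg)

/-- `y` is a mild solution of `y' = A y + B y`, `y(0) = x`, where `A` generates `E`. -/
structure IsMildSolution (E : ℝ → X →L[ℂ] X) (B : X →L[ℂ] X) (x : X) (y : ℝ → X) : Prop where
  cont : Continuous y
  eq : ∀ t, 0 ≤ t → y t = E t x + ∫ s in (0 : ℝ)..t, E (t - s) (B (y s))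

/-- Subtracting the Duhamel formulas bounds the norm of the difference by ‖B‖ times its own
integral; Grönwall's inequality is applied to that integral. -/
theorem IsMildSolution.unique (hE : IsContractionSemigroup E) {B : X →L[ℂ] X} {x : X}
    {y₁ y₂ : ℝ → X} (h₁ : IsMildSolution E B x y₁) (h₂ : IsMildSolution E B x y₂) {t : ℝ}
    (ht : 0 ≤ t) : y₁ t = y₂ t := by
  set N : ℝ → ℝ := fun s => ‖y₁ s - y₂ s‖ with hN
  have hNc : Continuous N := (h₁.cont.sub h₂.cont).norm
  have hbound : ∀ s, 0 ≤ s → N s ≤ ‖B‖ * ∫ r in (0 : ℝ)..s, N r := by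
    intro s hs
    have hi : ∀ y : ℝ → X, Continuous y →
        IntervalIntegrable (fun r => E (s - r) (B (y r))) volume 0 s := fun y hy =>
      (hE.continuous_comp (by fun_prop) (B.continuous.comp hy)).intervalIntegrable _ _
    have e : y₁ s - y₂ s = ∫ r in (0 : ℝ)..s, E (s - r) (B (y₁ r - y₂ r)) := by
      rw [h₁.eq s hs, h₂.eq s hs, add_sub_add_left_eq_sub,
        ← intervalIntegral.integral_sub (hi _ h₁.cont) (hi _ h₂.cont)]
      simp only [map_sub]
    rw [hN]
    simp only
    rw [e, ← intervalIntegral.integral_const_mul]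
    refine intervalIntegral.norm_integral_le_of_norm_le hs
      (Filter.Eventually.of_forall fun r _ => ?_)
      ((continuous_const.mul hNc).intervalIntegrable _ _)
    exact (hE.norm_le _ _).trans (B.le_opNorm _)
  have hF : ∀ s ∈ Icc (0 : ℝ) t, ‖∫ r in (0 : ℝ)..s, N r‖ ≤ gronwallBound 0 ‖B‖ 0 (s - 0) := by
    refine norm_le_gronwallBound_of_norm_deriv_right_le (f' := N) ?_ ?_ (by simp) ?_
    · exact (intervalIntegral.continuous_primitive
        (fun a b => hNc.intervalIntegrable a b) 0).continuousOn
    · intro s _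
      exact (intervalIntegral.integral_hasDerivAt_right (hNc.intervalIntegrable _ _)
        (hNc.stronglyMeasurableAtFilter _ _) hNc.continuousAt).hasDerivWithinAt
    · intro s hs
      have h0 : 0 ≤ ∫ r in (0 : ℝ)..s, N r :=
        intervalIntegral.integral_nonneg hs.1 fun r _ => norm_nonneg _
      rw [Real.norm_eq_abs, Real.norm_eq_abs, abs_of_nonneg h0, add_zero,
        abs_of_nonneg (norm_nonneg _ : 0 ≤ N s)]
      exact hbound s hs.1
  have hF' := hF t ⟨ht, le_rfl⟩
  rw [gronwallBound_ε0, zero_mul] at hF'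
  have h1 := hbound t ht
  rw [norm_le_zero_iff.1 hF', mul_zero] at h1
  exact sub_eq_zero.1 (norm_le_zero_iff.1 h1)

/-- Uniform in t: this makes convolution with a weighted semigroup small for large η, and also
bounds forced parabolic modes. -/
theorem weighted_integral_bound {η t b : ℝ} (hη : 0 < η) (hb : 0 ≤ b) :
    ∫ s in (0 : ℝ)..t, Real.exp (-η * (t - s)) * b ≤ b / η := by
  have h : ∀ s ∈ uIcc 0 t, HasDerivAt (fun s => Real.exp (-η * (t - s)) * (b / η))
      (Real.exp (-η * (t - s)) * b) s := by
    intro s _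
    have h1 : HasDerivAt (fun s : ℝ => -η * (t - s)) (-η * (0 - 1)) s :=
      ((hasDerivAt_const s t).sub (hasDerivAt_id s)).const_mul (-η)
    convert! h1.exp.mul_const (b / η) using 1
    field_simp
    ring
  rw [intervalIntegral.integral_eq_sub_of_hasDerivAt h
    (by apply Continuous.intervalIntegrable; fun_prop)]
  have : 0 ≤ Real.exp (-η * (t - 0)) * (b / η) := by positivity
  simpa using this

/-- The weighted convolution operator whose fixed points are the mild solutions. -/
def duhamelMap (hE : IsContractionSemigroup E) (B : X →L[ℂ] X) {η : ℝ} (hη : 0 < η) :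
    (ℝ →ᵇ X) →L[ℂ] (ℝ →ᵇ X) :=
  have hcont : ∀ y : ℝ →ᵇ X, Continuous fun p : ℝ × ℝ =>
      (Real.exp (-η * (max p.1 0 - p.2)) : ℂ) • E (max p.1 0 - p.2) (B (y p.2)) := fun y => by
    have h1 := hE.continuous_comp (f := fun p : ℝ × ℝ => max p.1 0 - p.2)
      (g := fun p : ℝ × ℝ => B (y p.2)) (by fun_prop)
      (B.continuous.comp (y.continuous.comp continuous_snd))
    exact (by fun_prop : Continuous fun p : ℝ × ℝ =>
      ((Real.exp (-η * (max p.1 0 - p.2)) : ℝ) : ℂ)).smul h1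
  have hbound : ∀ (y : ℝ →ᵇ X) (t : ℝ), ‖∫ s in (0 : ℝ)..max t 0,
      (Real.exp (-η * (max t 0 - s)) : ℂ) • E (max t 0 - s) (B (y s))‖ ≤ ‖B‖ / η * ‖y‖ :=
    fun y t => by
      calc _ ≤ ∫ s in (0 : ℝ)..max t 0, Real.exp (-η * (max t 0 - s)) * (‖B‖ * ‖y‖) := by
            refine intervalIntegral.norm_integral_le_of_norm_le (le_max_right _ _)
              (Filter.Eventually.of_forall fun s _ => ?_)
              (by apply Continuous.intervalIntegrable; fun_prop)
            rw [norm_smul, Complex.norm_real, Real.norm_eq_abs, Real.abs_exp]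
            gcongr
            exact (hE.norm_le _ _).trans ((B.le_opNorm _).trans (by
              gcongr; exact y.norm_coe_le_norm s))
        _ ≤ ‖B‖ * ‖y‖ / η := weighted_integral_bound hη (by positivity)
        _ = ‖B‖ / η * ‖y‖ := by ring
  have hint : ∀ (y : ℝ →ᵇ X) (t : ℝ), IntervalIntegrable (fun s =>
      (Real.exp (-η * (max t 0 - s)) : ℂ) • E (max t 0 - s) (B (y s))) volume 0 (max t 0) :=
    fun y t => ((hcont y).comp (continuous_const.prodMk continuous_id)).intervalIntegrable _ _
  LinearMap.mkContinuous
    { toFun := fun y => BoundedContinuousFunction.ofNormedAddCommGroup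
        (fun t => ∫ s in (0 : ℝ)..max t 0,
          (Real.exp (-η * (max t 0 - s)) : ℂ) • E (max t 0 - s) (B (y s)))
        (intervalIntegral.continuous_parametric_intervalIntegral_of_continuous
          (f := fun t s => (Real.exp (-η * (max t 0 - s)) : ℂ) • E (max t 0 - s) (B (y s)))
          (hcont y) (by fun_prop)) (‖B‖ / η * ‖y‖) (hbound y)
      map_add' := fun y₁ y₂ => by
        ext t
        simp only [BoundedContinuousFunction.coe_ofNormedAddCommGroup,
          BoundedContinuousFunction.coe_add, Pi.add_apply]
        rw [← intervalIntegral.integral_add (hint y₁ t) (hint y₂ t)]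
        simp only [map_add, smul_add]
      map_smul' := fun c y => by
        ext t
        simp only [BoundedContinuousFunction.coe_ofNormedAddCommGroup,
          BoundedContinuousFunction.coe_smul, RingHom.id_apply]
        rw [← intervalIntegral.integral_smul]
        simp only [map_smul, smul_comm c] }
    (‖B‖ / η) (fun y => by
      refine (BoundedContinuousFunction.norm_le (by positivity)).2 fun t => ?_
      exact hbound y t)

theorem duhamelMap_apply (hE : IsContractionSemigroup E) (B : X →L[ℂ] X) {η : ℝ} (hη : 0 < η)
    (y : ℝ →ᵇ X) (t : ℝ) : duhamelMap hE B hη y t = ∫ s in (0 : ℝ)..max t 0,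
      (Real.exp (-η * (max t 0 - s)) : ℂ) • E (max t 0 - s) (B (y s)) := rfl

theorem norm_duhamelMap_le (hE : IsContractionSemigroup E) (B : X →L[ℂ] X) {η : ℝ} (hη : 0 < η) :
    ‖duhamelMap hE B hη‖ ≤ ‖B‖ / η := by
  unfold duhamelMap
  exact LinearMap.mkContinuous_norm_le _ (by positivity) _

/-- The weighted orbit map. -/
def orbitMap (hE : IsContractionSemigroup E) {η : ℝ} (hη : 0 < η) : X →L[ℂ] (ℝ →ᵇ X) :=
  have hbound : ∀ (x : X) (t : ℝ),
      ‖(Real.exp (-η * max t 0) : ℂ) • E (max t 0) x‖ ≤ 1 * ‖x‖ := fun x t => by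
    rw [norm_smul, Complex.norm_real, Real.norm_eq_abs, Real.abs_exp]
    gcongr
    · exact Real.exp_le_one_iff.2 (by nlinarith [le_max_right t 0])
    · exact hE.norm_le _ _
  LinearMap.mkContinuous
    { toFun := fun x => BoundedContinuousFunction.ofNormedAddCommGroup
        (fun t => (Real.exp (-η * max t 0) : ℂ) • E (max t 0) x)
        ((by fun_prop : Continuous fun t : ℝ => ((Real.exp (-η * max t 0) : ℝ) : ℂ)).smul
          ((hE.cont x).comp (by fun_prop))) (1 * ‖x‖) (hbound x)
      map_add' := fun x₁ x₂ => by ext t; simp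
      map_smul' := fun c x => by
        ext t
        simp [smul_comm c] }
    1 (fun x => (BoundedContinuousFunction.norm_le (by positivity)).2 fun t => hbound x t)

theorem orbitMap_apply (hE : IsContractionSemigroup E) {η : ℝ} (hη : 0 < η) (x : X) (t : ℝ) :
    orbitMap hE hη x t = (Real.exp (-η * max t 0) : ℂ) • E (max t 0) x := rfl

variable [CompleteSpace X]

/-- A bounded perturbation of the generator of a contraction semigroup generates a semigroup. -/
theorem IsContractionSemigroup.exists_perturbation (hE : IsContractionSemigroup E)
    (B : X →L[ℂ] X) : ∃ T : ℝ → X →L[ℂ] X,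
      (∀ x, IsMildSolution E B x fun t => T t x) ∧
      (∃ C η : ℝ, 0 ≤ C ∧ 0 < η ∧ ∀ t, 0 ≤ t → ‖T t‖ ≤ C * Real.exp (η * t)) ∧
      (∀ s t, 0 ≤ s → 0 ≤ t → T (t + s) = T t * T s) := by
  -- Any weight exceeding ‖B‖ makes the Duhamel map a strict contraction, so I - Φ is invertible by
  -- a Neumann series.
  set η : ℝ := ‖B‖ + 1 with hηdef
  have hη : 0 < η := by positivity
  set Φ := duhamelMap hE B hη with hΦ
  have hΦ1 : ‖Φ‖ < 1 := (norm_duhamelMap_le hE B hη).trans_lt (by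
    rw [div_lt_one hη]; linarith)
  set U := Units.oneSub Φ hΦ1 with hU
  set S : X →L[ℂ] (ℝ →ᵇ X) := (↑U⁻¹ : (ℝ →ᵇ X) →L[ℂ] (ℝ →ᵇ X)).comp (orbitMap hE hη) with hS
  have hSeq : ∀ x, S x = orbitMap hE hη x + Φ (S x) := by
    intro x
    have h1 : (U : (ℝ →ᵇ X) →L[ℂ] (ℝ →ᵇ X)) * ↑U⁻¹ = 1 := U.mul_inv
    have h2 := congrArg (fun A => A (orbitMap hE hη x)) h1
    have h3 : (U : (ℝ →ᵇ X) →L[ℂ] (ℝ →ᵇ X)) = 1 - Φ := rfl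
    rw [h3] at h2
    have h4 : S x - Φ (S x) = orbitMap hE hη x := h2
    rw [← h4]; abel
  set T : ℝ → X →L[ℂ] X := fun t => (Real.exp (η * max t 0) : ℂ) •
    (BoundedContinuousFunction.evalCLM ℂ t).comp S with hT
  have hTapp : ∀ t x, T t x = (Real.exp (η * max t 0) : ℂ) • S x t := fun t x => rfl
  have hmild : ∀ x, IsMildSolution E B x fun t => T t x := by
    intro x
    refine ⟨?_, fun t ht => ?_⟩
    · simp only [hTapp]
      exact (by fun_prop : Continuous fun t : ℝ => ((Real.exp (η * max t 0) : ℝ) : ℂ)).smul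
        (S x).continuous
    · simp only [hTapp]
      rw [hSeq x, BoundedContinuousFunction.add_apply, hΦ, duhamelMap_apply, orbitMap_apply,
        max_eq_left ht, ← hSeq x, smul_add, smul_smul, ← intervalIntegral.integral_smul]
      have e0 : (Real.exp (η * t) : ℂ) * (Real.exp (-η * t) : ℂ) = 1 := by
        rw [← Complex.ofReal_mul, ← Real.exp_add]
        simp
      rw [e0, one_smul]
      congr 1
      refine intervalIntegral.integral_congr fun s hs => ?_
      rw [uIcc_of_le ht] at hs
      rw [max_eq_left hs.1, map_smul, map_smul, smul_smul]
      congr 1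
      rw [← Complex.ofReal_mul, ← Real.exp_add]
      congr 2
      ring
  refine ⟨T, hmild, ⟨‖S‖, η, norm_nonneg _, hη, fun t ht => ?_⟩, fun s t hs ht => ?_⟩
  · refine ContinuousLinearMap.opNorm_le_bound _ (by positivity) fun x => ?_
    rw [hTapp, norm_smul, Complex.norm_real, Real.norm_eq_abs, Real.abs_exp, max_eq_left ht]
    calc _ ≤ Real.exp (η * t) * (‖S‖ * ‖x‖) := by
          gcongr
          exact ((S x).norm_coe_le_norm t).trans (S.le_opNorm x)
      _ = _ := by ring
  · ext x
    have hc : Continuous fun r => T r x := (hmild x).cont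
    -- The semigroup law follows from uniqueness: the shifted orbit is a mild solution from T(s)x.
    -- The `max` ensures that negative r, where the equation says nothing, does no harm.
    have hshift : IsMildSolution E B (T s x) fun r => T (max r 0 + s) x := by
      refine ⟨hc.comp (by fun_prop), fun r hr => ?_⟩
      simp only [max_eq_left hr]
      have hi : ∀ a b, IntervalIntegrable (fun q => E (r + s - q) (B (T q x))) volume a b :=
        fun a b => (hE.continuous_comp (by fun_prop) (B.continuous.comp hc)).intervalIntegrable _ _
      rw [(hmild x).eq (r + s) (by positivity),
        ← intervalIntegral.integral_add_adjacent_intervals (hi 0 s) (hi s (r + s)), ← add_assoc]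
      have e1 : ∫ q in s..(r + s), E (r + s - q) (B (T q x))
          = ∫ q in (0 : ℝ)..r, E (r - q) (B (T (max q 0 + s) x)) := by
        have h1 := intervalIntegral.integral_comp_add_right (a := 0) (b := r)
          (fun q => E (r + s - q) (B (T q x))) s
        rw [zero_add] at h1
        rw [← h1]
        refine intervalIntegral.integral_congr fun q hq => ?_
        rw [uIcc_of_le hr] at hq
        simp only [max_eq_left hq.1]
        congr 2
        ring
      have e2 : ∫ q in (0 : ℝ)..s, E (r + s - q) (B (T q x))
          = E r (∫ q in (0 : ℝ)..s, E (s - q) (B (T q x))) := by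
        rw [← ContinuousLinearMap.intervalIntegral_comp_comm]
        · refine intervalIntegral.integral_congr fun q hq => ?_
          rw [uIcc_of_le hs] at hq
          rw [← hE.map_add r (s - q) hr (by linarith [hq.2])]
          congr 2
          ring
        · exact (hE.continuous_comp (by fun_prop) (B.continuous.comp hc)).intervalIntegrable _ _
      have e3 : T s x = E s x + ∫ q in (0 : ℝ)..s, E (s - q) (B (T q x)) := (hmild x).eq s hs
      rw [e1, e2, hE.map_add r s hr hs, e3, (E r).map_add]
    have := hshift.unique hE (hmild (T s x)) ht
    simpa [max_eq_left ht] using this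

end Perturbation

/-! ### Diagonalization of compact self-adjoint operators -/

section Diagonalization

universe u

theorem inner_eq_zero_of_hilbertBasis {W : Type*} [NormedAddCommGroup W] [InnerProductSpace ℝ W] {k : Type*} (b : HilbertBasis k ℝ W) (φ : W →L[ℝ] ℝ)
    (h : ∀ i, φ (b i) = 0) (e : W) : φ e = 0 := by
  have h1 := (b.hasSum_repr e).mapL φ
  simp only [map_smul, h, smul_zero] at h1
  exact h1.unique hasSum_zero

/-- Concatenate Hilbert bases of the subspaces. A vector orthogonal to all of them is orthogonal to
every subspace, hence zero. -/
theorem exists_hilbertBasis_of_orthogonalFamily {H : Type u} [NormedAddCommGroup H]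
    [InnerProductSpace ℝ H] [CompleteSpace H] {ι : Type} (V : ι → Submodule ℝ H)
    (hc : ∀ i, CompleteSpace (V i))
    (hV : OrthogonalFamily ℝ (fun i => V i) fun i => (V i).subtypeₗᵢ) (hbot : (⨆ i, V i)ᗮ = ⊥) :
    ∃ (J : Type u) (g : HilbertBasis J ℝ H) (s : J → ι), ∀ j, g j ∈ V (s j) := by
  have hex : ∀ i, ∃ (w : Set (V i)), Nonempty (HilbertBasis w ℝ (V i)) := fun i =>
    let ⟨w, b, _⟩ := exists_hilbertBasis ℝ (V i)
    ⟨w, ⟨b⟩⟩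
  choose w hw using hex
  let b := fun i => (hw i).some
  let v : (Σ i, w i) → H := fun a => (b a.1 a.2 : H)
  have hon : Orthonormal ℝ v := hV.orthonormal_sigma_orthonormal fun i => (b i).orthonormal
  have hspan : (Submodule.span ℝ (Set.range v))ᗮ = ⊥ := by
    rw [eq_bot_iff, ← hbot]
    intro x hx
    rw [Submodule.mem_orthogonal]
    suffices h : (⨆ i, V i) ≤ (Submodule.span ℝ {x})ᗮ by
      intro u hu
      rw [real_inner_comm]
      exact (Submodule.mem_orthogonal _ _).1 (h hu) x (Submodule.mem_span_singleton_self x)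
    refine iSup_le fun i e he => ?_
    rw [Submodule.mem_orthogonal_singleton_iff_inner_right]
    refine inner_eq_zero_of_hilbertBasis (b i) ((innerSL ℝ x).comp (V i).subtypeL) (fun k => ?_) ⟨e, he⟩
    have h4 : inner ℝ (v ⟨i, k⟩) x = 0 :=
      (Submodule.mem_orthogonal _ _).1 hx (v ⟨i, k⟩) (Submodule.subset_span ⟨_, rfl⟩)
    rw [real_inner_comm] at h4
    exact h4
  let g : HilbertBasis (Σ i, w i) ℝ H := HilbertBasis.mkOfOrthogonalEqBot hon hspan
  have hg : ∀ a, g a = v a := fun a => congrFun (HilbertBasis.coe_mkOfOrthogonalEqBot hon hspan) a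
  refine ⟨Σ i, w i, g, Sigma.fst, fun a => ?_⟩
  rw [hg a]
  exact (b a.1 a.2).2

variable {H : Type u} [NormedAddCommGroup H] [InnerProductSpace ℝ H]

/-- The eigenspaces, the kernel included, are closed and mutually orthogonal, and by the spectral
theorem their span is dense. -/
theorem exists_hilbertBasis_eigenvectors [CompleteSpace H] (K : H →L[ℝ] H)
    (hK : IsCompactOperator K) (hs : (K : H →ₗ[ℝ] H).IsSymmetric) :
    ∃ (J : Type u) (g : HilbertBasis J ℝ H) (κ : J → ℝ), ∀ j, K (g j) = κ j • g j := by
  have hclosed : ∀ μ : ℝ, IsClosed (Module.End.eigenspace (K : H →ₗ[ℝ] H) μ : Set H) := by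
    intro μ
    have e : (Module.End.eigenspace (K : H →ₗ[ℝ] H) μ : Set H) = {x | K x = μ • x} := by
      ext x
      exact Module.End.mem_eigenspace_iff
    rw [e]
    exact isClosed_eq K.continuous (continuous_const_smul μ)
  obtain ⟨J, g, κ, h⟩ := exists_hilbertBasis_of_orthogonalFamily
    (fun μ : ℝ => Module.End.eigenspace (K : H →ₗ[ℝ] H) μ)
    (fun μ => (hclosed μ).completeSpace_coe) hs.orthogonalFamily_eigenspaces
    (ContinuousLinearMap.orthogonalComplement_iSup_eigenspaces_eq_bot hK hs)
  exact ⟨J, g, κ, fun j => Module.End.mem_eigenspace_iff.1 (h j)⟩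

/-- The rank-one operator `x ↦ ⟪v, x⟫ v`. -/
def rankOneSelf (v : H) : H →L[ℝ] H := (innerSL ℝ v).smulRight v

theorem rankOneSelf_apply (v x : H) : rankOneSelf v x = inner ℝ v x • v := rfl

theorem norm_rankOneSelf_le (v : H) : ‖rankOneSelf v‖ ≤ ‖v‖ * ‖v‖ := by
  unfold rankOneSelf
  rw [ContinuousLinearMap.norm_smulRight_apply, innerSL_apply_norm]

theorem isCompactOperator_rankOneSelf (v : H) : IsCompactOperator (rankOneSelf v) :=
  (isCompactOperator_of_locallyCompactSpace_rng ((1 : ℝ →L[ℝ] ℝ).smulRight v)).comp_clm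
    (innerSL ℝ v)

/-- The operator with eigenvalues `c n` in the Hilbert basis `e`. -/
def diagOp (e : HilbertBasis ℕ ℝ H) (c : ℕ → ℝ) : H →L[ℝ] H := ∑' n, c n • rankOneSelf (e n)

/-- The symmetric rank-one perturbation `x - τ ⟪p, x⟫ p` of the identity. -/
def rankOnePerturb (τ : ℝ) (p : H) : H →L[ℝ] H := 1 - τ • rankOneSelf p

theorem rankOnePerturb_apply (τ : ℝ) (p x : H) :
    rankOnePerturb τ p x = x - (τ * inner ℝ p x) • p := by
  simp [rankOnePerturb, rankOneSelf_apply, smul_smul]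

theorem inner_rankOnePerturb (τ : ℝ) (p x y : H) :
    inner ℝ (rankOnePerturb τ p x) y = inner ℝ x (rankOnePerturb τ p y) := by
  rw [rankOnePerturb_apply, rankOnePerturb_apply, inner_sub_left, inner_sub_right,
    inner_smul_left, inner_smul_right, real_inner_comm p x]
  simp only [conj_trivial]
  ring

/-- Expanding the square loses exactly τ⟪p,x⟫²(2 - τ‖p‖²), which is nonnegative. -/
theorem norm_rankOnePerturb_le {τ : ℝ} {p : H} (h0 : 0 ≤ τ) (h1 : τ * ‖p‖ ^ 2 ≤ 1) (x : H) :
    ‖rankOnePerturb τ p x‖ ≤ ‖x‖ := by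
  refine le_of_sq_le_sq ?_ (norm_nonneg _)
  rw [rankOnePerturb_apply, ← real_inner_self_eq_norm_sq, inner_sub_left, inner_sub_right,
    inner_sub_right, inner_smul_left, inner_smul_right, inner_smul_right, inner_smul_left,
    real_inner_comm p x, real_inner_self_eq_norm_sq, real_inner_self_eq_norm_sq]
  simp only [conj_trivial]
  have h2 : 0 ≤ τ * inner ℝ p x ^ 2 * (2 - τ * ‖p‖ ^ 2) :=
    mul_nonneg (mul_nonneg h0 (sq_nonneg _)) (by linarith)
  nlinarith [h2]

/-- The Sherman–Morrison formula. -/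
theorem rankOnePerturb_comp {τ : ℝ} {p : H} (h1 : τ * ‖p‖ ^ 2 ≠ 1) (x : H) :
    rankOnePerturb (-(τ / (1 - τ * ‖p‖ ^ 2))) p (rankOnePerturb τ p x) = x := by
  have h2 : 1 - τ * ‖p‖ ^ 2 ≠ 0 := sub_ne_zero.2 (Ne.symm h1)
  rw [rankOnePerturb_apply, rankOnePerturb_apply, inner_sub_right, inner_smul_right,
    real_inner_self_eq_norm_sq, sub_sub, ← add_smul, sub_eq_self]
  convert zero_smul ℝ p
  field_simp
  ring

variable [CompleteSpace H]

theorem summable_diagOp (e : HilbertBasis ℕ ℝ H) {c : ℕ → ℝ} (hc : Summable c) (h0 : ∀ n, 0 ≤ c n) :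
    Summable fun n => c n • rankOneSelf (e n) := by
  refine Summable.of_norm_bounded hc fun n => ?_
  rw [norm_smul, Real.norm_of_nonneg (h0 n)]
  have h1 := norm_rankOneSelf_le (e n)
  rw [e.orthonormal.1 n, one_mul] at h1
  exact mul_le_of_le_one_right (h0 n) h1

/-- Summability of c makes the defining series converge in operator norm, so the operator is a norm
limit of finite-rank ones. -/
theorem isCompactOperator_diagOp (e : HilbertBasis ℕ ℝ H) {c : ℕ → ℝ} (hc : Summable c)
    (h0 : ∀ n, 0 ≤ c n) : IsCompactOperator (diagOp e c) := by
  refine isCompactOperator_of_tendsto (summable_diagOp e hc h0).hasSum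
    (Filter.Eventually.of_forall fun s => ?_)
  have : ∀ n ∈ s, c n • rankOneSelf (e n) ∈ compactOperator (RingHom.id ℝ) H H := fun n _ =>
    Submodule.smul_mem _ _ (isCompactOperator_rankOneSelf (e n))
  exact Submodule.sum_mem _ this

theorem inner_diagOp (e : HilbertBasis ℕ ℝ H) {c : ℕ → ℝ} (hc : Summable c) (h0 : ∀ n, 0 ≤ c n)
    (x : H) (m : ℕ) : inner ℝ (e m) (diagOp e c x) = c m * inner ℝ (e m) x := by
  have h1 := (summable_diagOp e hc h0).hasSum.mapL
    ((innerSL ℝ (e m)).comp (ContinuousLinearMap.apply ℝ H x))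
  have h2 : ∀ n, ((innerSL ℝ (e m)).comp (ContinuousLinearMap.apply ℝ H x))
      (c n • rankOneSelf (e n)) = if n = m then c m * inner ℝ (e m) x else 0 := by
    intro n
    have h3 : ((innerSL ℝ (e m)).comp (ContinuousLinearMap.apply ℝ H x))
      (c n • rankOneSelf (e n)) = inner ℝ (e m) (c n • (inner ℝ (e n) x • e n)) := rfl
    rw [h3, inner_smul_right, inner_smul_right, orthonormal_iff_ite.1 e.orthonormal m n]
    by_cases h : n = m
    · subst h; simp
    · simp [h, Ne.symm h]
  simp only [h2] at h1
  exact h1.unique (hasSum_ite_eq m _)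

theorem inner_diagOp_left (e : HilbertBasis ℕ ℝ H) {c : ℕ → ℝ} (hc : Summable c)
    (h0 : ∀ n, 0 ≤ c n) (x y : H) :
    HasSum (fun n => c n * (inner ℝ (e n) x * inner ℝ (e n) y)) (inner ℝ (diagOp e c x) y) := by
  refine (e.hasSum_inner_mul_inner (diagOp e c x) y).congr_fun fun n => ?_
  rw [real_inner_comm (e n) (diagOp e c x), inner_diagOp e hc h0]
  ring

/-- Write S for the perturbed identity and G for the diagonal operator. The eigenvalues of SGS are
κ_j = Σ_n c_n⟪e_n, S g_j⟫². They are positive because S is injective and at most `cmax` because ‖S‖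
≤ 1; interchanging the sums bounds the trace by Σ c_n‖S e_n‖². -/
theorem exists_diagonalization (e : HilbertBasis ℕ ℝ H) {c : ℕ → ℝ} (hc : Summable c)
    (h0 : ∀ n, 0 < c n) {cmax : ℝ} (hmax : ∀ n, c n ≤ cmax) {τ : ℝ} {p : H} (hτ : 0 ≤ τ)
    (hτp : τ * ‖p‖ ^ 2 < 1) :
    ∃ (J : Type u) (g : HilbertBasis J ℝ H) (κ : J → ℝ),
      (∀ j, rankOnePerturb τ p (diagOp e c (rankOnePerturb τ p (g j))) = κ j • g j) ∧
      (∀ j, 0 < κ j) ∧ (∀ j, κ j ≤ cmax) ∧ Summable κ := by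
  have h0' := fun n => (h0 n).le
  set S := rankOnePerturb τ p with hS
  set G := diagOp e c with hG
  have hGs : ∀ x y, inner ℝ (G x) y = inner ℝ x (G y) := by
    intro x y
    have h1 := inner_diagOp_left e hc h0' x y
    have h2 := inner_diagOp_left e hc h0' y x
    rw [real_inner_comm] at h2
    exact h1.unique (h2.congr_fun fun n => by ring)
  obtain ⟨J, g, κ, hg⟩ := exists_hilbertBasis_eigenvectors (S.comp (G.comp S))
    (((isCompactOperator_diagOp e hc h0').comp_clm S).clm_comp S) (by
      intro x y
      change inner ℝ (S (G (S x))) y = inner ℝ x (S (G (S y)))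
      rw [inner_rankOnePerturb, hGs, inner_rankOnePerturb])
  have hκ : ∀ j, HasSum (fun n => c n * inner ℝ (e n) (S (g j)) ^ 2) (κ j) := by
    intro j
    have h1 := inner_diagOp_left e hc h0' (S (g j)) (S (g j))
    have h2 : inner ℝ (G (S (g j))) (S (g j)) = κ j := by
      rw [real_inner_comm, inner_rankOnePerturb]
      have h3 : S (G (S (g j))) = κ j • g j := hg j
      rw [h3, inner_smul_right, real_inner_self_eq_norm_sq, g.orthonormal.1 j]
      simp
    rw [← h2]
    exact h1.congr_fun fun n => by ring
  have hSn : ∀ x, ‖S x‖ ≤ ‖x‖ := norm_rankOnePerturb_le hτ hτp.le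
  refine ⟨J, g, κ, hg, fun j => ?_, fun j => ?_, ?_⟩
  · have hn : ∀ n, 0 ≤ c n * inner ℝ (e n) (S (g j)) ^ 2 := fun n =>
      mul_nonneg (h0' n) (sq_nonneg _)
    refine lt_of_le_of_ne ((hκ j).nonneg hn) fun h => ?_
    have h1 := hκ j
    rw [← h, hasSum_zero_iff_of_nonneg hn] at h1
    have h2 : S (g j) = 0 := by
      have h3 := e.hasSum_inner_mul_inner (S (g j)) (S (g j))
      have h4 : ∀ n, inner ℝ (e n) (S (g j)) = 0 := fun n => by
        have := congrFun h1 n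
        simpa [(h0 n).ne'] using this
      simp only [h4, mul_zero] at h3
      exact inner_self_eq_zero.1 (h3.unique hasSum_zero)
    have h5 := rankOnePerturb_comp hτp.ne (g j)
    rw [← hS, h2, map_zero] at h5
    exact g.orthonormal.ne_zero j h5.symm
  · have h1 := e.hasSum_inner_mul_inner (S (g j)) (S (g j))
    have h2 : κ j ≤ cmax * inner ℝ (S (g j)) (S (g j)) := by
      refine hasSum_le (fun n => ?_) (hκ j) (h1.mul_left cmax)
      rw [real_inner_comm, ← sq]
      exact mul_le_mul_of_nonneg_right (hmax n) (sq_nonneg _)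
    have h3 : inner ℝ (S (g j)) (S (g j)) ≤ (1 : ℝ) := by
      rw [real_inner_self_eq_norm_sq]
      have := hSn (g j)
      rw [g.orthonormal.1 j] at this
      exact pow_le_one₀ (norm_nonneg _) this
    have h4 : 0 ≤ cmax := (h0' 0).trans (hmax 0)
    nlinarith
  · refine summable_of_sum_le (fun j => ?_) (c := ∑' n, c n) fun F => ?_
    · exact (hκ j).nonneg fun n => mul_nonneg (h0' n) (sq_nonneg _)
    · refine hasSum_le (fun n => ?_) (hasSum_sum fun j _ => hκ j) hc.hasSum
      rw [← Finset.mul_sum]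
      refine mul_le_of_le_one_right (h0' n) ?_
      have h1 := g.orthonormal.sum_inner_products_le (S (e n)) (s := F)
      have h2 : ‖S (e n)‖ ^ 2 ≤ 1 := by
        have := hSn (e n)
        rw [e.orthonormal.1 n] at this
        exact pow_le_one₀ (norm_nonneg _) this
      refine le_trans (le_of_eq ?_) (h1.trans h2)
      refine Finset.sum_congr rfl fun j _ => ?_
      rw [← inner_rankOnePerturb, real_inner_comm, Real.norm_eq_abs, sq_abs]

end Diagonalization

/-! ### The characteristic equation -/

/-- The weights `6 / (π n)²`. -/
def zetaWeight (n : ℕ) : ℝ := 6 / waveNum n ^ 2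

theorem zetaWeight_pos (n : ℕ) : 0 < zetaWeight n := by
  have := waveNum_pos n
  unfold zetaWeight; positivity

/-- This is ζ(2) = π²/6; it makes the thermal sum in `charW` a convex combination. -/
theorem hasSum_zetaWeight : HasSum zetaWeight 1 := by
  have h := (hasSum_nat_add_iff' 1).2 hasSum_zeta_two
  have h2 := h.mul_left (6 / Real.pi ^ 2)
  have e : 6 / Real.pi ^ 2 * (Real.pi ^ 2 / 6 - ∑ i ∈ Finset.range 1, 1 / (i : ℝ) ^ 2) = 1 := by
    simp
  rw [e] at h2
  refine h2.congr_fun fun n => ?_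
  unfold zetaWeight waveNum
  push_cast
  have := Real.pi_ne_zero
  field_simp

theorem hasSum_inv_waveNum_pow_four : HasSum (fun n => 1 / waveNum n ^ 4) (1 / 90) := by
  have h := (hasSum_nat_add_iff' 1).2 hasSum_zeta_four
  have h2 := h.mul_left (1 / Real.pi ^ 4)
  have e : 1 / Real.pi ^ 4 * (Real.pi ^ 4 / 90 - ∑ i ∈ Finset.range 1, 1 / (i : ℝ) ^ 4) = 1 / 90 := by
    have := Real.pi_ne_zero
    simp; field_simp
  rw [e] at h2
  refine h2.congr_fun fun n => ?_
  unfold waveNum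
  push_cast
  have := Real.pi_ne_zero
  field_simp

theorem waveNum_zero_le (n : ℕ) : Real.pi ≤ waveNum n := by
  have := Real.pi_pos
  unfold waveNum
  have : (0 : ℝ) ≤ n := Nat.cast_nonneg n
  nlinarith

namespace BubbleParams

variable (P : BubbleParams)

/-- The thermal decay rates `κ̄ (nπ)²`. -/
def thermalRate (n : ℕ) : ℝ := P.kbar * waveNum n ^ 2

theorem thermalRate_pos (n : ℕ) : 0 < P.thermalRate n :=
  mul_pos P.kbar_pos (pow_pos (waveNum_pos n) 2)

theorem thermalRate_ge (n : ℕ) : Real.pi ^ 2 * P.kbar ≤ P.thermalRate n := by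
  unfold thermalRate
  rw [mul_comm]
  have := P.kbar_pos
  gcongr
  exact waveNum_zero_le n

/-- The thermal transfer function. -/
def charW (l : ℂ) : ℂ :=
  1 - P.theta + P.theta * ∑' n, (zetaWeight n : ℂ) * (P.thermalRate n / (l + P.thermalRate n))

/-- The mechanical quadratic. -/
def charQ (l : ℂ) : ℂ :=
  (P.rhoL * P.Rstar ^ 2 : ℝ) * l ^ 2 + (4 * P.muL : ℝ) * l - (2 * P.sigma / P.Rstar : ℝ)

variable {P}

theorem re_add_thermalRate_ge {l : ℂ} {s : ℝ} (hs0 : 0 ≤ s)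
    (hl : -(s * (Real.pi ^ 2 * P.kbar)) ≤ l.re) (n : ℕ) :
    (1 - s) * P.thermalRate n ≤ l.re + P.thermalRate n := by
  have h1 := P.thermalRate_ge n
  nlinarith

/-- The reciprocal (l + ν)/ν has real part at least 1 - s, and inversion maps this half-plane into
the disc with diameter [0, 1/(1-s)]. -/
theorem norm_sub_disc {l : ℂ} {s : ℝ} (hs0 : 0 ≤ s) (hs1 : s < 1)
    (hl : -(s * (Real.pi ^ 2 * P.kbar)) ≤ l.re) (n : ℕ) :
    ‖(P.thermalRate n / (l + P.thermalRate n) : ℂ) - ((1 / (1 - s) / 2 : ℝ) : ℂ)‖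
      ≤ 1 / (1 - s) / 2 := by
  have h1 := re_add_thermalRate_ge hs0 hl n
  have hν := P.thermalRate_pos n
  set ν := P.thermalRate n
  have hs : 0 < 1 - s := by linarith
  have hre : 0 < (l + ν).re := by
    rw [Complex.add_re, Complex.ofReal_re]
    exact (mul_pos hs hν).trans_le h1
  have hne : l + ν ≠ 0 := fun h => by rw [h] at hre; simp at hre
  set D := 1 / (1 - s) with hD
  have hDpos : 0 < D := by positivity
  have e : (ν / (l + ν) : ℂ) - ((D / 2 : ℝ) : ℂ) = (ν - (D / 2 : ℝ) * (l + ν)) / (l + ν) := by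
    field_simp
  rw [e, norm_div, div_le_iff₀ (norm_pos_iff.2 hne)]
  refine le_of_sq_le_sq ?_ (by positivity)
  rw [mul_pow, Complex.sq_norm, Complex.sq_norm, Complex.normSq_apply, Complex.normSq_apply]
  simp only [Complex.sub_re, Complex.sub_im, Complex.mul_re, Complex.mul_im, Complex.ofReal_re,
    Complex.ofReal_im, Complex.add_re, Complex.add_im]
  have h2 : ν ≤ D * (l.re + ν) := by
    rw [hD, div_mul_eq_mul_div, one_mul, le_div_iff₀ hs]
    linarith
  nlinarith [mul_nonneg hν.le (sub_nonneg.2 h2)]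

theorem summable_charW {l : ℂ} {s : ℝ} (hs0 : 0 ≤ s) (hs1 : s < 1)
    (hl : -(s * (Real.pi ^ 2 * P.kbar)) ≤ l.re) :
    Summable fun n => (zetaWeight n : ℂ) * (P.thermalRate n / (l + P.thermalRate n)) := by
  refine Summable.of_norm_bounded (hasSum_zetaWeight.summable.mul_right (1 / (1 - s))) fun n => ?_
  have h1 := norm_sub_disc hs0 hs1 hl n
  have hs : 0 < 1 - s := by linarith
  rw [norm_mul, Complex.norm_real, Real.norm_of_nonneg (zetaWeight_pos n).le]
  refine mul_le_mul_of_nonneg_left ?_ (zetaWeight_pos n).le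
  have h2 := norm_add_le ((P.thermalRate n / (l + P.thermalRate n) : ℂ)
    - ((1 / (1 - s) / 2 : ℝ) : ℂ)) ((1 / (1 - s) / 2 : ℝ) : ℂ)
  rw [sub_add_cancel, Complex.norm_real, Real.norm_of_nonneg (by positivity)] at h2
  linarith

/-- The transfer function takes values in a disc. -/
theorem charW_disc {l : ℂ} {s : ℝ} (hs0 : 0 ≤ s) (hs1 : s < 1)
    (hl : -(s * (Real.pi ^ 2 * P.kbar)) ≤ l.re) :
    0 < (P.charW l).re ∧
      ‖P.charW l‖ ^ 2 ≤ (1 - P.theta + P.theta / (1 - s)) * (P.charW l).re := by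
  have hθ := P.theta_pos
  have hθ1 := P.theta_lt_one
  have hs : 0 < 1 - s := by linarith
  have hsum := summable_charW hs0 hs1 hl
  set D := 1 / (1 - s) with hD
  have hDpos : 0 < D := by positivity
  set H := ∑' n, (zetaWeight n : ℂ) * (P.thermalRate n / (l + P.thermalRate n)) with hH
  have h1 : HasSum (fun n => (zetaWeight n : ℂ) * ((P.thermalRate n / (l + P.thermalRate n) : ℂ)
      - ((D / 2 : ℝ) : ℂ))) (H - ((D / 2 : ℝ) : ℂ)) := by
    have := hsum.hasSum.sub ((Complex.hasSum_ofReal.2 hasSum_zetaWeight).mul_right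
      ((D / 2 : ℝ) : ℂ))
    rw [Complex.ofReal_one, one_mul] at this
    refine this.congr_fun fun n => by ring
  have h2 : ‖H - ((D / 2 : ℝ) : ℂ)‖ ≤ D / 2 := by
    have h3 := hasSum_zetaWeight.mul_right (D / 2)
    rw [one_mul] at h3
    rw [← h1.tsum_eq]
    -- A convex combination of points of a disc stays in the disc.
    refine tsum_of_norm_bounded h3 fun n => ?_
    rw [norm_mul, Complex.norm_real, Real.norm_of_nonneg (zetaWeight_pos n).le]
    exact mul_le_mul_of_nonneg_left (norm_sub_disc hs0 hs1 hl n) (zetaWeight_pos n).le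
  have hW : P.charW l = 1 - P.theta + P.theta * H := rfl
  have h4 : ‖H - ((D / 2 : ℝ) : ℂ)‖ ^ 2 ≤ (D / 2) ^ 2 := pow_le_pow_left₀ (norm_nonneg _) h2 2
  rw [Complex.sq_norm, Complex.normSq_apply] at h4
  simp only [Complex.sub_re, Complex.sub_im, Complex.ofReal_re, Complex.ofReal_im, sub_zero] at h4
  have hre : (P.charW l).re = 1 - P.theta + P.theta * H.re := by
    rw [hW]; simp
  have him : (P.charW l).im = P.theta * H.im := by
    rw [hW]; simp
  have hH0 : 0 ≤ H.re := by nlinarith [sq_nonneg H.re, sq_nonneg H.im]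
  have hHD : H.re ≤ D := by nlinarith [sq_nonneg H.re, sq_nonneg H.im]
  rw [Complex.sq_norm, Complex.normSq_apply, hre, him]
  have e : P.theta / (1 - s) = P.theta * D := by rw [hD]; ring
  rw [e]
  have h5 : H.re * H.re + H.im * H.im ≤ D * H.re := by nlinarith
  refine ⟨by nlinarith [mul_nonneg hθ.le hH0], ?_⟩
  have h6 := mul_le_mul_of_nonneg_left h5 (mul_nonneg hθ.le hθ.le)
  -- Exactly the gap between the two sides once |H|² is replaced by D·Re H.
  have h7 : 0 ≤ (1 - P.theta) * P.theta * (D - H.re) :=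
    mul_nonneg (mul_nonneg (by linarith) hθ.le) (by linarith)
  nlinarith [h6, h7]

theorem normSq_add_thermalRate_pos {l : ℂ} {s : ℝ} (hs0 : 0 ≤ s) (hs1 : s < 1)
    (hl : -(s * (Real.pi ^ 2 * P.kbar)) ≤ l.re) (n : ℕ) :
    0 < Complex.normSq (l + P.thermalRate n) := by
  rw [Complex.normSq_pos]
  intro h
  have h1 := re_add_thermalRate_ge hs0 hl n
  have h2 := congrArg Complex.re h
  rw [Complex.add_re, Complex.ofReal_re, Complex.zero_re] at h2
  have := mul_pos (sub_pos.2 hs1) (P.thermalRate_pos n)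
  linarith

/-- Im(ν/(l+ν)) = -ν·Im l/|l+ν|², and the weight times ν is the constant 6κ̄. All terms carry the
same sign, which yields the thermal damping. -/
theorem hasSum_charW_im {l : ℂ} {s : ℝ} (hs0 : 0 ≤ s) (hs1 : s < 1)
    (hl : -(s * (Real.pi ^ 2 * P.kbar)) ≤ l.re) :
    HasSum (fun n => -(P.theta * l.im) *
      (6 * P.kbar / Complex.normSq (l + P.thermalRate n))) (P.charW l).im := by
  have hsum := (summable_charW hs0 hs1 hl).hasSum
  have h2 := (Complex.hasSum_im hsum).mul_left P.theta
  have him : (P.charW l).im = P.theta *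
      (∑' n, (zetaWeight n : ℂ) * (P.thermalRate n / (l + P.thermalRate n))).im := by
    unfold charW; simp
  rw [him]
  refine h2.congr_fun fun n => ?_
  have hn := (normSq_add_thermalRate_pos hs0 hs1 hl n).ne'
  rw [Complex.im_ofReal_mul, Complex.div_im]
  simp only [Complex.ofReal_re, Complex.ofReal_im, Complex.add_im]
  have hw := (waveNum_pos n).ne'
  unfold zetaWeight thermalRate at *
  field_simp
  ring

end BubbleParams

/-! ### The explicit decay rate and the exclusion of characteristic roots -/

/-- The error term in the decay rate. -/
def rateError (ε x : ℝ) : ℝ :=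
  -(4 * Real.pi ^ 4 / 90) * ((1 - ε) ^ (3 / 4 : ℝ))⁻¹
    * (3 * ((1 - ε) * x ^ 2) / (1 + 3 * ((1 - ε) * x ^ 2)))

/-- With y = (1-ε)x², both 3y and 1 bound 3y/(1+3y), hence so does 3y^{3/4}. The factor (1-ε)^{3/4}
in y^{3/4} cancels the inverse power, so the constant is free of ε. -/
theorem abs_rateError_le {ε x : ℝ} (hε : ε < 1) (hx : 0 < x) :
    |rateError ε x| ≤ (4 * Real.pi ^ 4 / 90 * 3) * x ^ (3 / 2 : ℝ) := by
  have h1 : 0 < 1 - ε := by linarith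
  set y := (1 - ε) * x ^ 2 with hy
  have hypos : 0 < y := by positivity
  have hr : 0 < (1 - ε) ^ (3 / 4 : ℝ) := Real.rpow_pos_of_pos h1 _
  have hyr : y ^ (3 / 4 : ℝ) = (1 - ε) ^ (3 / 4 : ℝ) * x ^ (3 / 2 : ℝ) := by
    rw [hy, Real.mul_rpow h1.le (by positivity), ← Real.rpow_natCast x 2, ← Real.rpow_mul hx.le]
    norm_num
  have hfrac : 3 * y / (1 + 3 * y) ≤ 3 * y ^ (3 / 4 : ℝ) := by
    rcases le_total y 1 with h | h
    · have h2 : y ≤ y ^ (3 / 4 : ℝ) := by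
        have := Real.rpow_le_rpow_of_exponent_ge hypos h (by norm_num : (3 / 4 : ℝ) ≤ 1)
        rwa [Real.rpow_one] at this
      calc 3 * y / (1 + 3 * y) ≤ 3 * y := div_le_self (by positivity) (by linarith)
        _ ≤ _ := by linarith
    · have h2 : 1 ≤ y ^ (3 / 4 : ℝ) := Real.one_le_rpow h (by norm_num)
      have h3 : 3 * y / (1 + 3 * y) ≤ 1 := by rw [div_le_one (by positivity)]; linarith
      linarith
  unfold rateError
  rw [← hy, abs_mul, abs_mul, abs_neg, abs_of_pos (by positivity), abs_of_pos (by positivity),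
    abs_of_pos (by positivity)]
  calc _ ≤ 4 * Real.pi ^ 4 / 90 * ((1 - ε) ^ (3 / 4 : ℝ))⁻¹ * (3 * y ^ (3 / 4 : ℝ)) := by gcongr
    _ = _ := by rw [hyr]; field_simp

/-- The identity for which `rateError` was designed: the bracket of the rate in closed, visibly
positive form. -/
theorem bracket_rateError {ε : ℝ} (x : ℝ) (hε : ε < 1) :
    4 * Real.pi ^ 4 / 90 + (1 - ε) ^ (3 / 4 : ℝ) * rateError ε x
      = 4 * Real.pi ^ 4 / 90 / (1 + 3 * ((1 - ε) * x ^ 2)) := by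
  have h1 : 0 < 1 - ε := by linarith
  have hr : 0 < (1 - ε) ^ (3 / 4 : ℝ) := Real.rpow_pos_of_pos h1 _
  have h2 : 0 < 1 + 3 * ((1 - ε) * x ^ 2) := by positivity
  unfold rateError
  field_simp
  ring

namespace BubbleParams

variable (P : BubbleParams)

/-- The ratio `p_{∞,*} R_* / (2 p_{∞,*} R_* + 6 σ)`. -/
def pressRatio : ℝ := P.pinf * P.Rstar / (2 * P.pinf * P.Rstar + 6 * P.sigma)

theorem pressRatio_pos : 0 < P.pressRatio := by
  have h1 := P.pinf_pos
  have h2 := P.Rstar_pos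
  have h3 := P.sigma_nonneg
  unfold pressRatio
  positivity

/-- The fraction of the first thermal rate below which the thermal transfer function is
controlled. -/
def thermalFrac : ℝ := 1 - Real.sqrt (P.theta / (P.pressRatio + P.theta))

/-- Let h be `pressRatio` and q = ϑ/(h+ϑ) < 1. Then 1 - `thermalFrac` = √q > q, so ϑ/√q < ϑ/q = ϑ +
h; the square root is what creates strict slack. -/
theorem thermalFrac_spec : 0 < P.thermalFrac ∧ P.thermalFrac < 1 ∧
    1 - P.theta + P.theta / (1 - P.thermalFrac) < 1 + P.pressRatio := by
  have hθ := P.theta_pos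
  have hh := P.pressRatio_pos
  set q := P.theta / (P.pressRatio + P.theta) with hq
  have hq0 : 0 < q := by positivity
  have hq1 : q < 1 := by rw [hq, div_lt_one (by positivity)]; linarith
  have hs0 : 0 < Real.sqrt q := Real.sqrt_pos.2 hq0
  have hs1 : Real.sqrt q < 1 := by rw [Real.sqrt_lt' one_pos]; simpa using hq1
  have hf : P.thermalFrac = 1 - Real.sqrt q := rfl
  refine ⟨by linarith, by linarith, ?_⟩
  rw [hf, sub_sub_cancel]
  have h1 : q < Real.sqrt q := by
    have := Real.mul_self_sqrt hq0.le
    nlinarith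
  have h2 : P.theta / Real.sqrt q < P.theta + P.pressRatio := by
    rw [div_lt_iff₀ hs0]
    have h3 : P.theta = q * (P.pressRatio + P.theta) := by
      rw [hq]; field_simp
    calc P.theta = q * (P.pressRatio + P.theta) := h3
      _ < Real.sqrt q * (P.pressRatio + P.theta) := by gcongr
      _ = _ := by ring
  linarith

/-- The reason for this ratio: a disc of diameter below 1 + h forces 3p_*·Re(1/W) above 2p_* +
2σ/R_*. -/
theorem pressRatio_mul : (1 + P.pressRatio) * (2 * P.pStar + 2 * P.sigma / P.Rstar)
    = 3 * P.pStar := by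
  have h1 := P.pinf_pos
  have h2 := P.Rstar_pos
  have h3 := P.sigma_nonneg
  have h4 : 0 < 2 * P.pinf * P.Rstar + 6 * P.sigma := by positivity
  rw [pStar_eq]
  unfold pressRatio
  field_simp
  ring

theorem discr_eq : P.Rstar ^ 2 * P.discr
    = 16 * P.muL ^ 2 - 8 * (P.rhoL * P.Rstar ^ 2) * P.pStar := by
  have h2 := P.Rstar_pos.ne'
  unfold discr
  field_simp
  ring

theorem decayRate_bounds {ε e : ℝ} : P.decayRate ε e ≤ P.thermalFrac * (Real.pi ^ 2 * P.kbar) ∧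
    P.decayRate ε e ≤ Real.sqrt (ε * (2 * P.pStar / (P.rhoL * P.Rstar ^ 2))) ∧
    (P.discr ≤ 0 → P.decayRate ε e ≤ 2 * P.muL / (P.rhoL * P.Rstar ^ 2)
        + (1 - ε) ^ 2 * P.theta * P.pStar / (Real.pi ^ 4 * P.kbar * P.rhoL * P.Rstar ^ 2)
              * (4 * Real.pi ^ 4 / 90 + (1 - ε) ^ (3 / 4 : ℝ) * e)) ∧
    (0 < P.discr → P.decayRate ε e ≤ 2 * P.muL / (P.rhoL * P.Rstar ^ 2)
        - Real.sqrt P.discr / (2 * P.rhoL * P.Rstar)) := by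
  unfold decayRate
  refine ⟨(min_le_left _ _).trans (le_of_eq ?_), (min_le_right _ _).trans (min_le_left _ _),
    fun h => ?_, fun h => ?_⟩
  · unfold thermalFrac pressRatio; ring
  · refine ((min_le_right _ _).trans (min_le_right _ _)).trans (le_of_eq ?_)
    rw [if_pos h, if_neg (not_lt.2 h), sub_zero]
  · refine ((min_le_right _ _).trans (min_le_right _ _)).trans (le_of_eq ?_)
    rw [if_pos h, if_neg (not_le.2 h), add_zero]

/-- Only the last entry matters. If Δ ≤ 0 the thermal term is positive even without viscosity; if Δ
> 0 then √Δ < 4μ_l/R_*, since 8ρ_l p_* > 0 was subtracted. -/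
theorem decayRate_pos {ε : ℝ} (h0 : 0 < ε) (h1 : ε < 1) (x : ℝ) :
    0 < P.decayRate ε (rateError ε x) := by
  have hp := P.pStar_pos
  have hρ := P.rhoL_pos
  have hR := P.Rstar_pos
  have hk := P.kbar_pos
  have hθ := P.theta_pos
  have hμ := P.muL_nonneg
  have hε : 0 < 1 - ε := by linarith
  unfold decayRate
  refine lt_min ?_ (lt_min (Real.sqrt_pos.2 (by positivity)) ?_)
  · have := P.thermalFrac_spec.1
    unfold thermalFrac pressRatio at this
    positivity
  · rw [bracket_rateError x h1]
    rcases le_or_gt P.discr 0 with h | h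
    · rw [if_pos h, if_neg (not_lt.2 h), sub_zero]
      positivity
    · rw [if_pos h, if_neg (not_le.2 h), add_zero, sub_pos]
      have h2 : Real.sqrt P.discr < 4 * P.muL / P.Rstar := by
        rw [Real.sqrt_lt' ?_]
        · have : 0 < 8 * P.rhoL * P.pStar := by positivity
          unfold discr; linarith
        · refine lt_of_le_of_ne (by positivity) fun h3 => ?_
          have : 0 < 8 * P.rhoL * P.pStar := by positivity
          unfold discr at h
          rw [← h3] at h
          nlinarith
      calc Real.sqrt P.discr / (2 * P.rhoL * P.Rstar)
          < 4 * P.muL / P.Rstar / (2 * P.rhoL * P.Rstar) := by gcongr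
        _ = _ := by field_simp; ring

/-- Lower bound for the thermal damping sum. -/
theorem thermal_sum_lower {P : BubbleParams} {l : ℂ} {s : ℝ} (hs0 : 0 ≤ s) (hs1 : s < 1)
    (hl : -(s * (Real.pi ^ 2 * P.kbar)) ≤ l.re) (hre : l.re ≤ 0) {A : ℝ}
    (hA : HasSum (fun n => 6 * P.kbar / Complex.normSq (l + P.thermalRate n)) A) {r : ℝ}
    (hr : ‖l‖ ^ 2 ≤ r * (Real.pi ^ 2 * P.kbar) ^ 2) (hr0 : 0 ≤ r) :
    6 / P.kbar * (1 / 90) / (1 + r) ≤ A := by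
  have hk := P.kbar_pos
  have h1 := (hasSum_inv_waveNum_pow_four.mul_left (6 / P.kbar)).div_const (1 + r)
  refine hasSum_le (fun n => ?_) h1 hA
  have hn := normSq_add_thermalRate_pos hs0 hs1 hl n
  have hw := waveNum_pos n
  have hν := P.thermalRate_pos n
  -- Expand |l+ν|²: the cross term 2ν·Re l is nonpositive, and |l|² ≤ r(π²κ̄)² ≤ rν².
  have h2 : Complex.normSq (l + P.thermalRate n) ≤ P.kbar ^ 2 * waveNum n ^ 4 * (1 + r) := by
    have h3 : Complex.normSq (l + P.thermalRate n)
        = ‖l‖ ^ 2 + 2 * l.re * P.thermalRate n + P.thermalRate n ^ 2 := by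
      rw [Complex.sq_norm, Complex.normSq_apply, Complex.normSq_apply]
      simp only [Complex.add_re, Complex.add_im, Complex.ofReal_re, Complex.ofReal_im]
      ring
    have h4 : Real.pi ^ 2 * P.kbar ≤ P.thermalRate n := P.thermalRate_ge n
    have h5 : (Real.pi ^ 2 * P.kbar) ^ 2 ≤ P.thermalRate n ^ 2 :=
      pow_le_pow_left₀ (by positivity) h4 2
    have h6 : P.thermalRate n ^ 2 = P.kbar ^ 2 * waveNum n ^ 4 := by unfold thermalRate; ring
    rw [h3, ← h6]
    nlinarith [mul_le_mul_of_nonneg_left h5 hr0, mul_nonneg (neg_nonneg.2 hre) hν.le]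
  calc 6 / P.kbar * (1 / waveNum n ^ 4) / (1 + r)
      = 6 * P.kbar / (P.kbar ^ 2 * waveNum n ^ 4 * (1 + r)) := by field_simp
    _ ≤ _ := by gcongr

theorem charQ_re (l : ℂ) : (P.charQ l).re = P.rhoL * P.Rstar ^ 2 * (l.re ^ 2 - l.im ^ 2)
    + 4 * P.muL * l.re - 2 * P.sigma / P.Rstar := by
  have h : P.charQ l = (P.rhoL * P.Rstar ^ 2 : ℝ) * (l * l) + (4 * P.muL : ℝ) * l
      - (2 * P.sigma / P.Rstar : ℝ) := by
    unfold charQ; ring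
  rw [h, Complex.sub_re, Complex.add_re, Complex.re_ofReal_mul, Complex.re_ofReal_mul,
    Complex.ofReal_re, Complex.mul_re]
  ring

theorem charQ_im (l : ℂ) : (P.charQ l).im
    = l.im * (2 * (P.rhoL * P.Rstar ^ 2) * l.re + 4 * P.muL) := by
  have h : P.charQ l = (P.rhoL * P.Rstar ^ 2 : ℝ) * (l * l) + (4 * P.muL : ℝ) * l
      - (2 * P.sigma / P.Rstar : ℝ) := by
    unfold charQ; ring
  rw [h, Complex.sub_im, Complex.add_im, Complex.im_ofReal_mul, Complex.im_ofReal_mul,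
    Complex.ofReal_im, Complex.mul_im]
  ring

/-- Real and imaginary part of the characteristic equation. -/
theorem char_eq_parts {P : BubbleParams} {l : ℂ} (heq : P.charQ l * P.charW l = -(3 * P.pStar : ℝ))
    (hl : -(P.thermalFrac * (Real.pi ^ 2 * P.kbar)) ≤ l.re) :
    2 * P.pStar + 2 * P.sigma / P.Rstar < -(P.charQ l).re ∧ 0 < ‖P.charW l‖ ^ 2 ∧
      (P.charQ l).im * ‖P.charW l‖ ^ 2 = 3 * P.pStar * (P.charW l).im := by
  obtain ⟨hf0, hf1, hf2⟩ := P.thermalFrac_spec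
  obtain ⟨hWre, hWn⟩ := charW_disc hf0.le hf1 hl
  have hp := P.pStar_pos
  have hR := P.Rstar_pos
  have hprm := P.pressRatio_mul
  have hsg : 0 ≤ 2 * P.sigma / P.Rstar := by have := P.sigma_nonneg; positivity
  set sg := 2 * P.sigma / P.Rstar
  set W := P.charW l
  set Q := P.charQ l
  have hN : ‖W‖ ^ 2 = W.re * W.re + W.im * W.im := by
    rw [Complex.sq_norm, Complex.normSq_apply]
  have eqre : Q.re * W.re - Q.im * W.im = -(3 * P.pStar) := by
    have := congrArg Complex.re heq
    rwa [Complex.mul_re, Complex.neg_re, Complex.ofReal_re] at this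
  have eqim : Q.re * W.im + Q.im * W.re = 0 := by
    have := congrArg Complex.im heq
    rwa [Complex.mul_im, Complex.neg_im, Complex.ofReal_im, neg_zero] at this
  -- Multiply the equation by the conjugate of W, so that Q|W|² = -3p_*·W̄.
  have k1 : Q.re * ‖W‖ ^ 2 = -(3 * P.pStar) * W.re := by
    rw [hN]; linear_combination W.re * eqre + W.im * eqim
  have k2 : Q.im * ‖W‖ ^ 2 = 3 * P.pStar * W.im := by
    rw [hN]; linear_combination W.re * eqim - W.im * eqre
  have hWpos : 0 < ‖W‖ ^ 2 := by
    rw [hN]; nlinarith [mul_pos hWre hWre, mul_self_nonneg W.im]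
  have hWlt : ‖W‖ ^ 2 < (1 + P.pressRatio) * W.re :=
    hWn.trans_lt (mul_lt_mul_of_pos_right hf2 hWre)
  refine ⟨?_, hWpos, k2⟩
  have h2 : (2 * P.pStar + sg) * ‖W‖ ^ 2 < -Q.re * ‖W‖ ^ 2 := by
    calc (2 * P.pStar + sg) * ‖W‖ ^ 2 < (2 * P.pStar + sg) * ((1 + P.pressRatio) * W.re) := by
          gcongr
      _ = 3 * P.pStar * W.re := by rw [← hprm]; ring
      _ = _ := by linarith
  exact lt_of_mul_lt_mul_right h2 hWpos.le

/-- Completing the square gives (Mx + 2μ_l)² < R_*²Δ/4 with M = ρ_l R_*²; x lies strictly between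
the two real zeros, and the bound is the larger one. -/
theorem real_root_lt (P : BubbleParams) {x : ℝ}
    (hx : P.rhoL * P.Rstar ^ 2 * x ^ 2 + 4 * P.muL * x + 2 * P.pStar < 0) :
    0 < P.discr ∧
      x < -(2 * P.muL / (P.rhoL * P.Rstar ^ 2) - Real.sqrt P.discr / (2 * P.rhoL * P.Rstar)) := by
  have hdisc := P.discr_eq
  have hρ := P.rhoL_pos
  have hR := P.Rstar_pos
  have hM : 0 < P.rhoL * P.Rstar ^ 2 := by positivity
  set M := P.rhoL * P.Rstar ^ 2 with hMdef
  have h2 : (M * x + 2 * P.muL) ^ 2 < P.Rstar ^ 2 * P.discr / 4 := by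
    have := mul_neg_of_pos_of_neg hM hx
    linarith
  have hd : 0 < P.discr := by
    by_contra h
    have := mul_nonneg (sq_nonneg P.Rstar) (neg_nonneg.2 (not_lt.1 h))
    linarith [sq_nonneg (M * x + 2 * P.muL)]
  refine ⟨hd, ?_⟩
  have h4 : |M * x + 2 * P.muL| < P.Rstar * Real.sqrt P.discr / 2 := by
    refine abs_lt_of_sq_lt_sq ?_ (by positivity)
    rw [div_pow, mul_pow, Real.sq_sqrt hd.le]
    linarith
  have h5 : M * (2 * P.muL / M - Real.sqrt P.discr / (2 * P.rhoL * P.Rstar))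
      = 2 * P.muL - P.Rstar * Real.sqrt P.discr / 2 := by
    rw [hMdef]; field_simp
  have h8 := (abs_lt.1 h4).2
  refine lt_of_mul_lt_mul_left ?_ hM.le
  rw [mul_neg, h5]
  linarith

/-- The thermal damping of oscillatory roots. -/
theorem oscillatory_root {P : BubbleParams} {l : ℂ}
    (heq : P.charQ l * P.charW l = -(3 * P.pStar : ℝ))
    (hl : -(P.thermalFrac * (Real.pi ^ 2 * P.kbar)) ≤ l.re) (hτ : l.im ≠ 0) :
    ∃ A, 0 ≤ A ∧ HasSum (fun n => 6 * P.kbar / Complex.normSq (l + P.thermalRate n)) A ∧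
      6 * (-(P.rhoL * P.Rstar ^ 2 * l.re) - 2 * P.muL) * P.pStar
        = P.theta * A * ‖P.charQ l‖ ^ 2 := by
  obtain ⟨hf0, hf1, hf2⟩ := P.thermalFrac_spec
  obtain ⟨-, hWpos, k2⟩ := char_eq_parts heq hl
  have him := hasSum_charW_im hf0.le hf1 hl
  have hp := P.pStar_pos
  have hθ := P.theta_pos
  have hk := P.kbar_pos
  rw [charQ_im] at k2
  set M := P.rhoL * P.Rstar ^ 2
  set W := P.charW l
  have h3 : P.theta * l.im ≠ 0 := mul_ne_zero hθ.ne' hτ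
  obtain ⟨A, hAim⟩ : ∃ A, W.im = -(P.theta * l.im * A) :=
    ⟨-W.im / (P.theta * l.im), by field_simp⟩
  have hsum : HasSum (fun n => 6 * P.kbar / Complex.normSq (l + P.thermalRate n)) A := by
    have h2 := him.mul_left (-1 / (P.theta * l.im))
    have e : -1 / (P.theta * l.im) * W.im = A := by rw [hAim]; field_simp
    rw [e] at h2
    refine h2.congr_fun fun n => ?_
    generalize 6 * P.kbar / Complex.normSq (l + P.thermalRate n) = q
    field_simp
  refine ⟨A, hsum.nonneg fun n => ?_, hsum, ?_⟩
  · have := normSq_add_thermalRate_pos hf0.le hf1 hl n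
    positivity
  · have k3 : (2 * M * l.re + 4 * P.muL) * ‖W‖ ^ 2 = -(3 * P.pStar * P.theta * A) := by
      refine mul_left_cancel₀ hτ ?_
      rw [hAim] at k2
      linarith
    -- The modulus of the characteristic equation eliminates W in favour of Q.
    have hQW : ‖P.charQ l‖ ^ 2 * ‖W‖ ^ 2 = 9 * P.pStar ^ 2 := by
      rw [← mul_pow, ← norm_mul, heq, norm_neg, Complex.norm_real,
        Real.norm_of_nonneg (by positivity)]
      ring
    refine mul_right_cancel₀ hWpos.ne' (mul_left_cancel₀ hp.ne' ?_)
    linear_combination (-3 * P.pStar ^ 2) * k3 - P.theta * A * P.pStar * hQW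

/-- Monotonicity estimates behind the explicit thermal damping rate. -/
theorem thermal_rate_aux {k A Y y ε : ℝ} (hk : 0 < k) (h0 : 0 < ε) (h1 : ε < 1) (hy : 0 ≤ y)
    (hY : 2 ≤ Y) (hA : 6 / k * (1 / 90) / (1 + 3 / 2 * Y * y) ≤ A) :
    4 / (k * 90) * ((1 - ε) ^ 2 / (1 + 3 * ((1 - ε) * y))) < A * Y ^ 2 / 6 := by
  have hε : 0 < 1 - ε := by linarith
  -- The right side increases in Y; the left side is its value at Y = 2.
  have k6 : 4 / (1 + 3 * y) ≤ Y ^ 2 / (1 + 3 / 2 * Y * y) := by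
    rw [div_le_div_iff₀ (by positivity) (by positivity)]
    have e1 : 0 ≤ Y * (Y - 2) * y := mul_nonneg (mul_nonneg (by linarith) (by linarith)) hy
    nlinarith
  -- The only place where ε > 0 provides strictness, needed to exclude roots with Re l = -β as well.
  have k7 : (1 - ε) ^ 2 / (1 + 3 * ((1 - ε) * y)) < 1 / (1 + 3 * y) := by
    rw [div_lt_div_iff₀ (by positivity) (by positivity)]
    nlinarith [mul_nonneg (mul_nonneg hε.le h0.le) hy, mul_pos h0 hε]
  calc _ < 4 / (k * 90) * (1 / (1 + 3 * y)) := by gcongr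
    _ = 1 / (k * 90) * (4 / (1 + 3 * y)) := by ring
    _ ≤ 1 / (k * 90) * (Y ^ 2 / (1 + 3 / 2 * Y * y)) := by gcongr
    _ = (6 / k * (1 / 90) / (1 + 3 / 2 * Y * y)) * Y ^ 2 / 6 := by
      field_simp
    _ ≤ _ := by gcongr

/-- The characteristic equation has no root to the right of `-β`. -/
theorem char_ne {P : BubbleParams} {ε : ℝ} (h0 : 0 < ε) (h1 : ε < 1) {l : ℂ}
    (hl : -P.decayRate ε (rateError ε P.errArg) ≤ l.re) :
    P.charQ l * P.charW l ≠ -(3 * P.pStar : ℝ) := by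
  intro heq
  obtain ⟨b1, b2, b3, b4⟩ := P.decayRate_bounds (ε := ε) (e := rateError ε P.errArg)
  rw [bracket_rateError _ h1] at b3
  set β := P.decayRate ε (rateError ε P.errArg) with hβ
  obtain ⟨hf0, hf1, -⟩ := P.thermalFrac_spec
  have hl' : -(P.thermalFrac * (Real.pi ^ 2 * P.kbar)) ≤ l.re := by linarith
  obtain ⟨hQlow, -, -⟩ := char_eq_parts heq hl'
  have hQge : -(P.charQ l).re ≤ ‖P.charQ l‖ := (neg_le_abs _).trans (Complex.abs_re_le_norm _)
  have hp := P.pStar_pos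
  have hρ := P.rhoL_pos
  have hR := P.Rstar_pos
  have hk := P.kbar_pos
  have hθ := P.theta_pos
  have hμ := P.muL_nonneg
  have hsg : 0 ≤ 2 * P.sigma / P.Rstar := by have := P.sigma_nonneg; positivity
  by_cases hτ : l.im = 0
  · rw [charQ_re, hτ] at hQlow
    obtain ⟨hd, h2⟩ := P.real_root_lt (x := l.re) (by linarith)
    linarith [b4 hd]
  obtain ⟨A, hA0, hsum, hroot⟩ := oscillatory_root heq hl' hτ
  have hQre := P.charQ_re l
  have hMpos : 0 < P.rhoL * P.Rstar ^ 2 := by positivity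
  set x := P.errArg with hx
  set Q := P.charQ l
  have hx2 : (Real.pi ^ 2 * P.kbar) ^ 2 * x ^ 2 = 2 * P.pStar / (P.rhoL * P.Rstar ^ 2) := by
    rw [hx]
    unfold errArg
    rw [mul_pow (1 / (Real.pi ^ 2 * P.kbar)), Real.sq_sqrt (by positivity)]
    have := Real.pi_ne_zero
    field_simp
  have hrate : (P.rhoL * P.Rstar ^ 2) * (2 * P.muL / (P.rhoL * P.Rstar ^ 2)
      + (1 - ε) ^ 2 * P.theta * P.pStar / (Real.pi ^ 4 * P.kbar * P.rhoL * P.Rstar ^ 2)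
      * (4 * Real.pi ^ 4 / 90 / (1 + 3 * ((1 - ε) * x ^ 2)))) = 2 * P.muL + P.pStar * P.theta *
        (4 / (P.kbar * 90) * ((1 - ε) ^ 2 / (1 + 3 * ((1 - ε) * x ^ 2)))) := by
    have hε : 0 < 1 - ε := by linarith
    have h2 : 0 < 1 + 3 * ((1 - ε) * x ^ 2) := by positivity
    have h3 := Real.pi_ne_zero
    field_simp
  set M := P.rhoL * P.Rstar ^ 2 with hM
  -- The thermal sum is nonnegative, so oscillatory roots decay at least as fast as viscosity alone
  -- dictates.
  have hMl : M * l.re ≤ -(2 * P.muL) := by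
    have h2 : 0 ≤ P.theta * A * ‖Q‖ ^ 2 := by positivity
    rw [← hroot] at h2
    have h3 := nonneg_of_mul_nonneg_left h2 hp
    linarith
  have hMβ := mul_le_mul_of_nonneg_left hl hMpos.le
  rcases le_or_gt P.discr 0 with hd | hd
  · have hc := mul_le_mul_of_nonneg_left (b3 hd) hMpos.le
    rw [hrate] at hc
    have hre0 : l.re ≤ 0 := by
      by_contra h
      have := mul_pos hMpos (not_le.1 h)
      linarith
    -- Here the second entry of β enters.
    have hβ2 : M * l.re ^ 2 ≤ 2 * P.pStar := by
      have h2 : -l.re ≤ Real.sqrt (ε * (2 * P.pStar / M)) := by linarith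
      have h3 : l.re ^ 2 ≤ ε * (2 * P.pStar / M) := by
        have := pow_le_pow_left₀ (by linarith) h2 2
        rw [Real.sq_sqrt (by positivity)] at this
        linarith
      have h4 : ε * (2 * P.pStar / M) ≤ 2 * P.pStar / M :=
        mul_le_of_le_one_left (by positivity) h1.le
      have h5 := mul_le_mul_of_nonneg_left (h3.trans h4) hMpos.le
      rwa [mul_div_cancel₀ _ hMpos.ne'] at h5
    obtain ⟨Y, hQY⟩ : ∃ Y, ‖Q‖ = P.pStar * Y := ⟨‖Q‖ / P.pStar, by field_simp⟩
    have hY2 : 2 ≤ Y := by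
      refine le_of_mul_le_mul_left ?_ hp
      linarith
    -- From -Re Q ≤ ‖Q‖ and Re l ≤ 0, M(Im l)² ≤ ‖Q‖ + M(Re l)²; moreover 2M(Re l)² ≤ 4p_* ≤ 2‖Q‖.
    have hln : M * ‖l‖ ^ 2 ≤ 3 * ‖Q‖ := by
      rw [Complex.sq_norm, Complex.normSq_apply]
      have h2 : P.muL * l.re ≤ 0 := mul_nonpos_of_nonneg_of_nonpos hμ hre0
      linarith
    have hlow := thermal_sum_lower hf0.le hf1 hl' hre0 hsum (r := 3 / 2 * Y * x ^ 2) (by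
      have h2 : 3 / 2 * Y * x ^ 2 * (Real.pi ^ 2 * P.kbar) ^ 2 = 3 * ‖Q‖ / M := by
        calc _ = 3 / 2 * Y * ((Real.pi ^ 2 * P.kbar) ^ 2 * x ^ 2) := by ring
          _ = _ := by rw [hx2, hQY]; ring
      rw [h2, le_div_iff₀ hMpos]
      linarith) (by positivity)
    have k8 := thermal_rate_aux hk h0 h1 (sq_nonneg x) hY2 hlow
    have k9 := mul_lt_mul_of_pos_left k8 (mul_pos hp hθ)
    have k5 : -(M * l.re) = 2 * P.muL + P.pStar * P.theta * (A * Y ^ 2 / 6) := by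
      refine mul_right_cancel₀ hp.ne' ?_
      rw [hQY] at hroot
      linear_combination hroot / 6
    linarith
  -- For Δ > 0 the viscous part suffices: β is already strictly below 2μ_l/M.
  · have h2 := b4 hd
    have h3 : 0 < Real.sqrt P.discr / (2 * P.rhoL * P.Rstar) := by positivity
    have h5 : M * β < 2 * P.muL := by
      have := mul_lt_mul_of_pos_left (by linarith : β < 2 * P.muL / M) hMpos
      rwa [mul_div_cancel₀ _ hMpos.ne'] at this
    linarith

end BubbleParams

/-! ### Exponential decay of eventually compact semigroups -/

section CompactSemigroup

/-- If every coefficient vanished, the Fourier series would be summable, hence converge pointwise to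
f, and f would be zero. -/
theorem exists_fourier_ne_zero {f : ℝ → ℂ} (hf : ContinuousOn f (Icc 0 1)) (h01 : f 0 = f 1)
    {t : ℝ} (ht : t ∈ Ico (0 : ℝ) 1) (hft : f t ≠ 0) :
    ∃ k : ℤ, ∫ s in (0 : ℝ)..1, Complex.exp (2 * Real.pi * Complex.I * k * s) * f s ≠ 0 := by
  by_contra! h
  have : Fact ((0 : ℝ) < 1) := ⟨one_pos⟩
  have hc : Continuous (AddCircle.liftIco (1 : ℝ) 0 f) :=
    AddCircle.liftIco_continuous (by simpa using h01) (by simpa using hf)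
  let F : C(AddCircle (1 : ℝ), ℂ) := ⟨_, hc⟩
  have h0 : ∀ n, fourierCoeff F n = 0 := fun n => by
    have h1 : fourierCoeff F n = fourierCoeff (AddCircle.liftIco (1 : ℝ) 0 f) n := rfl
    rw [h1, fourierCoeff_eq_intervalIntegral _ n 0]
    have h2 : ∫ x in (0 : ℝ)..0 + 1, fourier (-n) (x : AddCircle (1 : ℝ)) •
        AddCircle.liftIco (1 : ℝ) 0 f x
        = ∫ s in (0 : ℝ)..1, Complex.exp (2 * Real.pi * Complex.I * (-n : ℤ) * s) * f s := by
      rw [zero_add]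
      refine intervalIntegral.integral_congr_ae ?_
      have : ∀ᵐ x : ℝ, x ≠ 1 := by
        simp [ae_iff]
      filter_upwards [this] with x hx hx'
      rw [uIoc_of_le zero_le_one] at hx'
      rw [AddCircle.liftIco_coe_apply ⟨hx'.1.le, by simpa using lt_of_le_of_ne hx'.2 hx⟩,
        fourier_coe_apply]
      simp
    rw [h2, h, smul_zero]
  have hs : Summable (fourierCoeff F) := by
    have : fourierCoeff F = fun _ => 0 := funext h0
    rw [this]; exact summable_zero
  have h3 := has_pointwise_sum_fourier_series_of_summable hs (t : AddCircle (1 : ℝ))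
  simp only [h0, zero_smul] at h3
  have h4 : F (t : AddCircle (1 : ℝ)) = f t :=
    AddCircle.liftIco_coe_apply (by simpa using ht)
  exact hft (h4 ▸ h3.unique hasSum_zero)

variable {X : Type*} [NormedAddCommGroup X] [NormedSpace ℂ X] [CompleteSpace X]
  {T : ℝ → X →L[ℂ] X}

/-- An eigenvector of the time-one map of a strongly continuous semigroup yields a common
eigenvector of the whole semigroup. -/
theorem exists_common_eigenvector (hc : ∀ x, Continuous fun t => T t x) (h0 : T 0 = 1)
    (hadd : ∀ s t, 0 ≤ s → 0 ≤ t → T (t + s) = T t * T s) {μ : ℂ} (hμ : μ ≠ 0) {x : X}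
    (hx : x ≠ 0) (hμx : T 1 x = μ • x) :
    ∃ (l : ℂ) (y : X), y ≠ 0 ∧ Complex.exp l = μ ∧ ∀ t, 0 ≤ t → T t y = Complex.exp (l * t) • y := by
  obtain ⟨φ, -, hφ⟩ := exists_dual_vector ℂ x (norm_ne_zero_iff.2 hx)
  set l₀ := Complex.log μ
  have hl₀ : Complex.exp l₀ = μ := Complex.exp_log hμ
  have hper : ∀ t, 0 ≤ t → T (t + 1) x = μ • T t x := fun t ht => by
    rw [hadd 1 t zero_le_one ht, mul_apply_eq_comp, hμx, map_smul]
  -- The orbit of x, divided by a logarithmic exponential, is 1-periodic and nonzero. Some Fourier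
  -- mode survives; its vector-valued coefficient is the common eigenvector, and the mode fixes the
  -- branch of the logarithm.
  obtain ⟨k, hk⟩ := exists_fourier_ne_zero (f := fun t => Complex.exp (-l₀ * t) * φ (T t x))
    (t := 0) (by have := hc x; fun_prop) (by
      simp only [h0, hμx, map_smul, smul_eq_mul, one_apply_eq_self]
      rw [← mul_assoc, Complex.ofReal_one, mul_one, Complex.exp_neg, hl₀, inv_mul_cancel₀ hμ]
      simp) ⟨le_rfl, one_pos⟩ (by
      simp only [h0, one_apply_eq_self, hφ]
      simpa using hx)
  set l : ℂ := l₀ - 2 * Real.pi * Complex.I * k with hl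
  have hexpl : Complex.exp l = μ := by
    rw [hl, Complex.exp_sub, hl₀]
    have : Complex.exp (2 * Real.pi * Complex.I * k) = 1 :=
      Complex.exp_eq_one_iff.2 ⟨k, by ring⟩
    rw [this, div_one]
  set G : ℝ → X := fun t => Complex.exp (-l * t) • T t x with hG
  have hGc : Continuous G := by have := hc x; fun_prop
  have hGper : ∀ t, 0 ≤ t → G (t + 1) = G t := fun t ht => by
    simp only [hG]
    rw [hper t ht, smul_smul]
    congr 1
    push_cast
    rw [mul_add, Complex.exp_add, mul_one, Complex.exp_neg l, hexpl, mul_assoc,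
      inv_mul_cancel₀ hμ, mul_one]
  have hi : ∀ a b, IntervalIntegrable G volume a b := fun a b => hGc.intervalIntegrable _ _
  refine ⟨l, ∫ t in (0 : ℝ)..1, G t, fun h => hk ?_, hexpl, fun h hh => ?_⟩
  · have h1 : φ (∫ t in (0 : ℝ)..1, G t) = 0 := by rw [h, map_zero]
    rw [← ContinuousLinearMap.intervalIntegral_comp_comm _ (hi _ _)] at h1
    rw [← h1]
    refine intervalIntegral.integral_congr fun t _ => ?_
    simp only [hG, map_smul, smul_eq_mul]
    rw [← mul_assoc, ← Complex.exp_add]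
    congr 2
    rw [hl]; ring
  · rw [← ContinuousLinearMap.intervalIntegral_comp_comm _ (hi _ _)]
    have h1 : ∫ t in (0 : ℝ)..1, T h (G t)
        = Complex.exp (l * h) • ∫ t in (0 : ℝ)..1, G (t + h) := by
      rw [← intervalIntegral.integral_smul]
      refine intervalIntegral.integral_congr fun t ht => ?_
      rw [uIcc_of_le zero_le_one] at ht
      simp only [hG]
      rw [map_smul, add_comm t h, hadd t h ht.1 hh, mul_apply_eq_comp, smul_smul,
        ← Complex.exp_add]
      congr 2
      push_cast
      ring
    -- What remains is that the integral of a periodic function over a period does not depend on the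
    -- starting point.
    rw [h1, intervalIntegral.integral_comp_add_right, zero_add]
    congr 1
    rw [← intervalIntegral.integral_add_adjacent_intervals (hi h 1) (hi 1 (1 + h)),
      ← intervalIntegral.integral_add_adjacent_intervals (hi 0 h) (hi h 1), add_comm]
    congr 1
    have h2 := intervalIntegral.integral_comp_add_right (a := 0) (b := h) G 1
    rw [zero_add, add_comm h 1] at h2
    rw [← h2]
    refine intervalIntegral.integral_congr fun t ht => ?_
    rw [uIcc_of_le hh] at ht
    exact hGper t ht.1

/-- A semigroup with compact time-one map decays at a prescribed exponential rate if all its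
exponential orbits do so strictly faster. -/
theorem exists_exponential_bound (hc : ∀ x, Continuous fun t => T t x) (h0 : T 0 = 1)
    (hadd : ∀ s t, 0 ≤ s → 0 ≤ t → T (t + s) = T t * T s)
    (hgrowth : ∃ C η : ℝ, 0 ≤ C ∧ 0 < η ∧ ∀ t, 0 ≤ t → ‖T t‖ ≤ C * Real.exp (η * t))
    (hcomp : IsCompactOperator (T 1)) {b : ℝ}
    (hspec : ∀ (l : ℂ) (x : X), x ≠ 0 → (∀ t, 0 ≤ t → T t x = Complex.exp (l * t) • x) →
      l.re < -b) :
    ∃ C : ℝ, 0 ≤ C ∧ ∀ t, 0 ≤ t → ‖T t‖ ≤ C * Real.exp (-b * t) := by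
  obtain ⟨C, η, hC, hη, hCη⟩ := hgrowth
  rcases subsingleton_or_nontrivial X with hX | hX
  · refine ⟨0, le_rfl, fun t _ => ?_⟩
    have : T t = 0 := by ext x; exact Subsingleton.elim _ _
    rw [this]; simp
  set q : NNReal := ⟨Real.exp (-b), (Real.exp_pos _).le⟩ with hq
  -- Nonzero spectrum of a compact operator consists of eigenvalues, each of the form e^l with Re l
  -- < -b. Strictness passes to the supremum over the spectrum.
  have hr : spectralRadius ℂ (T 1) < q := by
    refine spectrum.spectralRadius_lt_of_forall_lt _ fun μ hμ => ?_
    by_cases hμ0 : μ = 0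
    · rw [hμ0, nnnorm_zero]; exact Real.exp_pos _
    obtain ⟨x, hx⟩ := ((hcomp.hasEigenvalue_iff_mem_spectrum hμ0).2 hμ).exists_hasEigenvector
    obtain ⟨l, y, hy, hl, hTy⟩ := exists_common_eigenvector hc h0 hadd hμ0 hx.2 hx.apply_eq_smul
    have := hspec l y hy hTy
    rw [← hl, ← NNReal.coe_lt_coe, coe_nnnorm, Complex.norm_exp]
    exact Real.exp_lt_exp.2 this
  have hev := (spectrum.pow_nnnorm_pow_one_div_tendsto_nhds_spectralRadius (T 1)).eventually
    (gt_mem_nhds hr)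
  obtain ⟨N, hN⟩ := Filter.eventually_atTop.1 hev
  have hpow : ∀ n : ℕ, T n = T 1 ^ n := fun n => by
    induction n with
    | zero => simpa using h0
    | succ n ih =>
      push_cast
      rw [add_comm (n : ℝ) 1, hadd n 1 (by positivity) zero_le_one, ih, pow_succ']
  -- Excludes n = 0, for which the root in Gelfand's formula is meaningless.
  set M := N + 1
  have hM : ∀ n, M ≤ n → ‖T 1 ^ n‖ ≤ Real.exp (-b * n) := fun n hn => by
    have h1 := (hN n (by omega)).le
    have hn0 : (0 : ℝ) < n := by
      have : 0 < n := by omega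
      exact_mod_cast this
    have h2 := ENNReal.rpow_le_rpow h1 hn0.le
    rw [← ENNReal.rpow_mul, one_div_mul_cancel hn0.ne', ENNReal.rpow_one] at h2
    rw [← ENNReal.coe_rpow_of_nonneg _ hn0.le, ENNReal.coe_le_coe] at h2
    have h3 : ‖T 1 ^ n‖ ≤ Real.exp (-b) ^ (n : ℝ) := by exact_mod_cast h2
    rwa [← Real.exp_mul] at h3
  set A := C * Real.exp (η * (M + 1)) with hA
  have hA0 : 0 ≤ A := by positivity
  have hE1 : ∀ s ∈ Icc (0 : ℝ) (M + 1), Real.exp (b * s) ≤ Real.exp (|b| * (M + 1)) := by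
    intro s hs
    refine Real.exp_le_exp.2 ?_
    calc b * s ≤ |b| * s := mul_le_mul_of_nonneg_right (le_abs_self b) hs.1
      _ ≤ _ := mul_le_mul_of_nonneg_left hs.2 (abs_nonneg b)
  have hT1 : ∀ s ∈ Icc (0 : ℝ) (M + 1), ‖T s‖ ≤ A := fun s hs =>
    (hCη s hs.1).trans (by rw [hA]; gcongr; exact hs.2)
  refine ⟨A * Real.exp (|b| * (M + 1)), by positivity, fun t ht => ?_⟩
  rcases le_or_gt t (M + 1) with h | h
  · have e : Real.exp (b * t) * Real.exp (-b * t) = 1 := by rw [← Real.exp_add]; simp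
    calc ‖T t‖ ≤ A * (Real.exp (b * t) * Real.exp (-b * t)) := by
          rw [e, mul_one]; exact hT1 t ⟨ht, h⟩
      _ ≤ A * (Real.exp (|b| * (M + 1)) * Real.exp (-b * t)) := by
          exact mul_le_mul_of_nonneg_left (mul_le_mul_of_nonneg_right (hE1 t ⟨ht, h⟩)
            (Real.exp_pos _).le) hA0
      _ = _ := by ring
  · set n := ⌊t⌋₊ with hn
    have hnt : (n : ℝ) ≤ t := Nat.floor_le ht
    have hnt' : t < n + 1 := Nat.lt_floor_add_one t
    have hMn : M ≤ n := by
      rw [hn, Nat.le_floor_iff ht]; linarith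
    have hs : t - n ∈ Icc (0 : ℝ) (M + 1) := ⟨by linarith, by
      have : (0 : ℝ) ≤ M := by positivity
      linarith⟩
    have e : T t = T (t - n) * T 1 ^ n := by
      rw [← hpow, ← hadd n (t - n) (by positivity) hs.1, sub_add_cancel]
    have e2 : Real.exp (-b * n) = Real.exp (b * (t - n)) * Real.exp (-b * t) := by
      rw [← Real.exp_add]; congr 1; ring
    calc ‖T t‖ ≤ ‖T (t - n)‖ * ‖T 1 ^ n‖ := by rw [e]; exact norm_mul_le _ _
      _ ≤ A * Real.exp (-b * n) := by gcongr; exacts [hT1 _ hs, hM n hMn]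
      _ ≤ A * (Real.exp (|b| * (M + 1)) * Real.exp (-b * t)) := by
          rw [e2]
          exact mul_le_mul_of_nonneg_left (mul_le_mul_of_nonneg_right (hE1 _ hs)
            (Real.exp_pos _).le) hA0
      _ = _ := by ring

/-- Bounded perturbations preserve immediate compactness. -/
theorem IsMildSolution.isCompactOperator {E : ℝ → X →L[ℂ] X} (hE : IsContractionSemigroup E)
    {B : X →L[ℂ] X} (hcomp : ∀ t, 0 < t → IsCompactOperator (E t))
    (hT : ∀ x, IsMildSolution E B x fun t => T t x)
    (hgrowth : ∃ C η : ℝ, 0 ≤ C ∧ 0 < η ∧ ∀ t, 0 ≤ t → ‖T t‖ ≤ C * Real.exp (η * t)) :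
    IsCompactOperator (T 1) := by
  obtain ⟨C, η, hC, hη, hCη⟩ := hgrowth
  set A := C * Real.exp η with hA
  have hA1 : ∀ s ∈ Icc (0 : ℝ) 1, ‖T s‖ ≤ A := fun s hs =>
    (hCη s hs.1).trans (by rw [hA]; gcongr; nlinarith [hs.2])
  have hi : ∀ x (t a b : ℝ), IntervalIntegrable (fun q => E (t - q) (B (T q x))) volume a b :=
    fun x t a b => (hE.continuous_comp (by fun_prop)
      (B.continuous.comp (hT x).cont)).intervalIntegrable _ _
  -- The difference is the Duhamel integral over [1-δ, 1]. Thus T(1) is a norm limit of operators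
  -- with the compact factor E(δ).
  have key : ∀ δ ∈ Ioo (0 : ℝ) 1, ‖E δ * T (1 - δ) - T 1‖ ≤ ‖B‖ * A * δ := fun δ hδ => by
    refine ContinuousLinearMap.opNorm_le_bound _ (by have := hδ.1; positivity) fun x => ?_
    have h1 := (hT x).eq 1 zero_le_one
    have h2 := (hT x).eq (1 - δ) (by linarith [hδ.2])
    have h3 : E δ (∫ s in (0 : ℝ)..(1 - δ), E (1 - δ - s) (B (T s x)))
        = ∫ s in (0 : ℝ)..(1 - δ), E (1 - s) (B (T s x)) := by
      rw [← ContinuousLinearMap.intervalIntegral_comp_comm _ (hi _ _ _ _)]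
      refine intervalIntegral.integral_congr fun s hs => ?_
      rw [uIcc_of_le (by linarith [hδ.2])] at hs
      rw [← hE.map_add δ _ hδ.1.le (by linarith [hs.2])]
      congr 2
      ring
    have h4 : E 1 x = E δ (E (1 - δ) x) := by
      rw [← hE.map_add δ (1 - δ) hδ.1.le (by linarith [hδ.2])]
      congr 2; ring
    have h5 : (E δ * T (1 - δ) - T 1) x = -∫ s in (1 - δ)..1, E (1 - s) (B (T s x)) := by
      rw [sub_apply, mul_apply_eq_comp, h2, h1, map_add, h3, h4,
        ← intervalIntegral.integral_add_adjacent_intervals (hi x 1 0 (1 - δ)) (hi x 1 (1 - δ) 1)]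
      abel
    rw [h5, norm_neg]
    have h6 : ∀ s ∈ uIoc (1 - δ) 1, ‖E (1 - s) (B (T s x))‖ ≤ ‖B‖ * A * ‖x‖ := fun s hs => by
      rw [uIoc_of_le (by linarith [hδ.1])] at hs
      calc _ ≤ ‖B (T s x)‖ := hE.norm_le _ _
        _ ≤ ‖B‖ * (‖T s‖ * ‖x‖) := (B.le_opNorm _).trans (by gcongr; exact (T s).le_opNorm x)
        _ ≤ ‖B‖ * (A * ‖x‖) := by gcongr; exact hA1 s ⟨by linarith [hs.1, hδ.2], hs.2⟩
        _ = _ := by ring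
    have h7 := intervalIntegral.norm_integral_le_of_norm_le_const h6
    rw [sub_sub_cancel, abs_of_pos hδ.1] at h7
    linarith [h7, mul_right_comm (‖B‖ * A) ‖x‖ δ]
  refine isCompactOperator_of_tendsto (l := nhdsWithin (0 : ℝ) (Ioi 0))
    (F := fun δ => E δ * T (1 - δ)) ?_ ?_
  · rw [tendsto_iff_norm_sub_tendsto_zero]
    refine squeeze_zero' (Filter.Eventually.of_forall fun _ => norm_nonneg _)
      (g := fun δ => ‖B‖ * A * δ) ?_ ?_
    · filter_upwards [Ioo_mem_nhdsGT (zero_lt_one' ℝ)] with δ hδ using key δ hδ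
    · have : Continuous fun δ : ℝ => ‖B‖ * A * δ := by fun_prop
      simpa using (this.tendsto 0).mono_left nhdsWithin_le_nhds
  · filter_upwards [self_mem_nhdsWithin] with δ hδ
    exact (hcomp δ hδ).comp_clm (T (1 - δ))

end CompactSemigroup

/-! ### Diagonal semigroups on `ℓ²` -/

section DiagSemigroup

/-- Square-summable families. -/
abbrev Ell2 (ι 𝕜 : Type*) [RCLike 𝕜] : Type _ := lp (fun _ : ι => 𝕜) 2

variable {ι 𝕜 : Type*} [RCLike 𝕜]

theorem memℓp_two_iff {f : ι → 𝕜} :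
    Memℓp (E := fun _ => 𝕜) f 2 ↔ Summable fun i => ‖f i‖ ^ 2 := by
  rw [memℓp_gen_iff (by norm_num)]
  norm_num

theorem Ell2.summable_sq (f : Ell2 ι 𝕜) : Summable fun i => ‖f i‖ ^ 2 :=
  memℓp_two_iff.1 (lp.memℓp f)

theorem Ell2.norm_sq (f : Ell2 ι 𝕜) : ‖f‖ ^ 2 = ∑' i, ‖f i‖ ^ 2 := by
  have := lp.norm_rpow_eq_tsum (p := 2) (by norm_num) f
  norm_num at this
  exact this

/-- Dominated convergence for the series of squared coordinate differences. -/
theorem Ell2.continuousOn_of_dominated {f : ℝ → Ell2 ι 𝕜} {s : Set ℝ}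
    (hc : ∀ i, ContinuousOn (fun t => f t i) s)
    (hd : ∀ t ∈ s, ∃ M : ι → ℝ, Summable (fun i => M i ^ 2) ∧
      ∀ᶠ u in nhdsWithin t s, ∀ i, ‖f u i‖ ≤ M i) : ContinuousOn f s := by
  intro t ht
  obtain ⟨M, hM, hMb⟩ := hd t ht
  rw [ContinuousWithinAt, tendsto_iff_norm_sub_tendsto_zero]
  have hsq : Filter.Tendsto (fun u => ‖f u - f t‖ ^ 2) (nhdsWithin t s) (nhds 0) := by
    have h1 : Filter.Tendsto (fun u => ∑' i, ‖f u i - f t i‖ ^ 2) (nhdsWithin t s)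
        (nhds (∑' _ : ι, (0 : ℝ))) := by
      refine tendsto_tsum_of_dominated_convergence (bound := fun i => 4 * M i ^ 2)
        (hM.mul_left 4) (fun i => ?_) ?_
      · have h2 : ContinuousWithinAt (fun u => ‖f u i - f t i‖ ^ 2) s t :=
          ((hc i t ht).sub continuousWithinAt_const).norm.pow 2
        simpa using h2.tendsto
      · have hMt := hMb.self_of_nhdsWithin ht
        filter_upwards [hMb] with u hu i
        have h3 : ‖f u i - f t i‖ ≤ 2 * M i := by
          have := norm_sub_le (f u i) (f t i)
          linarith [hu i, hMt i]
        rw [Real.norm_of_nonneg (by positivity)]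
        calc ‖f u i - f t i‖ ^ 2 ≤ (2 * M i) ^ 2 := by gcongr
          _ = _ := by ring
    rw [tsum_zero] at h1
    refine h1.congr fun u => ?_
    rw [Ell2.norm_sq]
    rfl
  have h4 := hsq.sqrt
  rw [Real.sqrt_zero] at h4
  refine h4.congr fun u => Real.sqrt_sq (norm_nonneg _)

theorem Ell2.continuous_coord (i : ι) : Continuous fun f : Ell2 ι 𝕜 => f i :=
  (lp.evalCLM 𝕜 (fun _ : ι => 𝕜) 2 i).continuous

/-- The semigroup `(x_i) ↦ (e^{-r_i t} x_i)`. -/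
def diagSemigroup (r : ι → ℝ) (hr : ∀ i, 0 ≤ r i) (t : ℝ) : Ell2 ι ℂ →L[ℂ] Ell2 ι ℂ :=
  lp.mapCLM 2 (fun i => (Real.exp (-r i * max t 0) : ℂ) • (1 : ℂ →L[ℂ] ℂ)) zero_le_one
    (fun i => by
      rw [norm_smul, norm_one, mul_one, Complex.norm_real, Real.norm_eq_abs, Real.abs_exp]
      exact Real.exp_le_one_iff.2 (by
        have := mul_nonneg (hr i) (le_max_right t 0)
        linarith))

variable {r : ι → ℝ} {hr : ∀ i, 0 ≤ r i}

theorem diagSemigroup_apply (t : ℝ) (x : Ell2 ι ℂ) (i : ι) :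
    diagSemigroup r hr t x i = (Real.exp (-r i * max t 0) : ℂ) * x i := rfl

theorem isContractionSemigroup_diagSemigroup :
    IsContractionSemigroup (diagSemigroup r hr) where
  map_zero := by
    ext x i
    rw [diagSemigroup_apply]
    simp
  map_add s t hs ht x := by
    ext i
    simp only [diagSemigroup_apply]
    rw [max_eq_left hs, max_eq_left ht, max_eq_left (add_nonneg hs ht), mul_add, Real.exp_add]
    push_cast
    ring
  norm_le t x := by
    have := lp.norm_mapCLM_le 2 (fun i => (Real.exp (-r i * max t 0) : ℂ) • (1 : ℂ →L[ℂ] ℂ))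
      zero_le_one (fun i => by
        rw [norm_smul, norm_one, mul_one, Complex.norm_real, Real.norm_eq_abs, Real.abs_exp]
        exact Real.exp_le_one_iff.2 (by
          have := mul_nonneg (hr i) (le_max_right t 0)
          linarith))
    exact ((diagSemigroup r hr t).le_of_opNorm_le this x).trans (one_mul _).le
  cont x := by
    rw [← continuousOn_univ]
    refine Ell2.continuousOn_of_dominated (fun i => ?_) fun t _ =>
      ⟨fun i => ‖x i‖, Ell2.summable_sq x, Filter.Eventually.of_forall fun u i => ?_⟩
    · simp only [diagSemigroup_apply]
      fun_prop
    · rw [diagSemigroup_apply, norm_mul, Complex.norm_real, Real.norm_eq_abs, Real.abs_exp]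
      refine mul_le_of_le_one_left (norm_nonneg _) (Real.exp_le_one_iff.2 ?_)
      have := mul_nonneg (hr i) (le_max_right u 0)
      linarith

/-- The summable exponentials bound the norms of the rank-one coordinate pieces, so the operator is
a norm limit of finite-rank ones. -/
theorem isCompactOperator_diagSemigroup {t : ℝ} (ht : 0 < t)
    (hs : Summable fun i => Real.exp (-r i * t)) : IsCompactOperator (diagSemigroup r hr t) := by
  classical
  set A : ι → Ell2 ι ℂ →L[ℂ] Ell2 ι ℂ := fun i => (Real.exp (-r i * t) : ℂ) •
    (lp.singleContinuousLinearMap ℂ (fun _ : ι => ℂ) 2 i).comp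
      (lp.evalCLM ℂ (fun _ : ι => ℂ) 2 i) with hA
  have hAapp : ∀ i x, A i x = (Real.exp (-r i * t) : ℂ) • lp.single 2 i (x i) := fun i x => rfl
  have hsum : Summable A := by
    refine Summable.of_norm_bounded hs fun i => ?_
    refine ContinuousLinearMap.opNorm_le_bound _ (Real.exp_pos _).le fun x => ?_
    rw [hAapp, norm_smul, Complex.norm_real, Real.norm_eq_abs, Real.abs_exp,
      lp.norm_single (by norm_num)]
    gcongr
    exact lp.norm_apply_le_norm (by norm_num) x i
  have hE : diagSemigroup r hr t = ∑' i, A i := by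
    ext x j
    have h1 := hsum.hasSum.mapL ((lp.evalCLM ℂ (fun _ : ι => ℂ) 2 j).comp
      (ContinuousLinearMap.apply ℂ (Ell2 ι ℂ) x))
    have h2 : ∀ i, ((lp.evalCLM ℂ (fun _ : ι => ℂ) 2 j).comp
        (ContinuousLinearMap.apply ℂ (Ell2 ι ℂ) x)) (A i)
        = if i = j then (Real.exp (-r j * t) : ℂ) * x j else 0 := fun i => by
      have h3 : ((lp.evalCLM ℂ (fun _ : ι => ℂ) 2 j).comp
        (ContinuousLinearMap.apply ℂ (Ell2 ι ℂ) x)) (A i)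
          = (Real.exp (-r i * t) : ℂ) * (lp.single (E := fun _ : ι => ℂ) 2 i (x i)) j := rfl
      rw [h3]
      by_cases h : i = j
      · subst h; rw [if_pos rfl, lp.single_apply_self]
      · rw [if_neg h, lp.single_apply_ne _ _ _ (Ne.symm h), mul_zero]
    simp only [h2] at h1
    rw [diagSemigroup_apply, max_eq_left ht.le]
    exact (h1.unique (hasSum_ite_eq j _)).symm
  rw [hE]
  refine isCompactOperator_of_tendsto hsum.hasSum (Filter.Eventually.of_forall fun s => ?_)
  have : ∀ i ∈ s, A i ∈ compactOperator (RingHom.id ℂ) (Ell2 ι ℂ) (Ell2 ι ℂ) := fun i _ =>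
    Submodule.smul_mem _ _ (((isCompactOperator_of_locallyCompactSpace_rng
      (1 : ℂ →L[ℂ] ℂ)).comp_clm (lp.evalCLM ℂ (fun _ : ι => ℂ) 2 i)).clm_comp
        (lp.singleContinuousLinearMap ℂ (fun _ : ι => ℂ) 2 i))
  exact Submodule.sum_mem _ this

theorem IsMildSolution.coord_eq {B : Ell2 ι ℂ →L[ℂ] Ell2 ι ℂ} {x : Ell2 ι ℂ}
    {y : ℝ → Ell2 ι ℂ} (h : IsMildSolution (diagSemigroup r hr) B x y) {t : ℝ} (ht : 0 ≤ t)
    (i : ι) : y t i = (Real.exp (-r i * t) : ℂ) * x i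
      + ∫ s in (0 : ℝ)..t, (Real.exp (-r i * (t - s)) : ℂ) * B (y s) i := by
  rw [h.eq t ht]
  have h1 : (diagSemigroup r hr t x + ∫ s in (0 : ℝ)..t, diagSemigroup r hr (t - s) (B (y s))) i
      = diagSemigroup r hr t x i + lp.evalCLM ℂ (fun _ : ι => ℂ) 2 i
        (∫ s in (0 : ℝ)..t, diagSemigroup r hr (t - s) (B (y s))) := rfl
  refine h1.trans ?_
  rw [diagSemigroup_apply, max_eq_left ht, ← ContinuousLinearMap.intervalIntegral_comp_comm]
  · congr 1
    refine intervalIntegral.integral_congr fun s hs => ?_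
    rw [uIcc_of_le ht] at hs
    have h2 : (lp.evalCLM ℂ (fun _ : ι => ℂ) 2 i) (diagSemigroup r hr (t - s) (B (y s)))
      = diagSemigroup r hr (t - s) (B (y s)) i := rfl
    simp only [h2]
    rw [diagSemigroup_apply, max_eq_left (by linarith [hs.2])]
  · exact (isContractionSemigroup_diagSemigroup.continuous_comp (by fun_prop)
      (B.continuous.comp h.cont)).intervalIntegrable _ _

/-- Factoring e^{-r t} out of the Duhamel formula leaves an integral with continuous integrand.
Coordinatewise the equation holds up to t = 0 although the rates may be unbounded. -/
theorem IsMildSolution.hasDerivWithinAt_coord {B : Ell2 ι ℂ →L[ℂ] Ell2 ι ℂ} {x : Ell2 ι ℂ}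
    {y : ℝ → Ell2 ι ℂ} (h : IsMildSolution (diagSemigroup r hr) B x y) {t : ℝ} (ht : 0 ≤ t)
    (i : ι) : HasDerivWithinAt (fun s => y s i) (-r i * y t i + B (y t) i) (Ici 0) t := by
  have hBc : Continuous fun s => B (y s) i :=
    (Ell2.continuous_coord i).comp (B.continuous.comp h.cont)
  set g : ℝ → ℂ := fun s => (Real.exp (r i * s) : ℂ) * B (y s) i with hg
  have hgc : Continuous g :=
    (by fun_prop : Continuous fun s : ℝ => ((Real.exp (r i * s) : ℝ) : ℂ)).mul hBc
  have key : ∀ s, 0 ≤ s → y s i = (Real.exp (-r i * s) : ℂ) * (x i + ∫ u in (0 : ℝ)..s, g u) := by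
    intro s hs
    rw [h.coord_eq hs, mul_add, ← intervalIntegral.integral_const_mul]
    congr 1
    refine intervalIntegral.integral_congr fun u _ => ?_
    simp only [hg]
    rw [← mul_assoc, ← Complex.ofReal_mul, ← Real.exp_add]
    congr 3
    ring
  have h1 : HasDerivAt (fun s : ℝ => (Real.exp (-r i * s) : ℂ))
      ((Real.exp (-r i * t) * (-r i * 1) : ℝ) : ℂ) t :=
    (((hasDerivAt_id t).const_mul (-r i)).exp).ofReal_comp
  have h2 : HasDerivAt (fun s : ℝ => x i + ∫ u in (0 : ℝ)..s, g u) (g t) t :=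
    (intervalIntegral.integral_hasDerivAt_right (hgc.intervalIntegrable _ _)
      (hgc.stronglyMeasurableAtFilter _ _) hgc.continuousAt).const_add _
  have h3 := ((h1.mul h2).hasDerivWithinAt (s := Ici 0)).congr key (key t ht)
  refine h3.congr_deriv ?_
  rw [key t ht]
  have e : (Real.exp (-r i * t) : ℂ) * g t = B (y t) i := by
    simp only [hg]
    rw [← mul_assoc, ← Complex.ofReal_mul, ← Real.exp_add]
    simp
  rw [e]
  push_cast
  ring

/-- Parabolic smoothing for a scalar mode driven by a bounded forcing. -/
theorem norm_rate_mul_le {ρ t M : ℝ} (hρ : 0 ≤ ρ) (ht : 0 < t) {x b y : ℂ} {v : ℝ → ℂ}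
    (hM : ∀ s ∈ Icc 0 t, ‖v s‖ ≤ M)
    (hy : y = (Real.exp (-ρ * t) : ℂ) * x
      + ∫ s in (0 : ℝ)..t, (Real.exp (-ρ * (t - s)) : ℂ) * (v s * b)) :
    ‖(ρ : ℂ) * y‖ ≤ t⁻¹ * ‖x‖ + M * ‖b‖ := by
  have hM0 : 0 ≤ M := (norm_nonneg _).trans (hM 0 ⟨le_rfl, ht.le⟩)
  rcases hρ.eq_or_lt with h0 | h0
  · rw [← h0]
    simp only [Complex.ofReal_zero, zero_mul, norm_zero]
    positivity
  -- From ρt ≤ e^{ρt}; the resulting bound is independent of ρ.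
  have h1 : ρ * Real.exp (-ρ * t) ≤ t⁻¹ := by
    rw [neg_mul, Real.exp_neg, ← div_eq_mul_inv, div_le_iff₀ (Real.exp_pos _),
      inv_mul_eq_div, le_div_iff₀ ht]
    linarith [Real.add_one_le_exp (ρ * t)]
  have h2 : ‖∫ s in (0 : ℝ)..t, (Real.exp (-ρ * (t - s)) : ℂ) * (v s * b)‖ ≤ M * ‖b‖ / ρ := by
    refine (intervalIntegral.norm_integral_le_of_norm_le ht.le
      (g := fun s => Real.exp (-ρ * (t - s)) * (M * ‖b‖))
      (Filter.Eventually.of_forall fun s hs => ?_)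
      (by apply Continuous.intervalIntegrable; fun_prop)).trans
        (weighted_integral_bound h0 (by positivity))
    rw [norm_mul, norm_mul, Complex.norm_real, Real.norm_eq_abs, Real.abs_exp]
    gcongr
    exact hM s ⟨hs.1.le, hs.2⟩
  rw [hy, norm_mul, Complex.norm_real, Real.norm_of_nonneg hρ]
  calc ρ * ‖(Real.exp (-ρ * t) : ℂ) * x
        + ∫ s in (0 : ℝ)..t, (Real.exp (-ρ * (t - s)) : ℂ) * (v s * b)‖
      ≤ ρ * (Real.exp (-ρ * t) * ‖x‖ + M * ‖b‖ / ρ) := by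
        refine mul_le_mul_of_nonneg_left ((norm_add_le _ _).trans (add_le_add ?_ h2)) hρ
        rw [norm_mul, Complex.norm_real, Real.norm_eq_abs, Real.abs_exp]
    _ = (ρ * Real.exp (-ρ * t)) * ‖x‖ + M * ‖b‖ := by field_simp
    _ ≤ _ := by gcongr

end DiagSemigroup

/-! ### A diagonal parabolic system coupled to a damped oscillator -/

section Coupled

/-- Continuity of F in norm allows integrating coordinate by coordinate to f(s) = f(t) + ∫F, which
is then differentiated in ℓ². -/
theorem Ell2.hasDerivAt_of_coord {ι : Type*} {f F : ℝ → Ell2 ι ℝ} (hF : ContinuousOn F (Ioi 0))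
    (hd : ∀ i t, 0 < t → HasDerivAt (fun s => f s i) (F t i) t) {t : ℝ} (ht : 0 < t) :
    HasDerivAt f (F t) t := by
  have hsub : ∀ s, 0 < s → uIcc t s ⊆ Ioi 0 := fun s hs u hu =>
    lt_of_lt_of_le (lt_min ht hs) hu.1
  have hint : ∀ s, 0 < s → IntervalIntegrable F volume t s := fun s hs =>
    (hF.mono (hsub s hs)).intervalIntegrable
  have key : ∀ s, 0 < s → f s = f t + ∫ u in t..s, F u := by
    intro s hs
    ext i
    have h1 : (f t + ∫ u in t..s, F u) i
        = f t i + lp.evalCLM ℝ (fun _ : ι => ℝ) 2 i (∫ u in t..s, F u) := rfl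
    refine Eq.trans ?_ h1.symm
    rw [← ContinuousLinearMap.intervalIntegral_comp_comm _ (hint s hs)]
    have h2 : ∫ u in t..s, lp.evalCLM ℝ (fun _ : ι => ℝ) 2 i (F u) = f s i - f t i :=
      intervalIntegral.integral_eq_sub_of_hasDerivAt (f := fun s => f s i)
        (fun u hu => hd i u (hsub s hs hu))
        (((lp.evalCLM ℝ (fun _ : ι => ℝ) 2 i).continuous.comp_continuousOn
          (hF.mono (hsub s hs))).intervalIntegrable)
    rw [h2]
    ring
  have h3 : HasDerivAt (fun s => f t + ∫ u in t..s, F u) (F t) t :=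
    (intervalIntegral.integral_hasDerivAt_right (hint t ht)
      (hF.stronglyMeasurableAtFilter isOpen_Ioi t ht)
      (hF.continuousAt (Ioi_mem_nhds ht))).const_add _
  refine h3.congr_of_eventuallyEq ?_
  filter_upwards [Ioi_mem_nhds ht] with s hs using key s hs

variable {J : Type*}

/-- The parabolic components of a state. -/
def modeProj : Ell2 (J ⊕ Bool) ℂ →L[ℂ] Ell2 J ℂ :=
  LinearMap.mkContinuous
    { toFun := fun x => ⟨fun j => x (Sum.inl j), memℓp_two_iff.2
        ((Ell2.summable_sq x).comp_injective Sum.inl_injective)⟩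
      map_add' := fun _ _ => rfl
      map_smul' := fun _ _ => rfl } 1 (fun x => by
    rw [one_mul]
    refine le_of_sq_le_sq ?_ (norm_nonneg _)
    rw [Ell2.norm_sq, Ell2.norm_sq]
    exact Summable.tsum_le_tsum_of_inj Sum.inl Sum.inl_injective (fun _ _ => by positivity)
      (fun _ => le_rfl) ((Ell2.summable_sq x).comp_injective Sum.inl_injective)
      (Ell2.summable_sq x))

theorem norm_modeProj_le : ‖modeProj (J := J)‖ ≤ 1 := by
  unfold modeProj
  exact LinearMap.mkContinuous_norm_le _ zero_le_one _

/-- The coordinatewise real part. -/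
def reMap : Ell2 J ℂ →L[ℝ] Ell2 J ℝ :=
  have hle : ∀ (x : Ell2 J ℂ) j, ‖(x j).re‖ ^ 2 ≤ ‖x j‖ ^ 2 := fun x j => by
    gcongr; exact Complex.abs_re_le_norm _
  have hs : ∀ x : Ell2 J ℂ, Summable fun j => ‖(x j).re‖ ^ 2 := fun x =>
    (Ell2.summable_sq x).of_nonneg_of_le (fun _ => by positivity) (hle x)
  LinearMap.mkContinuous
    { toFun := fun x => ⟨fun j => (x j).re, memℓp_two_iff.2 (hs x)⟩
      map_add' := fun _ _ => rfl
      map_smul' := fun c x => by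
        ext j
        have h : ((c • x : Ell2 J ℂ) j) = (c : ℂ) * x j := rfl
        have h2 : ((RingHom.id ℝ c • (⟨fun j => (x j).re, memℓp_two_iff.2 (hs x)⟩ : Ell2 J ℝ)) j)
          = c * (x j).re := rfl
        refine Eq.trans ?_ h2.symm
        have h3 : (((c • x : Ell2 J ℂ) j)).re = c * (x j).re := by
          rw [h, Complex.re_ofReal_mul]
        exact h3 } 1 (fun x => by
    rw [one_mul]
    refine le_of_sq_le_sq ?_ (norm_nonneg _)
    rw [Ell2.norm_sq, Ell2.norm_sq]
    exact (hs x).tsum_le_tsum (hle x) (Ell2.summable_sq x))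

theorem norm_reMap_le : ‖reMap (J := J)‖ ≤ 1 := by
  unfold reMap
  exact LinearMap.mkContinuous_norm_le _ zero_le_one _

theorem reMap_apply (x : Ell2 J ℂ) (j : J) : reMap x j = (x j).re := rfl

/-- The state with parabolic components `w`, position `R` and velocity `V`. -/
def packState (w : Ell2 J ℝ) (R V : ℝ) : Ell2 (J ⊕ Bool) ℂ :=
  ⟨Sum.elim (fun j => (w j : ℂ)) fun c => if c then (V : ℂ) else R, memℓp_two_iff.2
    (Summable.sum _ (by
      refine (Ell2.summable_sq w).congr fun j => ?_
      simp) (Summable.of_finite))⟩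

theorem packState_inl (w : Ell2 J ℝ) (R V : ℝ) (j : J) : packState w R V (Sum.inl j) = w j := rfl

theorem packState_false (w : Ell2 J ℝ) (R V : ℝ) : packState w R V (Sum.inr false) = R := rfl

theorem packState_true (w : Ell2 J ℝ) (R V : ℝ) : packState w R V (Sum.inr true) = V := rfl

/-- The complexification of a real family. -/
def complexify (p : Ell2 J ℝ) : Ell2 J ℂ := modeProj (packState p 0 0)

theorem complexify_apply (p : Ell2 J ℝ) (j : J) : complexify p j = p j := rfl

theorem inner_complexify (p : Ell2 J ℝ) (x : Ell2 J ℂ) :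
    HasSum (fun j => (p j : ℂ) * x j) (inner ℂ (complexify p) x) := by
  refine (lp.hasSum_inner (complexify p) x).congr_fun fun j => ?_
  rw [complexify_apply]
  simp [mul_comm]

theorem re_inner_complexify (p : Ell2 J ℝ) (x : Ell2 J ℂ) :
    (inner ℂ (complexify p) x).re = inner ℝ p (reMap x) := by
  have h1 := (inner_complexify p x).mapL Complex.reCLM
  refine h1.unique ((lp.hasSum_inner p (reMap x)).congr_fun fun j => ?_)
  rw [reMap_apply]
  simp [mul_comm]

/-- The coupling operator. -/
def couplingOp (b p : Ell2 J ℝ) (k a : ℝ) : Ell2 (J ⊕ Bool) ℂ →L[ℂ] Ell2 (J ⊕ Bool) ℂ :=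
  (lp.evalCLM ℂ (fun _ : J ⊕ Bool => ℂ) 2 (Sum.inr true)).smulRight (packState b 1 (-a))
  + (-((innerSL ℂ (complexify p)).comp modeProj)
      - (k : ℂ) • lp.evalCLM ℂ (fun _ : J ⊕ Bool => ℂ) 2 (Sum.inr false)).smulRight
        (packState (0 : Ell2 J ℝ) 0 1)

variable {b p : Ell2 J ℝ} {k a : ℝ}

theorem couplingOp_inl (x : Ell2 (J ⊕ Bool) ℂ) (j : J) :
    couplingOp b p k a x (Sum.inl j) = x (Sum.inr true) * b j := by
  have h : couplingOp b p k a x (Sum.inl j) = x (Sum.inr true) * b j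
    + (-(inner ℂ (complexify p) (modeProj x)) - k * x (Sum.inr false)) * ((0 : ℝ) : ℂ) := rfl
  rw [h]; simp

theorem couplingOp_false (x : Ell2 (J ⊕ Bool) ℂ) :
    couplingOp b p k a x (Sum.inr false) = x (Sum.inr true) := by
  have h : couplingOp b p k a x (Sum.inr false) = x (Sum.inr true) * ((1 : ℝ) : ℂ)
    + (-(inner ℂ (complexify p) (modeProj x)) - k * x (Sum.inr false)) * ((0 : ℝ) : ℂ) := rfl
  rw [h]; simp

theorem couplingOp_true (x : Ell2 (J ⊕ Bool) ℂ) :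
    couplingOp b p k a x (Sum.inr true) = -(inner ℂ (complexify p) (modeProj x))
      - k * x (Sum.inr false) - a * x (Sum.inr true) := by
  have h : couplingOp b p k a x (Sum.inr true) = x (Sum.inr true) * ((-a : ℝ) : ℂ)
    + (-(inner ℂ (complexify p) (modeProj x)) - k * x (Sum.inr false)) * ((1 : ℝ) : ℂ) := rfl
  rw [h]; push_cast; ring

/-- An eigenvector of the coupled system for the eigenvalue `l`. -/
structure IsCoupledEigenvector (α : J → ℝ) (b p : Ell2 J ℝ) (k a : ℝ) (l : ℂ) (w : Ell2 J ℂ)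
    (R V : ℂ) : Prop where
  mode : ∀ j, l * w j = -α j * w j + V * b j
  pos : l * R = V
  vel : l * V = -(inner ℂ (complexify p) w) - k * R - a * V

/-- The coupled system is solvable for all initial data, with exponential decay at any rate which
is strictly beaten by all eigenvalues. -/
theorem exists_coupled_solution {α : J → ℝ} (hα : ∀ j, 0 < α j) (hs : Summable fun j => (α j)⁻¹)
    (b p : Ell2 J ℝ) (k a : ℝ) {β : ℝ}
    (hspec : ∀ (l : ℂ) (w : Ell2 J ℂ) (R V : ℂ), -β ≤ l.re →
      IsCoupledEigenvector α b p k a l w R V → w = 0 ∧ R = 0 ∧ V = 0)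
    (w₀ : Ell2 J ℝ) (R₀ V₀ : ℝ) :
    ∃ (w r : ℝ → Ell2 J ℝ) (R V : ℝ → ℝ) (C : ℝ),
      w 0 = w₀ ∧ R 0 = R₀ ∧ V 0 = V₀ ∧ Continuous w ∧ ContinuousOn r (Ioi 0) ∧
      (∀ t, 0 < t → ∀ j, r t j = α j * w t j) ∧
      (∀ t, 0 < t → HasDerivAt w (V t • b - r t) t) ∧
      (∀ t, 0 ≤ t → HasDerivWithinAt R (V t) (Ici 0) t) ∧
      (∀ t, 0 ≤ t → HasDerivWithinAt V (-inner ℝ p (w t) - k * R t - a * V t) (Ici 0) t) ∧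
      ∀ t, 0 ≤ t → ‖w t‖ + |R t| + |V t| ≤ C * Real.exp (-β * t) := by
  -- The oscillator gets rate 0 in the diagonal part; its whole dynamics sits in the bounded
  -- coupling.
  set ρ : J ⊕ Bool → ℝ := Sum.elim α fun _ => 0 with hρ
  have hρ0 : ∀ i, 0 ≤ ρ i := by
    rintro (j | c)
    · exact (hα j).le
    · exact le_rfl
  have hE := isContractionSemigroup_diagSemigroup (r := ρ) (hr := hρ0)
  have hEc : ∀ t, 0 < t → IsCompactOperator (diagSemigroup ρ hρ0 t) := by
    intro t ht
    refine isCompactOperator_diagSemigroup ht (Summable.sum _ ?_ Summable.of_finite)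
    refine (hs.mul_left t⁻¹).of_nonneg_of_le (fun j => (Real.exp_pos _).le) fun j => ?_
    have h1 : ρ (Sum.inl j) = α j := rfl
    simp only [Function.comp_apply, h1]
    have h2 : 0 < α j * t := mul_pos (hα j) ht
    rw [neg_mul, Real.exp_neg, ← mul_inv, mul_comm t]
    exact inv_anti₀ h2 (by linarith [Real.add_one_le_exp (α j * t)])
  set B := couplingOp b p k a with hB
  obtain ⟨T, hT, hgrowth, hadd⟩ := hE.exists_perturbation B
  have hT0 : T 0 = 1 := by
    refine ContinuousLinearMap.ext fun x => ?_
    have := (hT x).eq 0 le_rfl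
    rw [intervalIntegral.integral_same, add_zero, hE.map_zero] at this
    exact this
  have hcoord : ∀ x t, 0 ≤ t → ∀ i, HasDerivWithinAt (fun s => T s x i)
      (-ρ i * T t x i + B (T t x) i) (Ici 0) t := fun x t ht i => (hT x).hasDerivWithinAt_coord ht i
  obtain ⟨C, hC0, hC⟩ := exists_exponential_bound (fun x => (hT x).cont) hT0 hadd hgrowth
    (IsMildSolution.isCompactOperator hE hEc hT hgrowth) (b := β) (by
      intro l x hx hTx
      by_contra! hl
      -- Differentiate the exponential orbit coordinatewise at t = 0; x need not be known to lie in
      -- a domain.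
      have h1 : ∀ i, l * x i = -ρ i * x i + B x i := by
        intro i
        have h2 := hcoord x 0 le_rfl i
        rw [hT0] at h2
        have h3 : HasDerivWithinAt (fun s : ℝ => Complex.exp (l * s) * x i) (l * x i) (Ici 0) 0 := by
          have h4 : HasDerivAt (fun s : ℝ => l * (s : ℂ)) l 0 := by
            simpa using (Complex.ofRealCLM.hasDerivAt (x := 0)).const_mul l
          simpa using (h4.cexp.mul_const (x i)).hasDerivWithinAt (s := Ici 0)
        have h5 : HasDerivWithinAt (fun s => T s x i) (l * x i) (Ici 0) 0 := by
          refine h3.congr (fun s hs => ?_) ?_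
          · rw [hTx s hs]; rfl
          · rw [hTx 0 le_rfl]; rfl
        exact (uniqueDiffOn_Ici (0 : ℝ) 0 self_mem_Ici).eq_deriv _ h5 h2
      obtain ⟨hw, hR, hV⟩ := hspec l (modeProj x) (x (Sum.inr false)) (x (Sum.inr true)) hl
        ⟨fun j => by
          have := h1 (Sum.inl j)
          rw [hB, couplingOp_inl] at this
          exact this, by
          have := h1 (Sum.inr false)
          rw [hB, couplingOp_false] at this
          rw [this]
          simp [hρ], by
          have := h1 (Sum.inr true)
          rw [hB, couplingOp_true] at this
          rw [this]
          simp [hρ]⟩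
      refine hx (lp.ext (funext fun i => ?_))
      rcases i with j | c
      · have : modeProj x j = 0 := by rw [hw]; rfl
        exact this
      · cases c
        · exact hR
        · exact hV)
  set x₀ := packState w₀ R₀ V₀ with hx₀
  set y : ℝ → Ell2 (J ⊕ Bool) ℂ := fun t => T t x₀ with hy
  have hyc : Continuous y := (hT x₀).cont
  set w : ℝ → Ell2 J ℝ := fun t => reMap (modeProj (y t)) with hw
  set V : ℝ → ℝ := fun t => (y t (Sum.inr true)).re with hV
  set R : ℝ → ℝ := fun t => (y t (Sum.inr false)).re with hR
  have hwc : Continuous w := reMap.continuous.comp (modeProj.continuous.comp hyc)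
  have hyV : Continuous fun t => y t (Sum.inr true) := (Ell2.continuous_coord _).comp hyc
  have hwj : ∀ t j, w t j = (y t (Sum.inl j)).re := fun t j => rfl
  have hre : ∀ t, 0 ≤ t → ∀ i, HasDerivWithinAt (fun s => (y s i).re)
      ((-ρ i * y t i + B (y t) i).re) (Ici 0) t := fun t ht i =>
    (Complex.reCLM.hasFDerivAt.comp_hasDerivWithinAt t (hcoord x₀ t ht i))
  -- A square-summable majorant of α_j w_j near t, so that the generator applied to w is a
  -- continuous ℓ² function for positive times.
  have hsmooth : ∀ t, 0 < t → ∃ M : ℝ, ∀ u ∈ Ioo (t / 2) (t + 1), ∀ j,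
      ‖α j * w u j‖ ≤ (t / 2)⁻¹ * ‖w₀ j‖ + M * ‖b j‖ := by
    intro t ht
    obtain ⟨M, hM⟩ := (isCompact_Icc (a := (0 : ℝ)) (b := t + 1)).exists_bound_of_continuousOn
      hyV.continuousOn
    refine ⟨M, fun u hu j => ?_⟩
    have hu0 : 0 < u := by linarith [hu.1]
    have h1 := norm_rate_mul_le (hα j).le hu0 (M := M) (x := x₀ (Sum.inl j)) (b := (b j : ℂ))
      (y := y u (Sum.inl j)) (v := fun s => y s (Sum.inr true))
      (fun s hs => hM s ⟨hs.1, hs.2.trans hu.2.le⟩) (by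
        refine ((hT x₀).coord_eq hu0.le (Sum.inl j)).trans ?_
        simp only [hB, couplingOp_inl]
        rfl)
    have h2 : ‖α j * w u j‖ ≤ ‖(α j : ℂ) * y u (Sum.inl j)‖ := by
      rw [hwj, ← Complex.re_ofReal_mul]
      exact Complex.abs_re_le_norm _
    have h3 : ‖x₀ (Sum.inl j)‖ = ‖w₀ j‖ := by
      rw [hx₀, packState_inl, Complex.norm_real]
    have h4 : ‖(b j : ℂ)‖ = ‖b j‖ := Complex.norm_real _
    rw [h3, h4] at h1
    refine h2.trans (h1.trans ?_)
    gcongr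
    exact hu.1.le
  have hdom : ∀ c M : ℝ, Summable fun j => (c * ‖w₀ j‖ + M * ‖b j‖) ^ 2 := fun c M => by
    refine (((Ell2.summable_sq w₀).mul_left (2 * c ^ 2)).add
      ((Ell2.summable_sq b).mul_left (2 * M ^ 2))).of_nonneg_of_le (fun _ => sq_nonneg _)
      fun j => ?_
    nlinarith [sq_nonneg (c * ‖w₀ j‖ - M * ‖b j‖)]
  have hmem : ∀ t, 0 < t → Memℓp (E := fun _ : J => ℝ) (fun j => α j * w t j) 2 := by
    intro t ht
    obtain ⟨M, hM⟩ := hsmooth t ht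
    refine memℓp_two_iff.2 ((hdom (t / 2)⁻¹ M).of_nonneg_of_le (fun _ => by positivity) fun j => ?_)
    have := hM t ⟨by linarith, by linarith⟩ j
    gcongr
  classical
  set r : ℝ → Ell2 J ℝ := fun t => if h : 0 < t then ⟨_, hmem t h⟩ else 0 with hr
  have hrj : ∀ t, 0 < t → ∀ j, r t j = α j * w t j := fun t ht j => by
    simp only [hr]
    rw [dif_pos ht]
  have hrc : ContinuousOn r (Ioi 0) := by
    refine Ell2.continuousOn_of_dominated (fun j => ?_) fun t ht => ?_
    · refine ContinuousOn.congr (f := fun t => α j * w t j) ?_ fun t ht => hrj t ht j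
      exact (continuous_const.mul ((Ell2.continuous_coord j).comp hwc)).continuousOn
    · obtain ⟨M, hM⟩ := hsmooth t ht
      refine ⟨_, hdom (t / 2)⁻¹ M, ?_⟩
      have : Ioo (t / 2) (t + 1) ∈ nhds t := Ioo_mem_nhds (half_lt_self ht) (lt_add_one t)
      filter_upwards [nhdsWithin_le_nhds this, self_mem_nhdsWithin] with u hu hu0 j
      rw [hrj u hu0]
      exact hM u hu j
  have hVc : Continuous V := Complex.continuous_re.comp hyV
  have hinit : ∀ i, y 0 i = x₀ i := fun i => by simp only [hy, hT0]; rfl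
  refine ⟨w, r, R, V, C * ‖x₀‖ * 3, ?_, ?_, ?_, hwc, hrc, hrj, ?_, ?_, ?_, ?_⟩
  · ext j
    rw [hwj, hinit, hx₀, packState_inl, Complex.ofReal_re]
  · simp only [hR]
    rw [hinit, hx₀, packState_false, Complex.ofReal_re]
  · simp only [hV]
    rw [hinit, hx₀, packState_true, Complex.ofReal_re]
  · intro t ht
    refine Ell2.hasDerivAt_of_coord (F := fun t => V t • b - r t)
      ((hVc.continuousOn.smul continuousOn_const).sub hrc) (fun j s hs => ?_) ht
    have h1 := (hre s hs.le (Sum.inl j)).hasDerivAt (Ici_mem_nhds hs)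
    refine h1.congr_deriv ?_
    have h2 : (V s • b - r s) j = V s * b j - r s j := rfl
    refine Eq.trans ?_ h2.symm
    rw [hrj s hs, hB, couplingOp_inl, hwj]
    have h3 : ρ (Sum.inl j) = α j := rfl
    rw [h3]
    simp [hV]
    ring
  · intro t ht
    refine (hre t ht (Sum.inr false)).congr_deriv ?_
    rw [hB, couplingOp_false]
    simp [hρ, hV]
  · intro t ht
    refine (hre t ht (Sum.inr true)).congr_deriv ?_
    rw [hB, couplingOp_true, ← re_inner_complexify]
    simp [hρ, hV, hR]
  · intro t ht
    have h1 : ‖y t‖ ≤ C * Real.exp (-β * t) * ‖x₀‖ :=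
      (T t).le_of_opNorm_le (hC t ht) x₀
    have h2 : ∀ x : Ell2 J ℂ, ‖reMap x‖ ≤ ‖x‖ := fun x =>
      ((reMap (J := J)).le_of_opNorm_le norm_reMap_le x).trans (one_mul _).le
    have h3 : ‖modeProj (y t)‖ ≤ ‖y t‖ :=
      ((modeProj (J := J)).le_of_opNorm_le norm_modeProj_le (y t)).trans (one_mul _).le
    have h4 : ∀ i, |(y t i).re| ≤ ‖y t‖ := fun i =>
      (Complex.abs_re_le_norm _).trans (lp.norm_apply_le_norm (by norm_num) _ i)
    have h5 := (h2 (modeProj (y t))).trans h3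
    calc ‖w t‖ + |R t| + |V t| ≤ ‖y t‖ + ‖y t‖ + ‖y t‖ :=
          add_le_add (add_le_add h5 (h4 _)) (h4 _)
      _ ≤ _ := by linarith

end Coupled

/-! ### Eigenvalues of the thermal-mechanical system -/

section ThermalOperator

theorem HilbertBasis.ext_clm {ι H F : Type*} [NormedAddCommGroup H] [InnerProductSpace ℝ H]
    [NormedAddCommGroup F] [NormedSpace ℝ F] (e : HilbertBasis ι ℝ H) {A B : H →L[ℝ] F}
    (h : ∀ i, A (e i) = B (e i)) : A = B := by
  ext x
  have h1 := (e.hasSum_repr x).mapL A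
  have h2 := (e.hasSum_repr x).mapL B
  refine h1.unique (h2.congr_fun fun i => ?_)
  rw [map_smul, map_smul, h]

theorem HilbertBasis.hasSum_clm {ι H F : Type*} [NormedAddCommGroup H] [InnerProductSpace ℝ H]
    [NormedAddCommGroup F] [NormedSpace ℝ F] (e : HilbertBasis ι ℝ H) (A : H →L[ℝ] F) (x : H) :
    HasSum (fun i => inner ℝ (e i) x • A (e i)) (A x) := by
  refine ((e.hasSum_repr x).mapL A).congr_fun fun i => ?_
  rw [map_smul, e.repr_apply_apply]

theorem diagOp_basis {H : Type*} [NormedAddCommGroup H] [InnerProductSpace ℝ H] [CompleteSpace H]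
    (e : HilbertBasis ℕ ℝ H) {c : ℕ → ℝ} (hc : Summable c) (h0 : ∀ n, 0 ≤ c n) (n : ℕ) :
    diagOp e c (e n) = c n • e n := by
  refine e.repr.injective (lp.ext (funext fun m => ?_))
  rw [e.repr_apply_apply, e.repr_apply_apply, inner_diagOp e hc h0, inner_smul_right,
    orthonormal_iff_ite.1 e.orthonormal]
  by_cases h : m = n
  · subst h; simp
  · simp [h]

theorem integral_mul_sin_waveNum (n : ℕ) :
    ∫ y in (0 : ℝ)..1, y * Real.sin (waveNum n * y) = -Real.cos (waveNum n) / waveNum n := by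
  have hw := (waveNum_pos n).ne'
  have h : ∀ y ∈ uIcc (0 : ℝ) 1, HasDerivAt
      (fun y => -(y * Real.cos (waveNum n * y)) / waveNum n
        + Real.sin (waveNum n * y) / waveNum n ^ 2) (y * Real.sin (waveNum n * y)) y := by
    intro y _
    have h1 : HasDerivAt (fun y => waveNum n * y) (waveNum n) y := by
      simpa using (hasDerivAt_id y).const_mul (waveNum n)
    have h2 := ((((hasDerivAt_id y).mul h1.cos).neg.div_const (waveNum n)).add
      (h1.sin.div_const (waveNum n ^ 2)))
    refine h2.congr_deriv ?_
    simp only [id]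
    field_simp
    ring
  rw [intervalIntegral.integral_eq_sub_of_hasDerivAt h
    (by apply Continuous.intervalIntegrable; fun_prop)]
  simp [sin_waveNum]

/-- Integration by parts leaves cos((n+1)π), whose square is 1. The ζ(2) weights are thus the
squared coefficients of the normalized constant. -/
theorem inner_sineVec_unitProfile_sq (n : ℕ) :
    3 / (4 * Real.pi) * inner ℝ (sineVec n) unitProfile ^ 2 = zetaWeight n := by
  have hw := (waveNum_pos n).ne'
  have h1 : inner ℝ (sineVec n) unitProfile
      = 4 * Real.pi / Real.sqrt (2 * Real.pi) * (-Real.cos (waveNum n) / waveNum n) := by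
    rw [real_inner_comm, inner_unitProfile, integral_congr_ae (sineVec_ae n),
      integral_radialMeasure, ← integral_Ioc_eq_integral_Ioo,
      ← intervalIntegral.integral_of_le zero_le_one, ← integral_mul_sin_waveNum,
      ← intervalIntegral.integral_const_mul]
    refine intervalIntegral.integral_congr fun y _ => ?_
    have := mul_sineMode n y
    calc 4 * Real.pi * y ^ 2 * sineMode n y = 4 * Real.pi * y * (y * sineMode n y) := by ring
      _ = _ := by rw [this]; ring
  have h2 : Real.cos (waveNum n) ^ 2 = 1 := by
    have := Real.sin_sq_add_cos_sq (waveNum n)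
    rw [sin_waveNum] at this
    linarith
  have hpi := Real.pi_pos
  have h3 : Real.sqrt (2 * Real.pi) ^ 2 = 2 * Real.pi := Real.sq_sqrt (by positivity)
  rw [h1, mul_pow, div_pow, div_pow, h3, neg_sq, h2]
  unfold zetaWeight
  field_simp
  norm_num

/-! ### Symmetrization by the square root of I - ϑM -/

namespace BubbleParams

variable (P : BubbleParams)

/-- The strength of the square root of `I - ϑ M`, with `M` the mean-value projection. -/
def shrink : ℝ := (1 - (Real.sqrt P.gam)⁻¹) * (3 / (4 * Real.pi))

/-- The square root of `I - ϑ M`, with `M` the mean-value projection. -/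
def sqrtOp : RadialL2 →L[ℝ] RadialL2 := rankOnePerturb P.shrink unitProfile

/-- The inverse of `sqrtOp`. -/
def invSqrtOp : RadialL2 →L[ℝ] RadialL2 :=
  rankOnePerturb (-(P.shrink / (1 - P.shrink * ‖unitProfile‖ ^ 2))) unitProfile

/-- The inverse of `-κ̄ Δ` with Dirichlet conditions. -/
def greenOp : RadialL2 →L[ℝ] RadialL2 := diagOp sineBasis fun n => (P.thermalRate n)⁻¹

theorem sqrt_gam_gt_one : 1 < Real.sqrt P.gam := by
  rw [Real.lt_sqrt zero_le_one]
  simpa using P.gam_gt_one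

/-- Hence `sqrtOp` scales constants by γ^{-1/2}, whose square is 1 - ϑ, and fixes profiles of mean
zero. -/
theorem shrink_mul_norm_sq : P.shrink * ‖unitProfile‖ ^ 2 = 1 - (Real.sqrt P.gam)⁻¹ := by
  rw [norm_unitProfile_sq]
  unfold shrink
  have := Real.pi_ne_zero
  field_simp

theorem shrink_nonneg : 0 ≤ P.shrink := by
  have := inv_lt_one_of_one_lt₀ P.sqrt_gam_gt_one
  have := Real.pi_pos
  exact mul_nonneg (by linarith) (by positivity)

theorem shrink_mul_norm_sq_lt_one : P.shrink * ‖unitProfile‖ ^ 2 < 1 := by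
  rw [shrink_mul_norm_sq]
  have := inv_pos.2 (zero_lt_one.trans P.sqrt_gam_gt_one)
  linarith

theorem sqrtOp_unitProfile : P.sqrtOp unitProfile = (Real.sqrt P.gam)⁻¹ • unitProfile := by
  unfold sqrtOp
  rw [rankOnePerturb_apply, real_inner_self_eq_norm_sq, shrink_mul_norm_sq, sub_smul, one_smul,
    sub_sub_cancel]

theorem invSqrtOp_sqrtOp (x : RadialL2) : P.invSqrtOp (P.sqrtOp x) = x :=
  rankOnePerturb_comp P.shrink_mul_norm_sq_lt_one.ne x

/-- The Sherman–Morrison parameter map is an involution, so the same formula serves in the other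
order. -/
theorem sqrtOp_invSqrtOp (x : RadialL2) : P.sqrtOp (P.invSqrtOp x) = x := by
  have h := P.shrink_mul_norm_sq_lt_one
  have h1 := (sub_pos.2 h).ne'
  have h2 := rankOnePerturb_comp (τ := -(P.shrink / (1 - P.shrink * ‖unitProfile‖ ^ 2)))
    (p := unitProfile) (by
      intro h3
      rw [neg_mul, div_mul_eq_mul_div, ← neg_div, div_eq_one_iff_eq h1] at h3
      linarith) x
  have h3 : -(-(P.shrink / (1 - P.shrink * ‖unitProfile‖ ^ 2)) /
      (1 - -(P.shrink / (1 - P.shrink * ‖unitProfile‖ ^ 2)) * ‖unitProfile‖ ^ 2)) = P.shrink := by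
    have h4 : 1 - -(P.shrink / (1 - P.shrink * ‖unitProfile‖ ^ 2)) * ‖unitProfile‖ ^ 2
        = (1 - P.shrink * ‖unitProfile‖ ^ 2)⁻¹ := by
      field_simp
      ring
    rw [h4]
    field_simp
  rw [h3] at h2
  exact h2

theorem sqrtOp_sqrtOp (x : RadialL2) : P.sqrtOp (P.sqrtOp x)
    = x - (P.theta * (3 / (4 * Real.pi)) * inner ℝ unitProfile x) • unitProfile := by
  have hg := P.sqrt_gam_gt_one
  have hpi := Real.pi_ne_zero
  have h0 : P.sqrtOp x = x - (P.shrink * inner ℝ unitProfile x) • unitProfile :=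
    rankOnePerturb_apply _ _ _
  have h1 : P.sqrtOp (P.sqrtOp x) = P.sqrtOp x - (P.shrink * inner ℝ unitProfile x) •
      ((Real.sqrt P.gam)⁻¹ • unitProfile) := by
    rw [h0, map_sub, map_smul, sqrtOp_unitProfile, ← h0]
  rw [h1, h0, sub_sub, smul_smul, ← add_smul]
  congr 2
  have h2 : (Real.sqrt P.gam)⁻¹ ^ 2 = P.gam⁻¹ := by
    rw [inv_pow, Real.sq_sqrt P.gam_pos.le]
  unfold shrink theta
  rw [← h2]
  ring

theorem summable_inv_thermalRate : Summable fun n => (P.thermalRate n)⁻¹ := by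
  refine (summable_inv_waveNum_sq.mul_left P.kbar⁻¹).congr fun n => ?_
  unfold thermalRate
  rw [mul_inv]

theorem greenOp_sineVec (n : ℕ) : P.greenOp (sineVec n) = (P.thermalRate n)⁻¹ • sineVec n := by
  rw [← sineBasis_apply]
  exact diagOp_basis sineBasis P.summable_inv_thermalRate
    (fun n => (inv_pos.2 (P.thermalRate_pos n)).le) n

theorem inner_greenOp (x : RadialL2) (n : ℕ) :
    inner ℝ (sineVec n) (P.greenOp x) = (P.thermalRate n)⁻¹ * inner ℝ (sineVec n) x := by
  rw [← sineBasis_apply]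
  exact inner_diagOp sineBasis P.summable_inv_thermalRate
    (fun n => (inv_pos.2 (P.thermalRate_pos n)).le) x n

/-- The thermal operator `K = S G S` has a Hilbert basis of eigenvectors. -/
theorem exists_thermal_basis : ∃ (J : Type) (g : HilbertBasis J ℝ RadialL2) (α : J → ℝ),
    (∀ j, P.sqrtOp (P.greenOp (P.sqrtOp (g j))) = (α j)⁻¹ • g j) ∧
    (∀ j, Real.pi ^ 2 * P.kbar ≤ α j) ∧ Summable fun j => (α j)⁻¹ := by
  have hpi : 0 < Real.pi ^ 2 * P.kbar := mul_pos (pow_pos Real.pi_pos 2) P.kbar_pos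
  obtain ⟨J, g, κ, h1, h2, h3, h4⟩ := exists_diagonalization sineBasis P.summable_inv_thermalRate
    (fun n => inv_pos.2 (P.thermalRate_pos n)) (cmax := (Real.pi ^ 2 * P.kbar)⁻¹)
    (fun n => inv_anti₀ hpi (P.thermalRate_ge n)) P.shrink_nonneg P.shrink_mul_norm_sq_lt_one
  refine ⟨J, g, fun j => (κ j)⁻¹, fun j => ?_, fun j => ?_, ?_⟩
  · rw [inv_inv]; exact h1 j
  · rw [le_inv_comm₀ hpi (h2 j)]; exact h3 j
  · simpa using h4

variable {P}
variable {J : Type} {g : HilbertBasis J ℝ RadialL2} {α : J → ℝ}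

/-- An eigenvalue of the coupled system which is not purely thermal solves the characteristic
equation. -/
theorem char_eq_of_eigenvector
    (hg : ∀ j, P.sqrtOp (P.greenOp (P.sqrtOp (g j))) = (α j)⁻¹ • g j) (hα : ∀ j, 0 < α j)
    {s : ℝ} (hs0 : 0 ≤ s) (hs1 : s < 1) {l : ℂ} (hl : -(s * (Real.pi ^ 2 * P.kbar)) ≤ l.re)
    {w : Ell2 J ℂ} {R V : ℂ} (hV : V ≠ 0)
    (h : IsCoupledEigenvector α (g.repr ((P.theta * P.massCoef * Real.sqrt P.gam) • unitProfile))
      (g.repr ((P.gasCoef * Real.sqrt P.gam * (3 / (4 * Real.pi))) • unitProfile))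
      P.freqSq P.damping l w R V) :
    P.charQ l * P.charW l = -(3 * P.pStar : ℝ) := by
  have hsq : Real.sqrt P.gam ≠ 0 := (zero_lt_one.trans P.sqrt_gam_gt_one).ne'
  have hpi := Real.pi_ne_zero
  -- the linear functional with coefficients `w`
  set ω₁ : RadialL2 →L[ℝ] ℂ :=
    Complex.ofRealCLM.comp (innerSL ℝ (g.repr.symm (reMap w)))
      + Complex.I • Complex.ofRealCLM.comp
        (innerSL ℝ (g.repr.symm (reMap ((-Complex.I) • w)))) with hω₁
  have hω : ∀ j, ω₁ (g j) = w j := by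
    intro j
    have h1 : ω₁ (g j) = (inner ℝ (g.repr.symm (reMap w)) (g j) : ℝ)
      + Complex.I * (inner ℝ (g.repr.symm (reMap ((-Complex.I) • w))) (g j) : ℝ) := rfl
    have hgr : ∀ y : Ell2 J ℝ, inner ℝ (g.repr.symm y) (g j) = y j := fun y => by
      rw [real_inner_comm, ← g.repr_apply_apply, LinearIsometryEquiv.apply_symm_apply]
    rw [h1, hgr, hgr, reMap_apply, reMap_apply]
    have h2 : ((-Complex.I) • w : Ell2 J ℂ) j = -Complex.I * w j := rfl
    rw [h2]
    apply Complex.ext <;> simp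
  set u : RadialL2 →L[ℝ] ℂ := ω₁.comp P.invSqrtOp with hu
  have hωu : ∀ x, ω₁ x = u (P.sqrtOp x) := fun x => by
    rw [hu, ContinuousLinearMap.comp_apply, invSqrtOp_sqrtOp]
  set c : ℝ := P.theta * P.massCoef * Real.sqrt P.gam with hc
  set K : RadialL2 →L[ℝ] RadialL2 := P.sqrtOp.comp (P.greenOp.comp P.sqrtOp) with hK
  -- The mode equations divided by α_j: a resolvent identity in terms of K, free of unbounded
  -- operators.
  have hres : ω₁ + l • ω₁.comp K
      = (V * c) • Complex.ofRealCLM.comp ((innerSL ℝ unitProfile).comp K) := by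
    refine g.ext_clm fun j => ?_
    have h1 : (ω₁ + l • ω₁.comp K) (g j) = ω₁ (g j) + l * ω₁ (K (g j)) := rfl
    have h2 : ((V * c) • Complex.ofRealCLM.comp ((innerSL ℝ unitProfile).comp K)) (g j)
      = V * c * (inner ℝ unitProfile (K (g j)) : ℝ) := rfl
    have h3 : K (g j) = (α j)⁻¹ • g j := hg j
    have h4 := h.mode j
    rw [g.repr_apply_apply, inner_smul_right] at h4
    rw [h1, h2, h3, map_smul, hω, inner_smul_right, real_inner_comm (g j) unitProfile]
    have h5 : (α j : ℂ) ≠ 0 := by exact_mod_cast (hα j).ne'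
    have h6 : ((α j)⁻¹ • w j : ℂ) = (α j : ℂ)⁻¹ * w j := by
      rw [Complex.real_smul]; push_cast; rfl
    rw [h6]
    push_cast at h4 ⊢
    field_simp
    linear_combination h4
  set a : ℕ → ℝ := fun n => inner ℝ (sineVec n) unitProfile with ha
  set m : ℂ := (3 / (4 * Real.pi) : ℝ) * u unitProfile with hm
  -- Equals -l times the boundary value z of the eigenmode.
  set ζ : ℂ := l * m + P.massCoef * V with hζ
  have hν : ∀ n, l + P.thermalRate n ≠ 0 := fun n =>
    Complex.normSq_pos.1 (normSq_add_thermalRate_pos hs0 hs1 hl n)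
  -- Evaluating the resolvent identity at S⁻¹e_n turns K into S/ν_n and returns to the Dirichlet
  -- modes.
  have hun : ∀ n, u (sineVec n) = P.theta * ζ * (a n / (l + P.thermalRate n)) := by
    intro n
    have h1 := congrArg (fun A : RadialL2 →L[ℝ] ℂ => A (P.invSqrtOp (sineVec n))) hres
    have h2 : (ω₁ + l • ω₁.comp K) (P.invSqrtOp (sineVec n))
      = u (sineVec n) + l * ω₁ (K (P.invSqrtOp (sineVec n))) := rfl
    have h3 : ((V * c) • Complex.ofRealCLM.comp ((innerSL ℝ unitProfile).comp K))
        (P.invSqrtOp (sineVec n))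
      = V * c * (inner ℝ unitProfile (K (P.invSqrtOp (sineVec n))) : ℝ) := rfl
    have h4 : K (P.invSqrtOp (sineVec n)) = (P.thermalRate n)⁻¹ • P.sqrtOp (sineVec n) := by
      have : K (P.invSqrtOp (sineVec n))
        = P.sqrtOp (P.greenOp (P.sqrtOp (P.invSqrtOp (sineVec n)))) := rfl
      rw [this, sqrtOp_invSqrtOp, greenOp_sineVec, map_smul]
    have h5 : inner ℝ unitProfile (P.sqrtOp (sineVec n)) = (Real.sqrt P.gam)⁻¹ * a n := by
      have : inner ℝ unitProfile (P.sqrtOp (sineVec n))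
        = inner ℝ (P.sqrtOp unitProfile) (sineVec n) := (inner_rankOnePerturb _ _ _ _).symm
      rw [this, sqrtOp_unitProfile, inner_smul_left, real_inner_comm]
      simp [ha]
    simp only [h2, h3, h4] at h1
    rw [map_smul, hωu, sqrtOp_sqrtOp, map_sub, map_smul, inner_smul_right, h5,
      real_inner_comm (sineVec n) unitProfile, Complex.real_smul, Complex.real_smul] at h1
    have hn : (P.thermalRate n : ℂ) ≠ 0 := by exact_mod_cast (P.thermalRate_pos n).ne'
    have e1 : (V * c) * (((P.thermalRate n)⁻¹ * ((Real.sqrt P.gam)⁻¹ * a n) : ℝ) : ℂ)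
        = V * (P.theta * P.massCoef) * ((P.thermalRate n : ℂ)⁻¹ * a n) := by
      have : (Real.sqrt P.gam : ℂ) ≠ 0 := by exact_mod_cast hsq
      rw [hc]
      push_cast
      field_simp
    have e2 : (((P.theta * (3 / (4 * Real.pi)) * inner ℝ (sineVec n) unitProfile : ℝ)) : ℂ)
        * u unitProfile = P.theta * a n * m := by
      rw [hm, ha]; push_cast; ring
    rw [e1, e2] at h1
    rw [mul_div_assoc', eq_div_iff (hν n), hζ]
    push_cast at h1
    field_simp at h1
    linear_combination h1
  have hsumW := summable_charW hs0 hs1 hl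
  set Z : ℂ := ∑' n, (zetaWeight n : ℂ) * (P.thermalRate n / (l + P.thermalRate n)) with hZ
  -- Sum the modes to get the mean, using l/(l+ν) = 1 - ν/(l+ν) and total weight 1.
  have hlm : l * m = P.theta * ζ * (1 - Z) := by
    have h1 := (sineBasis.hasSum_clm u unitProfile).mul_left (l * (3 / (4 * Real.pi) : ℝ))
    have h2 : HasSum (fun n => (zetaWeight n : ℂ)) 1 := by
      have := (Complex.hasSum_ofReal (f := zetaWeight) (x := 1)).2 hasSum_zetaWeight
      rwa [Complex.ofReal_one] at this
    have h3 := (h2.sub hsumW.hasSum).mul_left (P.theta * ζ)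
    have h4 := h1.unique (h3.congr_fun fun n => ?_)
    · rw [hm, ← mul_assoc]; exact h4
    · rw [sineBasis_apply, hun, Complex.real_smul, ← inner_sineVec_unitProfile_sq]
      have := hν n
      push_cast
      field_simp
      ring
  have hζW : ζ * P.charW l = P.massCoef * V := by
    have : P.charW l = 1 - P.theta + P.theta * Z := rfl
    rw [this]
    linear_combination hlm + (hζ : ζ = l * m + P.massCoef * V)
  have hvel : l * V = -P.gasCoef * m - P.freqSq * R - P.damping * V := by
    have h1 := inner_complexify
      (g.repr ((P.gasCoef * Real.sqrt P.gam * (3 / (4 * Real.pi))) • unitProfile)) w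
    have h2 := (g.hasSum_clm ω₁ unitProfile).mul_left
      ((P.gasCoef * Real.sqrt P.gam * (3 / (4 * Real.pi)) : ℝ) : ℂ)
    have h3 := h1.unique (h2.congr_fun fun j => by
      rw [g.repr_apply_apply, inner_smul_right, hω, Complex.real_smul]
      push_cast
      ring)
    have h4 := h.vel
    rw [h3, hωu, sqrtOp_unitProfile, map_smul, Complex.real_smul] at h4
    rw [h4, hm]
    have : (Real.sqrt P.gam : ℂ) ≠ 0 := by exact_mod_cast hsq
    push_cast
    field_simp
  have hpos := h.pos
  have hmain : (l ^ 2 + P.damping * l + P.freqSq - P.gasCoef * P.massCoef) * P.charW l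
      = -(P.gasCoef * P.massCoef : ℂ) := by
    have h1 : (l ^ 2 + P.damping * l + P.freqSq - P.gasCoef * P.massCoef) * V
        = -P.gasCoef * ζ := by
      rw [hζ]; linear_combination l * hvel - P.freqSq * hpos
    refine mul_right_cancel₀ hV ?_
    linear_combination P.charW l * h1 - P.gasCoef * hζW
  have hin := P.inertia_pos.ne'
  have hR := P.Rstar_pos.ne'
  have e1 : P.charQ l = (P.inertia * P.Rstar : ℝ) *
      (l ^ 2 + P.damping * l + P.freqSq - P.gasCoef * P.massCoef) := by
    have h1 : P.inertia * P.Rstar = P.rhoL * P.Rstar ^ 2 := by unfold inertia; ring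
    have h2 : P.inertia * P.Rstar * P.damping = 4 * P.muL := by
      unfold damping; field_simp
    have h3 : P.inertia * P.Rstar * (P.freqSq - P.gasCoef * P.massCoef)
        = -(2 * P.sigma / P.Rstar) := by
      unfold freqSq gasCoef; field_simp; ring
    unfold charQ
    rw [← h1, ← h2]
    have h3' : ((P.inertia * P.Rstar * (P.freqSq - P.gasCoef * P.massCoef) : ℝ) : ℂ)
      = (-(2 * P.sigma / P.Rstar) : ℝ) := by rw [h3]
    push_cast at h3' ⊢
    linear_combination -h3'
  have e2 : P.inertia * P.Rstar * (P.gasCoef * P.massCoef) = 3 * P.pStar := by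
    have h1 := P.RgT_massCoef
    unfold gasCoef
    field_simp
    field_simp at h1
    linarith
  rw [e1, mul_assoc, hmain, ← e2]
  push_cast
  ring

/-- If V = 0 the modes decouple and vanish, since α_j ≥ π²κ̄ gives Re(l + α_j) > 0, and then
`freqSq` > 0 forces R = 0. If V ≠ 0, l would solve the characteristic equation. -/
theorem eigenvector_eq_zero
    (hg : ∀ j, P.sqrtOp (P.greenOp (P.sqrtOp (g j))) = (α j)⁻¹ • g j)
    (hα : ∀ j, Real.pi ^ 2 * P.kbar ≤ α j) {ε : ℝ} (h0 : 0 < ε) (h1 : ε < 1) (l : ℂ)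
    (w : Ell2 J ℂ) (R V : ℂ) (hl : -P.decayRate ε (rateError ε P.errArg) ≤ l.re)
    (h : IsCoupledEigenvector α (g.repr ((P.theta * P.massCoef * Real.sqrt P.gam) • unitProfile))
      (g.repr ((P.gasCoef * Real.sqrt P.gam * (3 / (4 * Real.pi))) • unitProfile))
      P.freqSq P.damping l w R V) : w = 0 ∧ R = 0 ∧ V = 0 := by
  have hpk : 0 < Real.pi ^ 2 * P.kbar := mul_pos (pow_pos Real.pi_pos 2) P.kbar_pos
  obtain ⟨hf0, hf1, -⟩ := P.thermalFrac_spec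
  have hb := (P.decayRate_bounds (ε := ε) (e := rateError ε P.errArg)).1
  have hl' : -(P.thermalFrac * (Real.pi ^ 2 * P.kbar)) ≤ l.re := by linarith
  by_cases hV : V = 0
  · have hw : w = 0 := by
      refine lp.ext (funext fun j => ?_)
      have h2 := h.mode j
      rw [hV, zero_mul, add_zero] at h2
      have h3 : (l + α j) * w j = 0 := by linear_combination h2
      have h4 : l + α j ≠ 0 := fun h5 => by
        have h6 := congrArg Complex.re h5
        simp at h6
        nlinarith [hα j]
      exact (mul_eq_zero.1 h3).resolve_left h4
    refine ⟨hw, ?_, hV⟩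
    have h2 := h.vel
    rw [hV, hw, inner_zero_right] at h2
    have h3 : (P.freqSq : ℂ) * R = 0 := by linear_combination h2
    have h4 : (P.freqSq : ℂ) ≠ 0 := by exact_mod_cast P.freqSq_pos.ne'
    exact (mul_eq_zero.1 h3).resolve_left h4
  · exact absurd (char_eq_of_eigenvector hg (fun j => hpk.trans_le (hα j)) hf0.le hf1 hl' hV h)
      (char_ne h0 h1 hl)

end BubbleParams

end ThermalOperator

/-! ### Existence and decay of solutions -/

section Existence

theorem contDiffOn_one_Ioi {F : Type*} [NormedAddCommGroup F] [NormedSpace ℝ F] {f f' : ℝ → F}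
    (hf : ∀ t, 0 < t → HasDerivAt f (f' t) t) (hc : ContinuousOn f' (Ioi 0)) :
    ContDiffOn ℝ 1 f (Ioi 0) := by
  rw [show (1 : WithTop ℕ∞) = 0 + 1 from (zero_add 1).symm,
    contDiffOn_succ_iff_deriv_of_isOpen isOpen_Ioi]
  refine ⟨fun t ht => (hf t ht).differentiableAt.differentiableWithinAt, by simp, ?_⟩
  rw [contDiffOn_zero]
  exact hc.congr fun t ht => (hf t ht).deriv

namespace BubbleParams

variable {P : BubbleParams}

/-- The mean value over the unit ball. -/
def meanCLM : RadialL2 →L[ℝ] ℝ := (3 / (4 * Real.pi)) • innerSL ℝ unitProfile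

theorem meanCLM_apply (x : RadialL2) :
    meanCLM x = 3 / (4 * Real.pi) * inner ℝ unitProfile x := rfl

theorem meanCLM_unitProfile : meanCLM unitProfile = 1 := by
  rw [meanCLM_apply, real_inner_self_eq_norm_sq, norm_unitProfile_sq]
  have := Real.pi_ne_zero
  field_simp

theorem meanCLM_sqrtOp (x : RadialL2) :
    meanCLM (P.sqrtOp x) = (Real.sqrt P.gam)⁻¹ * meanCLM x := by
  have : inner ℝ unitProfile (P.sqrtOp x) = inner ℝ (P.sqrtOp unitProfile) x :=
    (inner_rankOnePerturb _ _ _ _).symm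
  rw [meanCLM_apply, this, sqrtOp_unitProfile, inner_smul_left, meanCLM_apply]
  simp only [conj_trivial]
  ring

theorem sqrtOp_sqrtOp_eq (x : RadialL2) :
    P.sqrtOp (P.sqrtOp x) = x - (P.theta * meanCLM x) • unitProfile := by
  rw [sqrtOp_sqrtOp, meanCLM_apply, mul_assoc]

/-- The change of variables undone: u = S⁻¹W, z is dictated by the mass constraint, and bounded maps
carry the ℓ² decay to ϱ. -/
theorem exists_solution_with_decay {ε : ℝ} (h0 : 0 < ε) (h1 : ε < 1) {d : BubbleData}
    (hd : d.MassConstraint P) :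
    ∃ (ϱ : ℝ → RadialL2) (z R V : ℝ → ℝ) (C : ℝ), IsLinearizedSolution P d ϱ z R V ∧
      ∀ t, 0 ≤ t → ‖ϱ t‖ + |R t| + |V t|
        ≤ C * Real.exp (-(P.decayRate ε (rateError ε P.errArg)) * t) := by
  have hpk : 0 < Real.pi ^ 2 * P.kbar := mul_pos (pow_pos Real.pi_pos 2) P.kbar_pos
  have hpi := Real.pi_ne_zero
  have hsq : Real.sqrt P.gam ≠ 0 := (zero_lt_one.trans P.sqrt_gam_gt_one).ne'
  obtain ⟨J, g, α, hg, hα, hαs⟩ := P.exists_thermal_basis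
  obtain ⟨w, r, R, V, C, hw0, hR0, hV0, hwc, hrc, hrj, hwd, hRd, hVd, hdecay⟩ :=
    exists_coupled_solution (fun j => hpk.trans_le (hα j)) hαs
      (g.repr ((P.theta * P.massCoef * Real.sqrt P.gam) • unitProfile))
      (g.repr ((P.gasCoef * Real.sqrt P.gam * (3 / (4 * Real.pi))) • unitProfile))
      P.freqSq P.damping (eigenvector_eq_zero hg hα h0 h1)
      (g.repr (P.sqrtOp (d.dens - d.bdry • unitProfile))) d.rad d.vel
  set W : ℝ → RadialL2 := fun t => g.repr.symm (w t) with hW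
  set u : ℝ → RadialL2 := fun t => P.invSqrtOp (W t) with hu
  set q : ℝ → RadialL2 := fun t => g.repr.symm (r t) with hq
  set m : ℝ → ℝ := fun t => meanCLM (u t) with hm
  set z : ℝ → ℝ := fun t => -m t - P.massCoef * R t with hz
  have hgc : Continuous g.repr.symm := g.repr.symm.continuous
  have hWc : Continuous W := hgc.comp hwc
  have huc : Continuous u := P.invSqrtOp.continuous.comp hWc
  have hmc : Continuous m := meanCLM.continuous.comp huc
  have hRc : ContinuousOn R (Ici 0) := fun t ht => (hRd t ht).continuousWithinAt
  have hVc : ContinuousOn V (Ici 0) := fun t ht => (hVd t ht).continuousWithinAt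
  have hVc' : ContinuousOn V (Ioi 0) := hVc.mono Ioi_subset_Ici_self
  have hqc : ContinuousOn q (Ioi 0) := hgc.comp_continuousOn hrc
  have hSu : ∀ t, P.sqrtOp (u t) = W t := fun t => P.sqrtOp_invSqrtOp _
  have hWd : ∀ t, 0 < t → HasDerivAt W
      (V t • ((P.theta * P.massCoef * Real.sqrt P.gam) • unitProfile) - q t) t := by
    intro t ht
    have h2 := (g.repr.symm.toContinuousLinearEquiv.toContinuousLinearMap.hasFDerivAt
      (x := w t)).comp_hasDerivAt t (hwd t ht)
    refine h2.congr_deriv ?_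
    have h3 : g.repr.symm (V t • g.repr ((P.theta * P.massCoef * Real.sqrt P.gam) • unitProfile)
      - r t) = V t • ((P.theta * P.massCoef * Real.sqrt P.gam) • unitProfile) - q t := by
      rw [map_sub, map_smul, LinearIsometryEquiv.symm_apply_apply]
    exact h3
  -- Since q has coordinates α_j w_j, applying K to it returns W. Hence u = G S q lies in the
  -- Dirichlet domain, with Laplacian -κ̄⁻¹Sq.
  have hWq : ∀ t, 0 < t → W t = P.sqrtOp (P.greenOp (P.sqrtOp (q t))) := by
    intro t ht
    have h2 := g.hasSum_clm (P.sqrtOp.comp (P.greenOp.comp P.sqrtOp)) (q t)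
    have h3 := g.hasSum_repr (W t)
    refine h3.unique (h2.congr_fun fun j => ?_)
    have h4 : (P.sqrtOp.comp (P.greenOp.comp P.sqrtOp)) (g j) = (α j)⁻¹ • g j := hg j
    have h5 : g.repr (W t) j = w t j := by
      simp only [hW, LinearIsometryEquiv.apply_symm_apply]
    have h6 : inner ℝ (g j) (q t) = r t j := by
      rw [← g.repr_apply_apply]
      simp only [hq, LinearIsometryEquiv.apply_symm_apply]
    have h7 := (hpk.trans_le (hα j)).ne'
    rw [h4, h5, h6, hrj t ht j, smul_smul]
    congr 1
    field_simp
  have huq : ∀ t, 0 < t → u t = P.greenOp (P.sqrtOp (q t)) := fun t ht => by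
    simp only [hu]
    rw [hWq t ht, invSqrtOp_sqrtOp]
  have hWC : ContDiffOn ℝ 1 W (Ioi 0) :=
    contDiffOn_one_Ioi hWd ((hVc'.smul continuousOn_const).sub hqc)
  have huC : ContDiffOn ℝ 1 u (Ioi 0) := P.invSqrtOp.contDiff.comp_contDiffOn hWC
  have hmC : ContDiffOn ℝ 1 m (Ioi 0) := meanCLM.contDiff.comp_contDiffOn huC
  have hRd' : ∀ t, 0 < t → HasDerivAt R (V t) t := fun t ht =>
    (hRd t ht.le).hasDerivAt (Ici_mem_nhds ht)
  have hRC : ContDiffOn ℝ 1 R (Ioi 0) := contDiffOn_one_Ioi hRd' hVc'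
  have hzC : ContDiffOn ℝ 1 z (Ioi 0) := hmC.neg.sub (contDiffOn_const.mul hRC)
  have hzc : ContinuousOn z (Ici 0) := hmc.continuousOn.neg.sub (continuousOn_const.mul hRc)
  have hVd' : ∀ t, 0 < t → HasDerivAt V
      (-P.gasCoef * (-z t - P.massCoef * R t) - P.freqSq * R t - P.damping * V t) t := by
    intro t ht
    refine ((hVd t ht.le).hasDerivAt (Ici_mem_nhds ht)).congr_deriv ?_
    have h2 : inner ℝ (g.repr ((P.gasCoef * Real.sqrt P.gam * (3 / (4 * Real.pi))) • unitProfile))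
        (w t) = P.gasCoef * m t := by
      have h3 : w t = g.repr (W t) := by
        simp only [hW, LinearIsometryEquiv.apply_symm_apply]
      have h4 := meanCLM_sqrtOp (P := P) (u t)
      rw [hSu, meanCLM_apply] at h4
      rw [h3, LinearIsometryEquiv.inner_map_map, inner_smul_left]
      simp only [conj_trivial]
      rw [mul_assoc, h4]
      simp only [hm]
      field_simp
    rw [h2]
    simp only [hz]
    ring
  have hud : ∀ t, 0 < t → HasDerivAt u (-(P.theta * deriv z t) • unitProfile - P.sqrtOp (q t)) t := by
    intro t ht
    have h2 := P.invSqrtOp.hasFDerivAt.comp_hasDerivAt t (hWd t ht)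
    set u' := P.invSqrtOp
      (V t • ((P.theta * P.massCoef * Real.sqrt P.gam) • unitProfile) - q t) with hu'
    have h3 : HasDerivAt u u' t := h2
    have h4 : HasDerivAt z (-meanCLM u' - P.massCoef * V t) t :=
      (meanCLM.hasFDerivAt.comp_hasDerivAt t h3).neg.sub ((hRd' t ht).const_mul _)
    have h5 := sqrtOp_sqrtOp_eq (P := P) u'
    have h6 : P.sqrtOp (P.sqrtOp u')
        = (V t * (P.theta * P.massCoef)) • unitProfile - P.sqrtOp (q t) := by
      rw [hu', sqrtOp_invSqrtOp, map_sub, map_smul, map_smul, sqrtOp_unitProfile, smul_smul,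
        smul_smul]
      congr 2
      field_simp
    refine h3.congr_deriv ?_
    -- Solving S²u' = u' - ϑ·mean(u')·1 for u'; the constants then combine to -ϑz'.
    have h7 : u' = (V t * (P.theta * P.massCoef)) • unitProfile - P.sqrtOp (q t)
        + (P.theta * meanCLM u') • unitProfile := by rw [← h6, h5, sub_add_cancel]
    rw [h4.deriv]
    refine h7.trans ?_
    module
  have hu0 : u 0 = d.dens - d.bdry • unitProfile := by
    simp only [hu, hW]
    rw [hw0, LinearIsometryEquiv.symm_apply_apply, invSqrtOp_sqrtOp]
  -- The mass constraint on the data is what makes the prescribed boundary value attained.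
  have hz0 : z 0 = d.bdry := by
    simp only [hz, hm]
    rw [hu0, hR0, map_sub, map_smul, meanCLM_unitProfile, meanCLM_apply, inner_unitProfile]
    have h2 : (∫ y, d.dens y ∂radialMeasure) = -(4 * Real.pi * (P.rhoStar / P.Rstar) * d.rad) := by
      have := hd
      unfold BubbleData.MassConstraint at this
      linarith
    rw [h2]
    unfold massCoef
    simp only [smul_eq_mul]
    field_simp
    ring
  refine ⟨fun t => u t + z t • unitProfile, z, R, V,
    C * (‖P.invSqrtOp‖ + (‖(meanCLM : RadialL2 →L[ℝ] ℝ)‖ * ‖P.invSqrtOp‖ + |P.massCoef|)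
      * ‖unitProfile‖ + 1), ⟨?_, ?_, hzc, hzC, hRd, hVc, ?_, ?_, ?_, ?_, ?_, hz0, hR0, hV0⟩, ?_⟩
  · exact huc.continuousOn.add (hzc.smul continuousOn_const)
  · exact huC.add (hzC.smul contDiffOn_const)
  · exact fun t ht => (hVd' t ht).differentiableAt.differentiableWithinAt
  · intro t ht
    refine ⟨-P.kbar⁻¹ • P.sqrtOp (q t), hasRadialLaplacian_of_inner_sineVec fun n => ?_, ?_⟩
    · rw [add_sub_cancel_right, huq t ht, inner_greenOp, inner_smul_right]
      have hk := P.kbar_pos.ne'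
      have hn := (waveNum_pos n).ne'
      unfold thermalRate
      field_simp
    · have hzd : HasDerivAt z (deriv z t) t :=
        ((hzC.differentiableOn one_ne_zero).differentiableAt (Ioi_mem_nhds ht)).hasDerivAt
      have h2 := (hud t ht).add (hzd.smul_const unitProfile)
      rw [show (fun t => u t + z t • unitProfile) = u + fun t => z t • unitProfile from rfl,
        h2.deriv]
      have h3 : -(P.theta * deriv z t) • unitProfile - P.sqrtOp (q t) + deriv z t • unitProfile
          = P.kbar • (-P.kbar⁻¹ • P.sqrtOp (q t)) + (1 / P.gam * deriv z t) • unitProfile := by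
        have hk := P.kbar_pos.ne'
        rw [← one_sub_theta, smul_smul, mul_neg, mul_inv_cancel₀ hk]
        module
      rw [h3]
      filter_upwards [Lp.coeFn_add (P.kbar • (-P.kbar⁻¹ • P.sqrtOp (q t)))
          ((1 / P.gam * deriv z t) • unitProfile),
        Lp.coeFn_smul P.kbar (-P.kbar⁻¹ • P.sqrtOp (q t)),
        Lp.coeFn_smul (1 / P.gam * deriv z t) unitProfile, unitProfile_ae] with y e1 e2 e3 e4
      rw [e1, Pi.add_apply, e2, e3, Pi.smul_apply, Pi.smul_apply, e4]
      simp [kbar]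
  · intro t ht
    rw [← inner_unitProfile, inner_add_right, inner_smul_right, real_inner_self_eq_norm_sq,
      norm_unitProfile_sq]
    have h2 : inner ℝ unitProfile (u t) = 4 * Real.pi / 3 * m t := by
      simp only [hm, meanCLM_apply]
      field_simp
    rw [h2]
    simp only [hz]
    unfold massCoef
    field_simp
    ring
  · intro t ht
    exact P.stress_iff.2 (hVd' t ht).deriv
  · rw [hu0, hz0, sub_add_cancel]
  · intro t ht
    have hWn : ‖W t‖ = ‖w t‖ := LinearIsometryEquiv.norm_map _ _
    have h2 : ‖u t‖ ≤ ‖P.invSqrtOp‖ * ‖w t‖ := by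
      rw [← hWn]; exact P.invSqrtOp.le_opNorm _
    set N := ‖w t‖ + |R t| + |V t| with hN
    have hwN : ‖w t‖ ≤ N := by
      have := abs_nonneg (R t); have := abs_nonneg (V t); linarith
    have hRN : |R t| ≤ N := by
      have := norm_nonneg (w t); have := abs_nonneg (V t); linarith
    have hRVN : |R t| + |V t| ≤ N := by
      have := norm_nonneg (w t); linarith
    have h3 : ‖u t‖ ≤ ‖P.invSqrtOp‖ * N := h2.trans (by gcongr)
    have h4 : |m t| ≤ ‖(meanCLM : RadialL2 →L[ℝ] ℝ)‖ * (‖P.invSqrtOp‖ * N) :=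
      (meanCLM.le_opNorm (u t)).trans (by gcongr)
    have h5 : |z t| ≤ (‖(meanCLM : RadialL2 →L[ℝ] ℝ)‖ * ‖P.invSqrtOp‖ + |P.massCoef|) * N := by
      calc |z t| ≤ |-m t| + |P.massCoef * R t| := abs_sub _ _
        _ ≤ ‖(meanCLM : RadialL2 →L[ℝ] ℝ)‖ * (‖P.invSqrtOp‖ * N) + |P.massCoef| * N := by
          rw [abs_neg, abs_mul]; gcongr
        _ = _ := by ring
    have h6 : ‖u t + z t • unitProfile‖ ≤ ‖P.invSqrtOp‖ * N
        + (‖(meanCLM : RadialL2 →L[ℝ] ℝ)‖ * ‖P.invSqrtOp‖ + |P.massCoef|) * N * ‖unitProfile‖ := by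
      refine (norm_add_le _ _).trans (add_le_add h3 ?_)
      rw [norm_smul, Real.norm_eq_abs]
      gcongr
    set D := ‖P.invSqrtOp‖ + (‖(meanCLM : RadialL2 →L[ℝ] ℝ)‖ * ‖P.invSqrtOp‖ + |P.massCoef|)
      * ‖unitProfile‖ + 1 with hD
    have hD0 : 0 ≤ D := by positivity
    calc ‖u t + z t • unitProfile‖ + |R t| + |V t| ≤ D * N := by rw [hD]; linarith
      _ ≤ D * (C * Real.exp (-P.decayRate ε (rateError ε P.errArg) * t)) := by
        gcongr; exact hdecay t ht
      _ = _ := by ring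

end BubbleParams

end Existence

theorem theorem4p1 :
    -- unique global solvability
    (∀ (P : BubbleParams) (d : BubbleData), d.MassConstraint P →
      (∃ (ϱ : ℝ → RadialL2) (z 𝓡 V : ℝ → ℝ), IsLinearizedSolution P d ϱ z 𝓡 V) ∧
      (∀ (ϱ ϱ' : ℝ → RadialL2) (z 𝓡 V z' 𝓡' V' : ℝ → ℝ),
        IsLinearizedSolution P d ϱ z 𝓡 V → IsLinearizedSolution P d ϱ' z' 𝓡' V' →
        ∀ t, 0 ≤ t → ϱ t = ϱ' t ∧ z t = z' t ∧ 𝓡 t = 𝓡' t ∧ V t = V' t)) ∧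
    -- exponential decay; `E ε x` is the term `O(x^{3/2})`, with an absolute constant `K`
    (∃ (K : ℝ) (E : ℝ → ℝ → ℝ),
      (∀ ε x : ℝ, 0 < ε → ε < 1 → 0 < x → |E ε x| ≤ K * x ^ (3 / 2 : ℝ)) ∧
      ∀ (P : BubbleParams) (ε : ℝ), 0 < ε → ε < 1 →
        0 < P.decayRate ε (E ε P.errArg) ∧
        ∀ d : BubbleData, d.MassConstraint P →
          ∃ C₀ : ℝ, ∀ (ϱ : ℝ → RadialL2) (z 𝓡 V : ℝ → ℝ),
            IsLinearizedSolution P d ϱ z 𝓡 V →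
            ∀ t, 0 < t →
              ‖ϱ t‖ + |𝓡 t| + |V t| ≤ C₀ * Real.exp (-(P.decayRate ε (E ε P.errArg)) * t)) := by
  refine ⟨fun P d hd => ⟨?_, fun ϱ ϱ' z R V z' R' V' h h' t ht => h.unique h' t ht⟩,
    4 * Real.pi ^ 4 / 90 * 3, rateError, fun ε x _ h1 hx => abs_rateError_le h1 hx,
    fun P ε h0 h1 => ⟨P.decayRate_pos h0 h1 _, fun d hd => ?_⟩⟩
  · obtain ⟨ϱ, z, R, V, -, h, -⟩ :=
      -- For existence alone any ε in (0,1) serves.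
      BubbleParams.exists_solution_with_decay (ε := 1 / 2) (by norm_num) (by norm_num) hd
    exact ⟨ϱ, z, R, V, h⟩
  · obtain ⟨ϱ, z, R, V, C, h, hC⟩ := BubbleParams.exists_solution_with_decay h0 h1 hd
    refine ⟨C, fun ϱ' z' R' V' h' t ht => ?_⟩
    -- By uniqueness the bound for the constructed solution holds for every solution, so the
    -- constant depends only on the data, the parameters and ε.
    obtain ⟨e1, -, e2, e3⟩ := h'.unique h t ht.le
    rw [e1, e2, e3]
    exact hC t ht.le

end
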